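/- Let $p$ be a prime, $\mathbb{C}_p$ the completion of an algebraic closure of $\mathbb{Q}_p$, and $\mathbb{P}(\mathbb{C}_p)=\mathbb{C}_p\cup\{\infty\}$. Let $R\in\mathbb{C}_p(z)$ be a rational function of degree at least two. **Balls and analytic spaces.** Open (resp. closed) balls of $\mathbb{C}_p$ are the sets $\{|z-a|<r\}$ (resp. $\{|z-a|\le r\}$) with $r\in|\mathbb{C}_p^*|$; irrational balls are the sets $\{|z-a|<r\}$ with $r>0$, $r\notin|\mathbb{C}_p^*|$. An open (resp. closed, irrational) ball of $\mathbb{P}(\mathbb{C}_p)$ is a ball of $\mathbb{C}_p$ of the same kind or the complement of a closed (resp. open, irrational) ball of $\mathbb{C}_p$. An open affinoid is a nonempty finite intersection of open balls of $\mathbb{P}(\mathbb{C}_p)$; an open analytic space is a union of a nonempty family of open affinoids that all contain one common point. **Ends.** A vanishing chain is a sequence $\{B\setminus B_i\}_{i\ge 0}$ of nonempty sets, where the $B_i$ form an increasing sequence of closed or irrational balls whose union $B$ is an open ball, an irrational ball, or $\mathbb{P}(\mathbb{C}_p)$. Two chains are equivalent if for all $N$ there is $n\ge N$ with $B_N\subset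 B'_n$ and $B'_N\subset B_n$. An end $\mathcal P$ is an equivalence class of vanishing chains; it determines $B_{\mathcal P}=B$, and is called rational, irrational or singular according to the three cases for $B$. **The hyperbolic space.** The points of $\mathbb{H}_p$ are the following sets of ends: $\{\mathcal P\}$ with $\mathcal P$ singular (singular points); $\{\mathcal P,\mathcal P'\}$ with $\mathcal P,\mathcal P'$ irrational and $B_{\mathcal P'}=\mathbb{P}(\mathbb{C}_p)\setminus B_{\mathcal P}$ (irrational points); and the sets of the ends of the balls $\varphi(B(\zeta))$, $\zeta\in\mathbb{P}(\overline{\mathbb{F}}_p)$, where $\varphi$ is an automorphism of $\mathbb{P}(\mathbb{C}_p)$ and the $B(\zeta)$ are the residue classes of the integers of $\mathbb{C}_p$ together with $B(\infty)=\{|z|>1\}\cup\{\infty\}$ (rational points). A non-singular point $\mathcal S$ *separates* $X\subset\mathbb{P}(\mathbb{C}_p)$, written $\mathcal S\prec X$, if $X$ meets at least two of the balls $B_{\mathcal P}$, $\mathcal P\in\mathcal S$; for a singular point $\mathcal S=\{\mathcal P\}$, $\mathcal S\prec X$ means that for every vanishing chain $\{D_i\}$ defining $\mathcal P$ one has $D_i\subset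 X$ for all large $i$. **The action of $R$.** Write $\deg_R(x)$ for the multiplicity of $x$ as a preimage of $R(x)$. For an end $\mathcal P$, $R_*(\mathcal P)=\mathcal P'$ and $\deg_R(\mathcal P)=d\ge 1$ mean that for every vanishing chain $\{C_i\}$ defining $\mathcal P$ there is $N$ such that $\{R(C_i)\}_{i\ge N}$ is a vanishing chain defining $\mathcal P'$ and, for $i\ge N$, every point of $R(C_i)$ has exactly $d$ preimages in $C_i$ counted with multiplicity. For $\mathcal S\in\mathbb{H}_p$, $R_*(\mathcal S)$ is the point of $\mathbb{H}_p$ that contains $R_*(\mathcal P)$ for all $\mathcal P\in\mathcal S$. If $\mathcal S$ is singular or irrational, $\deg_R(\mathcal S)=\deg_R(\mathcal P)$ for $\mathcal P\in\mathcal S$. If $\mathcal S$ is rational, parametrize $\mathcal S=\{\mathcal P(\xi)\}$ and $R_*(\mathcal S)=\{\mathcal P'(\xi)\}$ by $\xi\in\mathbb{P}(\overline{\mathbb{F}}_p)$ as above; then $\deg_R(\mathcal S)$ is the degree of the rational function $\widetilde R\in\overline{\mathbb{F}}_p(z)$ with $R_*(\mathcal P(\xi))=\mathcal P'(\widetilde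 R(\xi))$ and $\deg_R(\mathcal P(\xi))=\deg_{\widetilde R}(\xi)$ for all $\xi$. A point $\mathcal S\in\mathbb{H}_p$ is a *repelling periodic point* of $R_*$ if there is $n\ge 1$ with $R_*^n(\mathcal S)=\mathcal S$ and $\deg_{R^n}(\mathcal S)>1$. **Exceptional points.** $E(R)$ is the set of the points of $\mathbb{P}(\mathbb{C}_p)$ that have only finitely many preimages under the iterates of $R$. **Proposition.** Let $X\subset\mathbb{P}(\mathbb{C}_p)$ be an open analytic space. If there is a repelling periodic point $\mathcal S\in\mathbb{H}_p$ of $R_*$ with $\mathcal S\prec X$, then $$\mathbb{P}(\mathbb{C}_p)\setminus E(R)\subset\bigcup_{n\ge 0}R^n(X),$$ where $E(R)$ has at most two elements. -/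

import Mathlib

namespace PadicDynamics

noncomputable section

/-! ### Rational functions acting on the projective line

The projective line over a field `K` is `OnePoint K`, where `∞` is the point `[1, 0]` and `z : K` is
the point `[z, 1]`.  The topology that Mathlib puts on `OnePoint K` is never used. -/

section RationalFunctions

variable {K : Type*} [Field K]

/-- The degree of a rational function. -/
def ratDegree (R : RatFunc K) : ℕ := max R.num.natDegree R.denom.natDegree

open Classical in
/-- The self-map of the projective line given by a rational function. -/
def ratMap (R : RatFunc K) : OnePoint K → OnePoint K
  | some z => if R.denom.eval z = 0 then OnePoint.infty
      else ((R.num.eval z / R.denom.eval z : K) : OnePoint K)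
  | none => if R.denom.natDegree < R.num.natDegree then OnePoint.infty
      else ((R.num.coeff R.denom.natDegree / R.denom.leadingCoeff : K) : OnePoint K)

/-- The polynomial whose roots in `K` are the solutions `z ≠ ∞` of `R z = y`. -/
def fiberPoly (R : RatFunc K) : OnePoint K → Polynomial K
  | some y => R.num - Polynomial.C y * R.denom
  | none => R.denom

/-- The multiplicity of a point `w` as a solution of `R z = y`.  At `w = ∞` it is the number of
solutions, counted with multiplicity, which are missing in `K`. -/
def fiberMult (R : RatFunc K) (y : OnePoint K) : OnePoint K → ℕ
  | some w => (fiberPoly R y).rootMultiplicity w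
  | none => ratDegree R - (fiberPoly R y).natDegree

/-- The local degree of `R` at `w`: the multiplicity of `w` as a preimage of `R w`. -/
def localDegree (R : RatFunc K) (w : OnePoint K) : ℕ := fiberMult R (ratMap R w) w

/-- The composition `Q ∘ R` of two rational functions. -/
def ratComp (Q R : RatFunc K) : RatFunc K :=
  Polynomial.aeval R Q.num / Polynomial.aeval R Q.denom

/-- The `n`-th iterate of a rational function. -/
def ratIter (R : RatFunc K) : ℕ → RatFunc K
  | 0 => RatFunc.X
  | n + 1 => ratComp R (ratIter R n)

/-- `R : X → Y` is of degree `d`: it maps `X` into `Y`, and every point of `Y` has exactly `d`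
preimages in `X`, counted with multiplicity. -/
def IsOfDegree (R : RatFunc K) (X Y : Set (OnePoint K)) (d : ℕ) : Prop :=
  1 ≤ d ∧ Set.MapsTo (ratMap R) X Y ∧
    ∀ y ∈ Y, ∑ᶠ x ∈ {x | x ∈ X ∧ ratMap R x = y}, localDegree R x = d

/-- The exceptional set of `R`: the points with finitely many preimages under the iterates
of `R`. -/
def exceptionalSet (R : RatFunc K) : Set (OnePoint K) :=
  {x | {y | ∃ n : ℕ, (ratMap R)^[n] y = x}.Finite}

end RationalFunctions

variable (p : ℕ) [Fact p.Prime]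

/-- The projective line over `ℂ_[p]`. -/
abbrev PLine := OnePoint ℂ_[p]

variable {p}

/-! ### Balls, open affinoids, open analytic spaces -/

/-- `{z ∈ ℂ_[p] | |z - a| < r}` as a subset of the projective line. -/
def openDisc (a : ℂ_[p]) (r : ℝ) : Set (PLine p) :=
  (fun z : ℂ_[p] => (z : PLine p)) '' {z | ‖z - a‖ < r}

/-- `{z ∈ ℂ_[p] | |z - a| ≤ r}` as a subset of the projective line. -/
def closedDisc (a : ℂ_[p]) (r : ℝ) : Set (PLine p) :=
  (fun z : ℂ_[p] => (z : PLine p)) '' {z | ‖z - a‖ ≤ r}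

/-- An open ball of the projective line: an open ball of `ℂ_[p]` with radius in the value group, or
the complement of a closed ball of `ℂ_[p]` with radius in the value group. -/
def IsOpenBall (B : Set (PLine p)) : Prop :=
  ∃ a c : ℂ_[p], c ≠ 0 ∧ (B = openDisc a ‖c‖ ∨ B = (closedDisc a ‖c‖)ᶜ)

/-- A closed ball of the projective line. -/
def IsClosedBall (B : Set (PLine p)) : Prop :=
  ∃ a c : ℂ_[p], c ≠ 0 ∧ (B = closedDisc a ‖c‖ ∨ B = (openDisc a ‖c‖)ᶜ)

/-- An irrational ball of the projective line: the radius is not in the value group. -/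
def IsIrrationalBall (B : Set (PLine p)) : Prop :=
  ∃ (a : ℂ_[p]) (r : ℝ), 0 < r ∧ (∀ c : ℂ_[p], ‖c‖ ≠ r) ∧
    (B = openDisc a r ∨ B = (openDisc a r)ᶜ)

/-- An open affinoid: a nonempty finite intersection of open balls. -/
def IsOpenAffinoid (Z : Set (PLine p)) : Prop :=
  Z.Nonempty ∧ ∃ F : Set (Set (PLine p)), F.Finite ∧ (∀ B ∈ F, IsOpenBall B) ∧ Z = ⋂₀ F

/-- An open analytic space: a union of open affinoids which all contain one and the same point. -/
def IsOpenAnalyticSpace (X : Set (PLine p)) : Prop :=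
  ∃ (x : PLine p) (F : Set (Set (PLine p))), F.Nonempty ∧
    (∀ Z ∈ F, IsOpenAffinoid Z ∧ x ∈ Z) ∧ X = ⋃₀ F

/-! ### Ends -/

variable (p) in
/-- A vanishing chain `{B - B_i}`: the `B_i` form an increasing sequence of closed or irrational
balls, and their union `B` is an open ball, an irrational ball or the whole projective line.  The
sets `B - B_i` are annuli (or balls, if `B` is everything); in particular they are not empty, which
has to be said when `B` is irrational. -/
structure VanishingChain where
  total : Set (PLine p)
  ball : ℕ → Set (PLine p)
  ball_closed_or_irrational : ∀ i, IsClosedBall (ball i) ∨ IsIrrationalBall (ball i)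
  mono : Monotone ball
  iUnion_ball : ⋃ i, ball i = total
  total_open_or_irrational_or_univ :
    IsOpenBall total ∨ IsIrrationalBall total ∨ total = Set.univ
  ball_ne : ∀ i, ball i ≠ total

/-- The `i`-th term `B - B_i` of a vanishing chain. -/
def VanishingChain.term (C : VanishingChain p) (i : ℕ) : Set (PLine p) := C.total \ C.ball i

/-- Equivalence of vanishing chains. -/
def VanishingChain.Equiv (C C' : VanishingChain p) : Prop :=
  ∀ N, ∃ n, N ≤ n ∧ C.ball N ⊆ C'.ball n ∧ C'.ball N ⊆ C.ball n

theorem VanishingChain.Equiv.total_subset {C C' : VanishingChain p} (h : C.Equiv C') :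
    C.total ⊆ C'.total := by
  rw [← C.iUnion_ball, ← C'.iUnion_ball]
  refine Set.iUnion_subset fun i => ?_
  obtain ⟨n, -, h1, -⟩ := h i
  exact h1.trans (Set.subset_iUnion _ n)

theorem VanishingChain.Equiv.symm {C C' : VanishingChain p} (h : C.Equiv C') : C'.Equiv C :=
  fun N => let ⟨n, hn, h1, h2⟩ := h N; ⟨n, hn, h2, h1⟩

theorem VanishingChain.Equiv.trans {C C' C'' : VanishingChain p} (h : C.Equiv C')
    (h' : C'.Equiv C'') : C.Equiv C'' := by
  intro N
  obtain ⟨n, hn, h1, -⟩ := h N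
  obtain ⟨m, hm, -, h2⟩ := h' N
  obtain ⟨k, hk, h3, -⟩ := h' n
  obtain ⟨l, hl, -, h4⟩ := h m
  refine ⟨max k l, hn.trans (hk.trans (le_max_left _ _)), ?_, ?_⟩
  · exact (h1.trans h3).trans (C''.mono (le_max_left _ _))
  · exact (h2.trans h4).trans (C.mono (le_max_right _ _))

instance vanishingChainSetoid : Setoid (VanishingChain p) where
  r := VanishingChain.Equiv
  iseqv :=
    ⟨fun _ N => ⟨N, le_rfl, subset_rfl, subset_rfl⟩, fun h => h.symm, fun h h' => h.trans h'⟩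

variable (p) in
/-- An end is an equivalence class of vanishing chains. -/
def End : Type := Quotient (vanishingChainSetoid (p := p))

/-- The end that a vanishing chain defines. -/
def VanishingChain.toEnd (C : VanishingChain p) : End p := Quotient.mk _ C

/-- The set `B_P` of an end `P`: the common union `B` of the vanishing chains defining `P`. -/
def End.ball (P : End p) : Set (PLine p) :=
  Quotient.lift VanishingChain.total
    (fun _ _ h => Set.Subset.antisymm (VanishingChain.Equiv.total_subset h)
      (VanishingChain.Equiv.total_subset (VanishingChain.Equiv.symm h))) P

def End.IsSingular (P : End p) : Prop := P.ball = Set.univ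

def End.IsIrrational (P : End p) : Prop := IsIrrationalBall P.ball

/-! ### The hyperbolic space -/

variable (p) in
/-- The residue field of `ℂ_[p]`. -/
abbrev ResidueField := IsLocalRing.ResidueField 𝓞_ℂ_[p]

/-- The balls `B(ζ)` of the canonical partition: `B(ζ)` is the residue class of `ζ` if `ζ ≠ ∞`, and
`B(∞) = {|z| > 1} ∪ {∞}`. -/
def canonicalBall : OnePoint (ResidueField p) → Set (PLine p)
  | some ζ => (fun z : 𝓞_ℂ_[p] => ((z : ℂ_[p]) : PLine p)) '' {z | IsLocalRing.residue _ z = ζ}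
  | none => (closedDisc 0 1)ᶜ

open Classical in
/-- `e` is a parametrization `ζ ↦ φ_* (P(ζ))` of the set of ends `S` by the projective line over the
residue field, for an automorphism `φ` of the projective line.  Here `P(ζ)` is the end of
the open ball `B(ζ)`, so that `φ_* (P(ζ))` is the end of the open ball `φ(B(ζ))`. -/
def IsParametrization (S : Set (End p)) (e : OnePoint (ResidueField p) → End p) : Prop :=
  S = Set.range e ∧ ∃ φ : GL (Fin 2) ℂ_[p],
    ∀ ζ, (e ζ).ball = (fun z : PLine p => φ • z) '' canonicalBall ζ

def IsSingularPoint (S : Set (End p)) : Prop := ∃ P : End p, P.IsSingular ∧ S = {P}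

def IsIrrationalPoint (S : Set (End p)) : Prop :=
  ∃ P P' : End p, P.IsIrrational ∧ P'.IsIrrational ∧ P'.ball = P.ballᶜ ∧ S = {P, P'}

def IsRationalPoint (S : Set (End p)) : Prop := ∃ e, IsParametrization S e

variable (p) in
/-- The `p`-adic hyperbolic space; its points are sets of ends. -/
def HypSpace : Type :=
  {S : Set (End p) // IsSingularPoint S ∨ IsIrrationalPoint S ∨ IsRationalPoint S}

/-- The relation `S ≺ X`.  If `S` is not singular it says that `S` separates `X`, that is, `X` meets
at least two of the balls associated with `S`. -/
def HypSpace.Separates (S : HypSpace p) (X : Set (PLine p)) : Prop :=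
  (¬ IsSingularPoint S.1 ∧
    ∃ P ∈ S.1, ∃ P' ∈ S.1, P ≠ P' ∧ (P.ball ∩ X).Nonempty ∧ (P'.ball ∩ X).Nonempty) ∨
  (IsSingularPoint S.1 ∧
    ∀ C : VanishingChain p, C.toEnd ∈ S.1 → ∃ N, ∀ i, N ≤ i → C.term i ⊆ X)

/-! ### The action of a rational function on ends and points -/

/-- `R_* P = P'` and `deg_R P = d`: for every vanishing chain `{C_i}` defining `P`, a tail of
`{R(C_i)}` is a vanishing chain defining `P'`, and `R : C_i → R(C_i)` is of degree `d` along this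
tail. -/
def EndMapsTo (R : RatFunc ℂ_[p]) (P P' : End p) (d : ℕ) : Prop :=
  1 ≤ d ∧ ∀ C : VanishingChain p, C.toEnd = P → ∃ N : ℕ,
    (∃ C' : VanishingChain p, C'.toEnd = P' ∧ ∀ i, C'.term i = ratMap R '' C.term (N + i)) ∧
    ∀ i, N ≤ i → IsOfDegree R (C.term i) (ratMap R '' C.term i) d

/-- `R_* S = S'`: the action of `R` on ends maps the elements of `S` to elements of `S'`.  (Every end
belongs to exactly one point of the hyperbolic space, so this determines `S'`.) -/
def PointMapsTo (R : RatFunc ℂ_[p]) (S S' : HypSpace p) : Prop :=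
  ∀ P ∈ S.1, ∃ P' ∈ S'.1, ∃ d, EndMapsTo R P P' d

/-- `R_*^n S = S'`. -/
def PointIterMapsTo (R : RatFunc ℂ_[p]) : ℕ → HypSpace p → HypSpace p → Prop
  | 0, S, S' => S = S'
  | n + 1, S, S' => ∃ S'', PointIterMapsTo R n S S'' ∧ PointMapsTo R S'' S'

/-- `deg_R S = d`.  For a singular or irrational point `S`, this is the degree of `R` at each of the
ends in `S`.  For a rational point `S`, it is the degree of the rational function over the residue
field which describes the action of `R` on the ends in `S`. -/
def HasPointDegree (R : RatFunc ℂ_[p]) (S : HypSpace p) (d : ℕ) : Prop :=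
  ((IsSingularPoint S.1 ∨ IsIrrationalPoint S.1) ∧ ∀ P ∈ S.1, ∃ P', EndMapsTo R P P' d) ∨
  ∃ (S' : HypSpace p) (e e' : OnePoint (ResidueField p) → End p) (r : RatFunc (ResidueField p)),
    IsParametrization S.1 e ∧ IsParametrization S'.1 e' ∧
    (∀ ζ, EndMapsTo R (e ζ) (e' (ratMap r ζ)) (localDegree r ζ)) ∧ d = ratDegree r

/-- `S` is a repelling periodic point of `R_*`: there is `n ≥ 1` with `R_*^n S = S` and
`deg_{R^n} S > 1`. -/
def IsRepellingPeriodic (R : RatFunc ℂ_[p]) (S : HypSpace p) : Prop :=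
  ∃ n : ℕ, 1 ≤ n ∧ PointIterMapsTo R n S S ∧ ∃ d : ℕ, 1 < d ∧ HasPointDegree (ratIter R n) S d

end

end PadicDynamics

/-! Let M be the complement of the union of the sets Rⁿ(X). It is backward invariant under every
iterate of R. If M is finite, the backward orbit of each of its points stays in a finite set, so M ⊂
E(R) (`compl_exceptionalSet_subset_of_finite`). The inclusion is thus reduced to the finiteness of
M.

The bound on E(R) does not involve S. The backward orbits of three exceptional points form a finite
backward invariant set, on which R is injective by counting. So each of the three points has a
single preimage, and three fibre polynomials are d-th powers of linear forms. They lie in the pencil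
spanned by numerator and denominator, hence satisfy a linear relation, which is impossible for d ≥ 2
in characteristic 0 (`not_three_totally_ramified`).

For the finiteness, put Q = Rⁿ, where n is a period of S. Near the boundary of a ball, in a suitable
coordinate, Q is a quotient N/D whose norm is c|t|^k; this `EdgeMap` controls the zeros of N - bD in
the ball. It rules out irrational repelling points: ρ = |q|ρ^k with k ≥ 2, or ρ⁻¹ = |q|ρ^k, would
put ρ in the value group. At a singular point, the distance from z to Q(z) is constant on small
discs of the chain and less than the radius, which forces degree 1.

So S is rational and its balls partition the line, being indexed by the projective line over the
residue field. Q permutes their ends through a rational function r of degree ≥ 2. An open affinoid Z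
⊂ X that meets two of the balls contains all but finitely many of them, and an annulus at the edge
of each remaining one. Hence M meets finitely many balls and keeps away from their edges. By
backward invariance these balls are totally ramified for r, so k ≥ 2 on each. If the zeros of N - bD
and N - b'D in the unit disc all lie within δ < 1 of one point, then |b - b'| ≤ δ^k
(`EdgeMap.norm_sub_le`). So the trace of M on the image ball has diameter at most the square of the
diameter of its trace on the source ball. Diameters below 1 that are permuted in this way are all 0:
M has at most one point in each of finitely many balls (`finite_of_preimage_subset`). -/

namespace PadicDynamics

noncomputable section

open Polynomial

/-! ### Rational maps in homogeneous coordinates, fibres and critical points. -/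

section Algebra

variable {K : Type*} [Field K]

open Classical in
/-- The point `[x, y]` of the projective line. -/
def homPoint (x y : K) : OnePoint K := if y = 0 then OnePoint.infty else ((x / y : K) : OnePoint K)

theorem homPoint_one (x : K) : homPoint x 1 = (x : OnePoint K) := by
  simp [homPoint]

theorem homPoint_zero (x : K) : homPoint x 0 = OnePoint.infty := by
  simp [homPoint]

open Classical in
theorem ratMap_coe (R : RatFunc K) (z : K) : ratMap R (z : OnePoint K) =
    if R.denom.eval z = 0 then OnePoint.infty
      else ((R.num.eval z / R.denom.eval z : K) : OnePoint K) := rfl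

open Classical in
theorem ratMap_infty_eq_ite (R : RatFunc K) : ratMap R OnePoint.infty =
    if R.denom.natDegree < R.num.natDegree then OnePoint.infty
      else ((R.num.coeff R.denom.natDegree / R.denom.leadingCoeff : K) : OnePoint K) := rfl

theorem exists_homPoint_eq (z : OnePoint K) :
    ∃ x y : K, (x ≠ 0 ∨ y ≠ 0) ∧ homPoint x y = z := by
  cases z with
  | infty => exact ⟨1, 0, by simp, homPoint_zero 1⟩
  | coe z => exact ⟨z, 1, by simp, homPoint_one z⟩

theorem homPoint_mul_mul {c : K} (hc : c ≠ 0) (x y : K) :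
    homPoint (c * x) (c * y) = homPoint x y := by
  unfold homPoint
  by_cases hy : y = 0
  · simp [hy]
  · rw [if_neg hy, if_neg (mul_ne_zero hc hy), mul_div_mul_left _ _ hc]

theorem homPoint_eq_homPoint_iff {x y x' y' : K} (h : x ≠ 0 ∨ y ≠ 0) (h' : x' ≠ 0 ∨ y' ≠ 0) :
    homPoint x y = homPoint x' y' ↔ x * y' = x' * y := by
  unfold homPoint
  by_cases hy : y = 0 <;> by_cases hy' : y' = 0
  · simp [hy, hy']
  · have hx : x ≠ 0 := by simpa [hy] using h
    simp [hy, hy', hx]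
  · have hx : x' ≠ 0 := by simpa [hy'] using h'
    simp [hy, hy', hx]
  · simp [hy, hy', div_eq_div_iff]

/-- The homogeneous form of degree `d` associated with a polynomial `A`, evaluated at `(x, y)`. -/
def homForm {S : Type*} [CommRing S] [Algebra K S] (d : ℕ) (A : K[X]) (x y : S) : S :=
  ∑ i ∈ Finset.range (d + 1), algebraMap K S (A.coeff i) * x ^ i * y ^ (d - i)

theorem map_homForm {S T : Type*} [CommRing S] [Algebra K S] [CommRing T] [Algebra K T]
    (f : S →ₐ[K] T) (d : ℕ) (A : K[X]) (x y : S) :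
    f (homForm d A x y) = homForm d A (f x) (f y) := by
  simp [homForm, map_sum]

theorem eval_homForm (d : ℕ) (A x y : K[X]) (t : K) :
    (homForm d A x y).eval t = homForm d A (x.eval t) (y.eval t) := by
  have := map_homForm (aeval t : K[X] →ₐ[K] K) d A x y
  simpa [coe_aeval_eq_eval] using this

theorem homForm_zero_right {S : Type*} [CommRing S] [Algebra K S] (d : ℕ) (A : K[X]) (x : S) :
    homForm d A x 0 = algebraMap K S (A.coeff d) * x ^ d := by
  unfold homForm
  rw [Finset.sum_eq_single d]
  · simp
  · intro i hi hne
    have : d - i ≠ 0 := by have := Finset.mem_range.1 hi; omega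
    simp [this]
  · simp

theorem homForm_mul_mul {S : Type*} [CommRing S] [Algebra K S] (d : ℕ) (A : K[X]) (c x y : S) :
    homForm d A (c * x) (c * y) = c ^ d * homForm d A x y := by
  unfold homForm
  rw [Finset.mul_sum]
  refine Finset.sum_congr rfl fun i hi => ?_
  have : c ^ d = c ^ i * c ^ (d - i) := by
    rw [← pow_add]; congr 1; have := Finset.mem_range.1 hi; omega
  rw [mul_pow, mul_pow, this]
  ring

theorem homForm_one_right {S : Type*} [CommRing S] [Algebra K S] {d : ℕ} {A : K[X]}
    (hA : A.natDegree ≤ d) (x : S) : homForm d A x 1 = aeval x A := by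
  rw [aeval_eq_sum_range' (Nat.lt_succ_of_le hA)]
  simp [homForm, Algebra.smul_def]

theorem homForm_eq_mul_aeval {L : Type*} [Field L] [Algebra K L] {d : ℕ} {A : K[X]}
    (hA : A.natDegree ≤ d) (x : L) {y : L} (hy : y ≠ 0) :
    homForm d A x y = y ^ d * aeval (x / y) A := by
  rw [← homForm_one_right hA, ← homForm_mul_mul, mul_one, mul_div_cancel₀ _ hy]

theorem homForm_C_mul {S : Type*} [CommRing S] [Algebra K S] (d : ℕ) (c : K) (A : K[X]) (x y : S) :
    homForm d (C c * A) x y = algebraMap K S c * homForm d A x y := by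
  simp [homForm, Finset.mul_sum, mul_assoc]

/-- `A` and `B` have no common zero on the projective line as forms of degree `d`. -/
structure IsFormPair (d : ℕ) (A B : K[X]) : Prop where
  coprime : IsCoprime A B
  natDegree_left : A.natDegree ≤ d
  natDegree_right : B.natDegree ≤ d
  coeff_ne : A.coeff d ≠ 0 ∨ B.coeff d ≠ 0

theorem IsCoprime.eval_ne {A B : K[X]} (h : IsCoprime A B) (t : K) :
    A.eval t ≠ 0 ∨ B.eval t ≠ 0 := by
  obtain ⟨u, v, huv⟩ := h
  by_contra! hc
  have := congrArg (eval t) huv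
  simp [hc.1, hc.2] at this

theorem isCoprime_of_eval_ne [IsAlgClosed K] {A B : K[X]}
    (h : ∀ t, A.eval t ≠ 0 ∨ B.eval t ≠ 0) : IsCoprime A B := by
  refine isCoprime_of_irreducible_dvd ?_ ?_
  · rintro ⟨rfl, rfl⟩
    simpa using h 0
  · intro q hq h1 h2
    obtain ⟨t, ht⟩ := IsAlgClosed.exists_root q hq.degree_pos.ne'
    rcases h t with h' | h'
    · exact h' ((IsRoot.dvd ht h1))
    · exact h' ((IsRoot.dvd ht h2))

theorem IsFormPair.homForm_ne {d : ℕ} {A B : K[X]} (h : IsFormPair d A B) {x y : K}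
    (hxy : x ≠ 0 ∨ y ≠ 0) : homForm d A x y ≠ 0 ∨ homForm d B x y ≠ 0 := by
  by_cases hy : y = 0
  · subst hy
    have hx : x ≠ 0 := by simpa using hxy
    simpa [homForm_zero_right, hx] using h.coeff_ne
  · rw [homForm_eq_mul_aeval h.natDegree_left _ hy, homForm_eq_mul_aeval h.natDegree_right _ hy]
    simpa [hy, coe_aeval_eq_eval] using IsCoprime.eval_ne h.coprime (x / y)

theorem isFormPair_num_denom (R : RatFunc K) : IsFormPair (ratDegree R) R.num R.denom := by
  refine ⟨RatFunc.isCoprime_num_denom R, le_max_left _ _, le_max_right _ _, ?_⟩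
  unfold ratDegree
  rcases le_total R.num.natDegree R.denom.natDegree with h | h
  · right
    rw [max_eq_right h]
    exact leadingCoeff_ne_zero.2 R.denom_ne_zero
  · by_cases h0 : R.num = 0
    · right
      simp [RatFunc.num_eq_zero_iff.1 h0]
    · left
      rw [max_eq_left h]
      exact leadingCoeff_ne_zero.2 h0

/-- Homogeneous coordinates absorb the case distinctions in `ratMap`: at [x, 0] the two forms reduce
to their coefficients of index d, which are not both zero. -/
theorem ratMap_homPoint_of_isFormPair {R : RatFunc K} {d : ℕ}
    (h : IsFormPair d R.num R.denom) {x y : K} (hxy : x ≠ 0 ∨ y ≠ 0) :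
    ratMap R (homPoint x y) = homPoint (homForm d R.num x y) (homForm d R.denom x y) := by
  by_cases hy : y = 0
  · subst hy
    have hx : x ≠ 0 := by simpa using hxy
    rw [homPoint_zero, homForm_zero_right, homForm_zero_right, mul_comm, mul_comm _ (x ^ d),
      homPoint_mul_mul (pow_ne_zero _ hx)]
    rw [ratMap_infty_eq_ite]
    unfold homPoint
    simp only [Algebra.algebraMap_self, RingHom.id_apply]
    split_ifs with h1 h2 h2
    · rfl
    · exact absurd h.natDegree_left (not_le.2 (h1.trans_le' (le_natDegree_of_ne_zero h2)))
    · exfalso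
      have h3 : d ≤ R.num.natDegree := le_natDegree_of_ne_zero (by simpa [h2] using h.coeff_ne)
      have h4 : R.denom.natDegree = d := le_antisymm h.natDegree_right (h3.trans (not_lt.1 h1))
      rw [← h4] at h2
      exact R.denom_ne_zero (leadingCoeff_eq_zero.1 h2)
    · have h4 : R.denom.natDegree = d := le_antisymm h.natDegree_right (le_natDegree_of_ne_zero h2)
      rw [leadingCoeff, h4]
  · rw [homForm_eq_mul_aeval h.natDegree_left _ hy, homForm_eq_mul_aeval h.natDegree_right _ hy,
      homPoint_mul_mul (pow_ne_zero _ hy)]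
    unfold homPoint
    rw [if_neg hy, ratMap_coe]
    by_cases h0 : R.denom.eval (x / y) = 0 <;> simp [coe_aeval_eq_eval, h0]

theorem ratMap_homPoint (R : RatFunc K) {x y : K} (hxy : x ≠ 0 ∨ y ≠ 0) :
    ratMap R (homPoint x y) =
      homPoint (homForm (ratDegree R) R.num x y) (homForm (ratDegree R) R.denom x y) :=
  ratMap_homPoint_of_isFormPair (isFormPair_num_denom R) hxy

/-- The self-map of the projective line given by a quotient of coprime polynomials. -/
theorem ratMap_homPoint_of_eq_div {R : RatFunc K} {d : ℕ} {A B : K[X]} (h : IsFormPair d A B)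
    (hB : B ≠ 0) (hR : R = algebraMap _ (RatFunc K) A / algebraMap _ (RatFunc K) B)
    {x y : K} (hxy : x ≠ 0 ∨ y ≠ 0) :
    ratMap R (homPoint x y) = homPoint (homForm d A x y) (homForm d B x y) := by
  -- Both fractions are in lowest terms, so they differ by a constant factor, which the projective
  -- point does not see.
  have h1 : R.num * B = A * R.denom := (RatFunc.num_mul_eq_mul_denom_iff hB).2 hR
  have h2 : R.denom ∣ B := R.isCoprime_num_denom.symm.dvd_of_dvd_mul_left ⟨A, by rw [h1]; ring⟩
  have h3 : B ∣ R.denom := h.coprime.symm.dvd_of_dvd_mul_left ⟨R.num, by rw [← h1]; ring⟩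
  obtain ⟨u, hu⟩ := associated_of_dvd_dvd h2 h3
  obtain ⟨c, hc, hcu⟩ := Polynomial.isUnit_iff.1 u.isUnit
  have hc0 : c ≠ 0 := hc.ne_zero
  have hB' : B = C c * R.denom := by rw [← hu, ← hcu, mul_comm]
  have hA' : A = C c * R.num := by
    have : A * R.denom = (C c * R.num) * R.denom := by rw [← h1, hB']; ring
    exact mul_right_cancel₀ R.denom_ne_zero this
  have h' : IsFormPair d R.num R.denom := by
    refine ⟨R.isCoprime_num_denom, ?_, ?_, ?_⟩
    · simpa [hA', natDegree_C_mul hc0] using h.natDegree_left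
    · simpa [hB', natDegree_C_mul hc0] using h.natDegree_right
    · simpa [hA', hB', hc0] using h.coeff_ne
  rw [ratMap_homPoint_of_isFormPair h' hxy, hA', hB', homForm_C_mul, homForm_C_mul,
    homPoint_mul_mul (by simpa using hc0)]

theorem ratMap_coe_eq_coe_iff (R : RatFunc K) (z w : K) :
    ratMap R (z : OnePoint K) = (w : OnePoint K) ↔ R.num.eval z = w * R.denom.eval z := by
  rw [ratMap_coe]
  have h := IsCoprime.eval_ne R.isCoprime_num_denom z
  split_ifs with h0
  · simp [h0] at h ⊢
    exact h
  · rw [OnePoint.coe_eq_coe, div_eq_iff h0]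

theorem ratMap_coe_eq_infty_iff (R : RatFunc K) (z : K) :
    ratMap R (z : OnePoint K) = OnePoint.infty ↔ R.denom.eval z = 0 := by
  rw [ratMap_coe]
  split_ifs with h0 <;> simp [h0]

/-- Two polynomials describe `f : K → ℙ¹(K)`: the point `f t` is `[A t, B t]`. -/
structure IsRep (f : K → OnePoint K) (A B : K[X]) : Prop where
  coprime : IsCoprime A B
  eq : ∀ t, f t = homPoint (A.eval t) (B.eval t)

theorem IsRep.ratMap_comp [IsAlgClosed K] {f : K → OnePoint K} {A B : K[X]} (h : IsRep f A B)
    (R : RatFunc K) : IsRep (fun t => ratMap R (f t)) (homForm (ratDegree R) R.num A B)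
      (homForm (ratDegree R) R.denom A B) := by
  refine ⟨isCoprime_of_eval_ne fun t => ?_, fun t => ?_⟩
  · rw [eval_homForm, eval_homForm]
    exact (isFormPair_num_denom R).homForm_ne (IsCoprime.eval_ne h.coprime t)
  · rw [eval_homForm, eval_homForm, h.eq]
    exact ratMap_homPoint R (IsCoprime.eval_ne h.coprime t)

/-! ### Surjectivity, fibres, composition -/

theorem natDegree_fiberPoly_le (R : RatFunc K) (y : OnePoint K) :
    (fiberPoly R y).natDegree ≤ ratDegree R := by
  cases y with
  | infty => exact le_max_right _ _
  | coe y =>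
    refine (natDegree_sub_le _ _).trans (max_le (le_max_left _ _) ?_)
    exact (natDegree_C_mul_le _ _).trans (le_max_right _ _)

theorem coe_isRoot_fiberPoly_iff (R : RatFunc K) (y : OnePoint K) (w : K) :
    (fiberPoly R y).eval w = 0 ↔ ratMap R (w : OnePoint K) = y := by
  cases y with
  | infty => exact (ratMap_coe_eq_infty_iff R w).symm
  | coe y =>
    rw [ratMap_coe_eq_coe_iff]
    change (R.num - C y * R.denom).eval w = 0 ↔ _
    simp [sub_eq_zero]

theorem ratMap_infty (R : RatFunc K) : ratMap R OnePoint.infty =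
    homPoint (R.num.coeff (ratDegree R)) (R.denom.coeff (ratDegree R)) := by
  have := ratMap_homPoint R (x := 1) (y := 0) (by simp)
  simpa [homPoint_zero, homForm_zero_right] using this

theorem coeff_fiberPoly_eq_zero_iff (R : RatFunc K) (y : OnePoint K) :
    (fiberPoly R y).coeff (ratDegree R) = 0 ↔ ratMap R OnePoint.infty = y := by
  have h := (isFormPair_num_denom R).coeff_ne
  rw [ratMap_infty]
  cases y with
  | infty =>
    rw [← homPoint_zero (1 : K), homPoint_eq_homPoint_iff h (by simp), homPoint_zero]
    change R.denom.coeff _ = 0 ↔ _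
    simp [eq_comm]
  | coe y =>
    rw [← homPoint_one, homPoint_eq_homPoint_iff h (by simp), homPoint_one]
    change (R.num - C y * R.denom).coeff _ = 0 ↔ _
    simp [sub_eq_zero]

theorem fiberPoly_ne_zero (R : RatFunc K) (hR : 1 ≤ ratDegree R) (y : OnePoint K) :
    fiberPoly R y ≠ 0 := by
  cases y with
  | infty => exact R.denom_ne_zero
  | coe y =>
    intro h
    have h1 : R.num = C y * R.denom := sub_eq_zero.1 h
    have h2 : IsUnit R.denom := by
      have := R.isCoprime_num_denom
      rw [h1] at this
      exact this.isUnit_of_dvd' (dvd_mul_left _ _) dvd_rfl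
    have h3 := natDegree_eq_zero_of_isUnit h2
    have h4 : R.num.natDegree ≤ 0 := by
      rw [h1, ← h3]; exact natDegree_C_mul_le _ _
    unfold ratDegree at hR
    omega

theorem natDegree_fiberPoly_lt_iff (R : RatFunc K) (hR : 1 ≤ ratDegree R) (y : OnePoint K) :
    (fiberPoly R y).natDegree < ratDegree R ↔ ratMap R OnePoint.infty = y := by
  rw [← coeff_fiberPoly_eq_zero_iff]
  refine ⟨coeff_eq_zero_of_natDegree_lt, fun h => lt_of_le_of_ne (natDegree_fiberPoly_le R y) ?_⟩
  intro h1
  rw [← h1] at h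
  exact fiberPoly_ne_zero R hR y (leadingCoeff_eq_zero.1 h)

/-- Either the fibre polynomial has degree below `ratDegree R`, and the missing root is ∞, or its
degree is positive and it has a root in K. -/
theorem ratMap_surjective [IsAlgClosed K] (R : RatFunc K) (hR : 1 ≤ ratDegree R) :
    Function.Surjective (ratMap R) := by
  intro y
  by_cases h : (fiberPoly R y).natDegree < ratDegree R
  · exact ⟨_, (natDegree_fiberPoly_lt_iff R hR y).1 h⟩
  · have h0 : (fiberPoly R y).degree ≠ 0 := by
      intro h0
      have := natDegree_eq_of_degree_eq_some (n := 0) h0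
      omega
    obtain ⟨w, hw⟩ := IsAlgClosed.exists_root _ h0
    exact ⟨w, (coe_isRoot_fiberPoly_iff R y w).1 hw⟩

/-- No root is lost at ∞, so the degree is full and all the roots coincide. -/
theorem fiberPoly_eq_of_unique_coe [IsAlgClosed K] (R : RatFunc K) (hR : 1 ≤ ratDegree R)
    {y : OnePoint K} {w : K} (h : ∀ x, ratMap R x = y → x = w) :
    fiberPoly R y = C (fiberPoly R y).leadingCoeff * (X - C w) ^ ratDegree R := by
  have hd : (fiberPoly R y).natDegree = ratDegree R := by
    refine le_antisymm (natDegree_fiberPoly_le R y) (not_lt.1 fun hlt => ?_)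
    exact OnePoint.infty_ne_coe w (h _ ((natDegree_fiberPoly_lt_iff R hR y).1 hlt))
  have hs := IsAlgClosed.splits (fiberPoly R y)
  have hr : (fiberPoly R y).roots = Multiset.replicate (ratDegree R) w := by
    rw [Multiset.eq_replicate, ← hd]
    refine ⟨hs.natDegree_eq_card_roots.symm, fun b hb => ?_⟩
    have := h b ((coe_isRoot_fiberPoly_iff R y b).1 (isRoot_of_mem_roots hb))
    exact OnePoint.coe_injective this
  conv_lhs => rw [hs.eq_prod_roots, hr]
  simp

theorem natDegree_fiberPoly_of_unique_infty [IsAlgClosed K] (R : RatFunc K)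
    {y : OnePoint K} (h : ∀ x, ratMap R x = y → x = OnePoint.infty) :
    (fiberPoly R y).natDegree = 0 := by
  by_contra h0
  have h1 : (fiberPoly R y).degree ≠ 0 := fun h1 => h0 (natDegree_eq_of_degree_eq_some h1)
  obtain ⟨w, hw⟩ := IsAlgClosed.exists_root _ h1
  exact OnePoint.coe_ne_infty w (h _ ((coe_isRoot_fiberPoly_iff R y w).1 hw))

theorem localDegree_eq_ratDegree_of_unique [IsAlgClosed K] (R : RatFunc K) (hR : 1 ≤ ratDegree R)
    {w : OnePoint K} (h : ∀ x, ratMap R x = ratMap R w → x = w) :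
    localDegree R w = ratDegree R := by
  cases w with
  | infty =>
    change ratDegree R - _ = _
    rw [natDegree_fiberPoly_of_unique_infty R h, Nat.sub_zero]
  | coe w =>
    change (fiberPoly R (ratMap R w)).rootMultiplicity w = _
    have h0 := fiberPoly_ne_zero R hR (ratMap R (w : OnePoint K))
    classical
    rw [fiberPoly_eq_of_unique_coe R hR h, ← count_roots,
      roots_C_mul _ (leadingCoeff_ne_zero.2 h0), roots_pow, roots_X_sub_C]
    simp

theorem natDegree_homForm_le (d e : ℕ) (A N D : K[X]) (hN : N.natDegree ≤ e)
    (hD : D.natDegree ≤ e) : (homForm d A N D).natDegree ≤ d * e := by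
  unfold homForm
  refine natDegree_sum_le_of_forall_le _ _ fun i hi => ?_
  have hi' : i ≤ d := by have := Finset.mem_range.1 hi; omega
  calc _ ≤ 0 + i * e + (d - i) * e := by
        refine natDegree_mul_le_of_le (natDegree_mul_le_of_le ?_ ?_) ?_
        · exact (natDegree_C _).le
        · exact natDegree_pow_le_of_le i hN
        · exact natDegree_pow_le_of_le (d - i) hD
    _ = d * e := by rw [zero_add, ← add_mul, Nat.add_sub_cancel' hi']

theorem coeff_homForm (d e : ℕ) (A N D : K[X]) (hN : N.natDegree ≤ e)
    (hD : D.natDegree ≤ e) :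
    (homForm d A N D).coeff (d * e) = homForm d A (N.coeff e) (D.coeff e) := by
  unfold homForm
  rw [finsetSum_coeff]
  refine Finset.sum_congr rfl fun i hi => ?_
  have hi' : i ≤ d := by have := Finset.mem_range.1 hi; omega
  have h1 : d * e = i * e + (d - i) * e := by rw [← add_mul, Nat.add_sub_cancel' hi']
  rw [mul_assoc, h1]
  change (C (A.coeff i) * (N ^ i * D ^ (d - i))).coeff _ = _
  rw [coeff_C_mul, coeff_mul_add_eq_of_natDegree_le (natDegree_pow_le_of_le i hN)
    (natDegree_pow_le_of_le (d - i) hD), coeff_pow_of_natDegree_le hN, coeff_pow_of_natDegree_le hD]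
  simp [mul_assoc]

theorem homForm_homForm (d e : ℕ) (A N D : K[X]) (hN : N.natDegree ≤ e)
    (hD : D.natDegree ≤ e) (x y : K) :
    homForm (d * e) (homForm d A N D) x y = homForm d A (homForm e N x y) (homForm e D x y) := by
  by_cases hy : y = 0
  · subst hy
    rw [homForm_zero_right, homForm_zero_right, homForm_zero_right, coeff_homForm _ _ _ _ _ hN hD,
      mul_comm _ (x ^ e), mul_comm _ (x ^ e), homForm_mul_mul, pow_mul', mul_comm]
    rfl
  · rw [homForm_eq_mul_aeval (natDegree_homForm_le d e A N D hN hD) _ hy,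
      homForm_eq_mul_aeval hN _ hy, homForm_eq_mul_aeval hD _ hy, homForm_mul_mul, map_homForm,
      pow_mul']

theorem exists_eval_ne_zero_and_not_mem [Infinite K] {A : K[X]} (hA : A ≠ 0) {s : Set K}
    (hs : s.Finite) : ∃ t, A.eval t ≠ 0 ∧ t ∉ s := by
  have h : ({t | A.eval t = 0} ∪ s).Finite := by
    refine Set.Finite.union ?_ hs
    exact (A.rootSet_finite K).subset fun t ht => by simpa [mem_rootSet, hA] using ht
  obtain ⟨t, ht⟩ := h.exists_notMem
  simp only [Set.mem_union, Set.mem_ofPred_eq, not_or] at ht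
  exact ⟨t, ht.1, ht.2⟩

/-- Substituting the numerator and denominator of R into the forms of Q gives two forms of degree
d·e without common zero. They are therefore a reduced fraction for the composite and compute it at
every point, including poles and ∞. -/
theorem ratMap_ratComp [IsAlgClosed K] (Q R : RatFunc K) (hR : Function.Surjective (ratMap R)) :
    ratMap (ratComp Q R) = ratMap Q ∘ ratMap R := by
  have hinf : Infinite K := IsAlgClosed.instInfinite
  set d := ratDegree Q
  set e := ratDegree R
  have hP := isFormPair_num_denom R
  have hQ := isFormPair_num_denom Q
  have hd : R.denom ≠ 0 := R.denom_ne_zero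
  have hcop : IsCoprime (homForm d Q.num R.num R.denom) (homForm d Q.denom R.num R.denom) :=
    isCoprime_of_eval_ne fun t => by
      rw [eval_homForm, eval_homForm]
      exact hQ.homForm_ne (IsCoprime.eval_ne hP.coprime t)
  have hpair : IsFormPair (d * e) (homForm d Q.num R.num R.denom)
      (homForm d Q.denom R.num R.denom) := by
    refine ⟨hcop, natDegree_homForm_le _ _ _ _ _ hP.natDegree_left hP.natDegree_right,
      natDegree_homForm_le _ _ _ _ _ hP.natDegree_left hP.natDegree_right, ?_⟩
    rw [coeff_homForm _ _ _ _ _ hP.natDegree_left hP.natDegree_right,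
      coeff_homForm _ _ _ _ _ hP.natDegree_left hP.natDegree_right]
    exact hQ.homForm_ne hP.coeff_ne
  -- A value y that is not a pole of Q and differs from R(∞) has a finite preimage z, and the form
  -- does not vanish at z.
  have hne : homForm d Q.denom R.num R.denom ≠ 0 := by
    intro h0
    obtain ⟨y, hy, hy'⟩ := exists_eval_ne_zero_and_not_mem Q.denom_ne_zero
      (s := {y | ratMap R OnePoint.infty = (y : OnePoint K)})
      (Set.Subsingleton.finite fun a ha b hb => OnePoint.coe_injective (ha.symm.trans hb))
    obtain ⟨z, hz⟩ := hR y
    cases z with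
    | infty => exact hy' hz
    | coe z =>
      rw [ratMap_coe_eq_coe_iff] at hz
      have hz0 : R.denom.eval z ≠ 0 := by
        intro h
        have := IsCoprime.eval_ne hP.coprime z
        simp [hz, h] at this
      have := congrArg (eval z) h0
      rw [eval_homForm, homForm_eq_mul_aeval hQ.natDegree_right _ hz0, hz,
        mul_div_cancel_right₀ _ hz0] at this
      simp [hz0, coe_aeval_eq_eval] at this
      exact hy this
  have haux : ∀ A : K[X], A.natDegree ≤ d → aeval R A =
      algebraMap K[X] (RatFunc K) (homForm d A R.num R.denom) /
        algebraMap K[X] (RatFunc K) R.denom ^ d := by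
    intro A hA
    have hd' : algebraMap K[X] (RatFunc K) R.denom ≠ 0 := by
      simpa using hd
    have h1 := map_homForm (IsScalarTower.toAlgHom K K[X] (RatFunc K)) d A R.num R.denom
    simp only [IsScalarTower.coe_toAlgHom'] at h1
    rw [h1, homForm_eq_mul_aeval hA _ hd', RatFunc.num_div_denom,
      mul_div_cancel_left₀ _ (pow_ne_zero _ hd')]
  have hcomp : ratComp Q R = algebraMap _ (RatFunc K) (homForm d Q.num R.num R.denom) /
      algebraMap _ (RatFunc K) (homForm d Q.denom R.num R.denom) := by
    have hd' : algebraMap K[X] (RatFunc K) R.denom ≠ 0 := by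
      simpa using hd
    unfold ratComp
    rw [haux _ hQ.natDegree_left, haux _ hQ.natDegree_right,
      div_div_div_cancel_right₀ (pow_ne_zero _ hd')]
  funext z
  obtain ⟨x, y, hxy, rfl⟩ := exists_homPoint_eq z
  rw [Function.comp_apply, ratMap_homPoint R hxy, ratMap_homPoint Q (hP.homForm_ne hxy),
    ratMap_homPoint_of_eq_div hpair hne hcomp hxy,
    homForm_homForm _ _ _ _ _ hP.natDegree_left hP.natDegree_right,
    homForm_homForm _ _ _ _ _ hP.natDegree_left hP.natDegree_right]

theorem ratMap_X [IsAlgClosed K] : ratMap (RatFunc.X : RatFunc K) = id := by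
  funext z
  cases z with
  | infty => simp [ratMap_infty_eq_ite]
  | coe z => simp [ratMap_coe]

theorem ratMap_ratIter [IsAlgClosed K] (R : RatFunc K) (hR : Function.Surjective (ratMap R))
    (n : ℕ) : ratMap (ratIter R n) = (ratMap R)^[n] := by
  induction n with
  | zero => exact ratMap_X
  | succ n ih =>
    rw [Function.iterate_succ', ← ih]
    refine ratMap_ratComp _ _ ?_
    rw [ih]
    exact hR.iterate n

/-! ### Critical points -/

theorem finite_setOf_eval_eq_zero {A : K[X]} (hA : A ≠ 0) : {t | A.eval t = 0}.Finite :=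
  (A.rootSet_finite K).subset fun t ht => by simpa [mem_rootSet, hA] using ht

theorem num_sub_C_mul_denom_ne_zero [Infinite K] (R : RatFunc K)
    (hR : Function.Surjective (ratMap R)) (y : K) : R.num - C y * R.denom ≠ 0 := by
  intro h
  have h1 : ∀ z : K, ratMap R z = y := fun z => by
    rw [ratMap_coe_eq_coe_iff, sub_eq_zero.1 h]
    simp
  have h2 : Set.range (ratMap R) ⊆ {(y : OnePoint K), ratMap R OnePoint.infty} := by
    rintro _ ⟨z, rfl⟩
    cases z with
    | infty => simp
    | coe z => simp [h1 z]
  rw [hR.range_eq] at h2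
  exact Set.infinite_univ ((Set.toFinite _).subset h2)

theorem finite_ratMap_preimage [Infinite K] (R : RatFunc K) (hR : Function.Surjective (ratMap R))
    (y : OnePoint K) : {x | ratMap R x = y}.Finite := by
  have h0 : fiberPoly R y ≠ 0 := by
    cases y with
    | infty => exact R.denom_ne_zero
    | coe y => exact num_sub_C_mul_denom_ne_zero R hR y
  refine (((finite_setOf_eval_eq_zero h0).image ((↑) : K → OnePoint K)).insert
    OnePoint.infty).subset ?_
  intro x hx
  cases x with
  | infty => simp
  | coe x => exact Or.inr ⟨x, (coe_isRoot_fiberPoly_iff R y x).2 hx, rfl⟩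

/-- Finite critical points that are not poles are zeros of the Wronskian of numerator and
denominator. In characteristic 0 it can vanish identically only if both polynomials are constant,
and then R takes at most two values. -/
theorem finite_localDegree_ne_one [CharZero K] (R : RatFunc K)
    (hR : Function.Surjective (ratMap R)) : {x | localDegree R x ≠ 1}.Finite := by
  have hw : wronskian R.num R.denom ≠ 0 := by
    intro h
    obtain ⟨h1, h2⟩ := (R.isCoprime_num_denom).wronskian_eq_zero_iff.1 h
    obtain ⟨a, ha⟩ := natDegree_eq_zero.1 (derivative_eq_zero.1 h1)
    obtain ⟨b, hb⟩ := natDegree_eq_zero.1 (derivative_eq_zero.1 h2)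
    have h3 : Set.range (ratMap R) ⊆ {homPoint a b, ratMap R OnePoint.infty} := by
      rintro _ ⟨z, rfl⟩
      cases z with
      | infty => simp
      | coe z =>
        left
        rw [ratMap_coe, ← ha, ← hb, eval_C, eval_C]
        rfl
    rw [hR.range_eq] at h3
    exact Set.infinite_univ ((Set.toFinite _).subset h3)
  refine ((((finite_setOf_eval_eq_zero hw).union
    (finite_setOf_eval_eq_zero R.denom_ne_zero)).image
      ((↑) : K → OnePoint K)).insert OnePoint.infty).subset ?_
  intro x hx
  cases x with
  | infty => simp
  | coe z =>
    refine Or.inr ⟨z, ?_, rfl⟩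
    by_contra hc
    simp only [Set.mem_union, Set.mem_ofPred_eq, not_or] at hc
    obtain ⟨h1, h2⟩ := hc
    apply hx
    set y := R.num.eval z / R.denom.eval z with hy
    have hRz : ratMap R (z : OnePoint K) = (y : OnePoint K) := by
      rw [ratMap_coe, if_neg h2]
    change fiberMult R (ratMap R (z : OnePoint K)) (z : OnePoint K) = 1
    rw [hRz]
    change (R.num - C y * R.denom).rootMultiplicity z = 1
    have h0 := num_sub_C_mul_denom_ne_zero R hR y
    have hroot : (R.num - C y * R.denom).IsRoot z := by
      rw [IsRoot.def, eval_sub, eval_mul, eval_C, hy, div_mul_cancel₀ _ h2, sub_self]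
    refine le_antisymm (not_lt.1 fun hlt => ?_) ((rootMultiplicity_pos h0).2 hroot)
    obtain ⟨-, h5⟩ := (one_lt_rootMultiplicity_iff_isRoot h0).1 hlt
    rw [IsRoot.def] at h5
    simp only [derivative_sub, derivative_C_mul, eval_sub, eval_mul, eval_C] at h5
    apply h1
    have h6 : R.num.eval z = y * R.denom.eval z := by rw [hy, div_mul_cancel₀ _ h2]
    rw [wronskian, eval_sub, eval_mul, eval_mul, h6, sub_eq_zero.1 h5]
    ring

/-- Away from critical values every multiplicity is 1, so the degree counts actual points. -/
theorem ncard_fiber_of_isOfDegree {R : RatFunc K} {Y Z : Set (OnePoint K)} {m : ℕ}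
    (h : IsOfDegree R Y Z m) {x : OnePoint K} (hx : ratMap R x ∈ Z)
    (hx' : ∀ z, localDegree R z ≠ 1 → ratMap R z ≠ ratMap R x) :
    {z | z ∈ Y ∧ ratMap R z = ratMap R x}.ncard = m := by
  rw [← h.2.2 _ hx, ← finsum_one]
  refine finsum_mem_congr rfl fun z hz => ?_
  by_contra hne
  exact hx' z (Ne.symm hne) hz.2

end Algebra

end

end PadicDynamics

namespace PadicDynamics

noncomputable section

open Polynomial

/-! ### The exceptional set. -/

section Exceptional

/-- Counting: |T| = |f(f⁻¹T)| ≤ |f⁻¹T| ≤ |T|, so all are equalities. It is used for exceptional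
points and again for the balls that meet M. -/
theorem preimage_eq_and_injOn_of_preimage_subset {α : Type*} {f : α → α}
    (hf : Function.Surjective f) {T : Set α} (hT : T.Finite) (h : f ⁻¹' T ⊆ T) :
    f ⁻¹' T = T ∧ Set.InjOn f T := by
  have h1 : f '' (f ⁻¹' T) = T := Set.image_preimage_eq T hf
  have h2 : (f ⁻¹' T).ncard ≤ T.ncard := Set.ncard_le_ncard h hT
  have h3 : T.ncard ≤ (f ⁻¹' T).ncard := by
    conv_lhs => rw [← h1]
    exact Set.ncard_image_le (hT.subset h)
  have h4 : f ⁻¹' T = T := Set.eq_of_subset_of_ncard_le h h3 hT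
  refine ⟨h4, Set.injOn_of_ncard_image_eq ?_ hT⟩
  conv_lhs => rw [← h4, h1]

variable {K : Type*} [Field K]

/-- At w₁ both the relation and its derivative lose the first term, because d ≥ 2. Eliminating a₂
between them leaves a₃(w₁ - w₃)^(d-1)(w₂ - w₃) = 0. Characteristic 0 allows division by d. -/
theorem not_three_powers [CharZero K] {a₁ a₂ a₃ w₁ w₂ w₃ : K} {d : ℕ} (hd : 2 ≤ d) (h₃ : a₃ ≠ 0)
    (h13 : w₁ ≠ w₃) (h23 : w₂ ≠ w₃)
    (h : C a₁ * (X - C w₁) ^ d + C a₂ * (X - C w₂) ^ d + C a₃ * (X - C w₃) ^ d = 0) : False := by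
  obtain ⟨e, rfl⟩ : ∃ e, d = e + 2 := ⟨d - 2, by omega⟩
  have e1 := congrArg (eval w₁) h
  have e2 := congrArg (fun q => eval w₁ (derivative q)) h
  simp only [eval_add, eval_mul, eval_C, eval_pow, eval_sub, eval_X, sub_self, derivative_add,
    derivative_C_mul, derivative_pow, derivative_sub, derivative_X, derivative_C, sub_zero,
    mul_one, map_natCast, eval_natCast, derivative_zero, eval_zero] at e1 e2
  have hne : ((e + 2 : ℕ) : K) ≠ 0 := Nat.cast_ne_zero.2 (by omega)
  have e3 : a₂ * (w₁ - w₂) ^ (e + 1) + a₃ * (w₁ - w₃) ^ (e + 1) = 0 := by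
    apply mul_left_cancel₀ hne
    rw [show e + 2 - 1 = e + 1 from rfl] at e2
    rw [zero_pow (Nat.succ_ne_zero e)] at e2
    linear_combination e2
  have e4 : a₃ * (w₁ - w₃) ^ (e + 1) * (w₂ - w₃) = 0 := by
    rw [zero_pow (by omega)] at e1
    linear_combination e1 - (w₁ - w₂) * e3
  have := sub_ne_zero.2 h13
  have := sub_ne_zero.2 h23
  simp_all

/-- This is the case of three powers with one of the points at ∞, where the power degenerates to a
constant. The derivative at w₁ alone gives the contradiction. -/
theorem not_two_powers_const [CharZero K] {a₁ a₂ a₃ w₁ w₂ : K} {d : ℕ} (hd : 2 ≤ d) (h₂ : a₂ ≠ 0)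
    (h12 : w₁ ≠ w₂)
    (h : C a₁ * (X - C w₁) ^ d + C a₂ * (X - C w₂) ^ d + C a₃ = 0) : False := by
  obtain ⟨e, rfl⟩ : ∃ e, d = e + 2 := ⟨d - 2, by omega⟩
  have e2 := congrArg (fun q => eval w₁ (derivative q)) h
  simp only [eval_add, eval_mul, eval_C, eval_pow, eval_sub, eval_X, sub_self, derivative_add,
    derivative_C_mul, derivative_pow, derivative_sub, derivative_X, derivative_C, sub_zero,
    mul_one, map_natCast, eval_natCast, derivative_zero, eval_zero] at e2
  have hne : ((e + 2 : ℕ) : K) ≠ 0 := Nat.cast_ne_zero.2 (by omega)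
  rw [show e + 2 - 1 = e + 1 from rfl, zero_pow (Nat.succ_ne_zero e)] at e2
  have := sub_ne_zero.2 h12
  have := hne
  simp_all

/-- All fibre polynomials lie in the pencil spanned by numerator and denominator, and distinct
points give non-proportional coefficient vectors. Hence no coefficient of the relation is zero. -/
theorem exists_linear_relation_fiberPoly (R : RatFunc K) {y₁ y₂ y₃ : OnePoint K} (h12 : y₁ ≠ y₂)
    (h13 : y₁ ≠ y₃) (h23 : y₂ ≠ y₃) : ∃ a₁ a₂ a₃ : K, a₁ ≠ 0 ∧ a₂ ≠ 0 ∧ a₃ ≠ 0 ∧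
      C a₁ * fiberPoly R y₁ + C a₂ * fiberPoly R y₂ + C a₃ * fiberPoly R y₃ = 0 := by
  have hi : fiberPoly R OnePoint.infty = R.denom := rfl
  have hc : ∀ y : K, fiberPoly R y = R.num - C y * R.denom := fun y => rfl
  cases y₁ with
  | infty =>
    cases y₂ with
    | infty => exact absurd rfl h12
    | coe y₂ =>
      cases y₃ with
      | infty => exact absurd rfl h13
      | coe y₃ =>
        refine ⟨y₃ - y₂, -1, 1, sub_ne_zero.2 fun h => h23 (by rw [h]), by simp, by simp, ?_⟩
        rw [hi, hc, hc]
        simp only [C_sub, C_neg, C_1]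
        ring
  | coe y₁ =>
    cases y₂ with
    | infty =>
      cases y₃ with
      | infty => exact absurd rfl h23
      | coe y₃ =>
        refine ⟨-1, y₃ - y₁, 1, by simp, sub_ne_zero.2 fun h => h13 (by rw [h]), by simp, ?_⟩
        rw [hi, hc, hc]
        simp only [C_sub, C_neg, C_1]
        ring
    | coe y₂ =>
      cases y₃ with
      | infty =>
        refine ⟨-1, 1, y₂ - y₁, by simp, by simp, sub_ne_zero.2 fun h => h12 (by rw [h]), ?_⟩
        rw [hi, hc, hc]
        simp only [C_sub, C_neg, C_1]
        ring
      | coe y₃ =>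
        refine ⟨y₂ - y₃, y₃ - y₁, y₁ - y₂, sub_ne_zero.2 fun h => h23 (by rw [h]),
          sub_ne_zero.2 fun h => h13 (by rw [h]), sub_ne_zero.2 fun h => h12 (by rw [h]), ?_⟩
        rw [hc, hc, hc]
        simp only [C_sub]
        ring

theorem not_three_totally_ramified [IsAlgClosed K] [CharZero K] (R : RatFunc K)
    (hR : 2 ≤ ratDegree R) {y₁ y₂ y₃ w₁ w₂ w₃ : OnePoint K} (h12 : y₁ ≠ y₂) (h13 : y₁ ≠ y₃)
    (h23 : y₂ ≠ y₃) (h₁ : ∀ x, ratMap R x = y₁ → x = w₁) (h₂ : ∀ x, ratMap R x = y₂ → x = w₂)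
    (h₃ : ∀ x, ratMap R x = y₃ → x = w₃) : False := by
  have hR1 : 1 ≤ ratDegree R := by omega
  have hs := ratMap_surjective R hR1
  have key : ∀ {y w}, (∀ x, ratMap R x = y → x = w) → ratMap R w = y := by
    intro y w h
    obtain ⟨x, hx⟩ := hs y
    rw [← h x hx, hx]
  have k₁ := key h₁
  have k₂ := key h₂
  have k₃ := key h₃
  have n12 : w₁ ≠ w₂ := fun h => h12 (by rw [← k₁, ← k₂, h])
  have n13 : w₁ ≠ w₃ := fun h => h13 (by rw [← k₁, ← k₃, h])
  have n23 : w₂ ≠ w₃ := fun h => h23 (by rw [← k₂, ← k₃, h])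
  obtain ⟨a₁, a₂, a₃, ha₁, ha₂, ha₃, hrel⟩ := exists_linear_relation_fiberPoly R h12 h13 h23
  have form : ∀ {y w}, (∀ x, ratMap R x = y → x = w) → ∃ c : K, c ≠ 0 ∧
      (w = OnePoint.infty → fiberPoly R y = C c) ∧
      ∀ w' : K, w = w' → fiberPoly R y = C c * (X - C w') ^ ratDegree R := by
    intro y w h
    refine ⟨(fiberPoly R y).leadingCoeff, leadingCoeff_ne_zero.2 (fiberPoly_ne_zero R hR1 y), ?_, ?_⟩
    · rintro rfl
      have h0 := natDegree_fiberPoly_of_unique_infty R h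
      rw [leadingCoeff, h0]
      exact eq_C_of_natDegree_eq_zero h0
    · rintro w' rfl
      exact fiberPoly_eq_of_unique_coe R hR1 h
  obtain ⟨c₁, hc₁, i₁, f₁⟩ := form h₁
  obtain ⟨c₂, hc₂, i₂, f₂⟩ := form h₂
  obtain ⟨c₃, hc₃, i₃, f₃⟩ := form h₃
  have m₁ := mul_ne_zero ha₁ hc₁
  have m₂ := mul_ne_zero ha₂ hc₂
  have m₃ := mul_ne_zero ha₃ hc₃
  cases w₁ with
  | infty =>
    cases w₂ with
    | infty => exact n12 rfl
    | coe w₂ =>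
      cases w₃ with
      | infty => exact n13 rfl
      | coe w₃ =>
        rw [i₁ rfl, f₂ _ rfl, f₃ _ rfl] at hrel
        refine not_two_powers_const (a₁ := a₂ * c₂) (a₃ := a₁ * c₁) (w₁ := w₂) (w₂ := w₃) hR m₃
          (fun h => n23 (by rw [h])) ?_
        simp only [C_mul]
        linear_combination hrel
  | coe w₁ =>
    cases w₂ with
    | infty =>
      cases w₃ with
      | infty => exact n23 rfl
      | coe w₃ =>
        rw [f₁ _ rfl, i₂ rfl, f₃ _ rfl] at hrel
        refine not_two_powers_const (a₁ := a₁ * c₁) (a₃ := a₂ * c₂) (w₁ := w₁) (w₂ := w₃) hR m₃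
          (fun h => n13 (by rw [h])) ?_
        simp only [C_mul]
        linear_combination hrel
    | coe w₂ =>
      cases w₃ with
      | infty =>
        rw [f₁ _ rfl, f₂ _ rfl, i₃ rfl] at hrel
        refine not_two_powers_const (a₁ := a₁ * c₁) (a₃ := a₃ * c₃) (w₁ := w₁) (w₂ := w₂) hR m₂
          (fun h => n12 (by rw [h])) ?_
        simp only [C_mul]
        linear_combination hrel
      | coe w₃ =>
        rw [f₁ _ rfl, f₂ _ rfl, f₃ _ rfl] at hrel
        refine not_three_powers (a₁ := a₁ * c₁) (a₂ := a₂ * c₂) (w₁ := w₁) (w₂ := w₂) (w₃ := w₃) hR m₃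
          (fun h => n13 (by rw [h])) (fun h => n23 (by rw [h])) ?_
        simp only [C_mul]
        linear_combination hrel

theorem exists_unique_preimage_of_mem_finite [IsAlgClosed K] (R : RatFunc K)
    (hR : 1 ≤ ratDegree R) {G : Set (OnePoint K)} (hG : G.Finite) (h : ratMap R ⁻¹' G ⊆ G)
    {y : OnePoint K} (hy : y ∈ G) : ∃ w, ∀ x, ratMap R x = y → x = w := by
  have hs := ratMap_surjective R hR
  obtain ⟨-, hinj⟩ := preimage_eq_and_injOn_of_preimage_subset hs hG h
  obtain ⟨w, hw⟩ := hs y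
  refine ⟨w, fun x hx => hinj (h ?_) (h ?_) (hx.trans hw.symm)⟩
  · rwa [Set.mem_preimage, hx]
  · rwa [Set.mem_preimage, hw]

theorem encard_exceptionalSet_le [IsAlgClosed K] [CharZero K] (R : RatFunc K)
    (hR : 2 ≤ ratDegree R) : (exceptionalSet R).encard ≤ 2 := by
  by_contra! hlt
  obtain ⟨t, ht, ht'⟩ := Set.exists_subset_encard_eq
    (show (3 : ℕ∞) ≤ (exceptionalSet R).encard by
      simpa [two_add_one_eq_three] using Order.add_one_le_of_lt hlt)
  obtain ⟨y₁, y₂, y₃, h12, h13, h23, rfl⟩ := Set.encard_eq_three.1 ht'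
  have h₁ : y₁ ∈ exceptionalSet R := ht (by simp)
  have h₂ : y₂ ∈ exceptionalSet R := ht (by simp)
  have h₃ : y₃ ∈ exceptionalSet R := ht (by simp)
  set G : Set (OnePoint K) := {z | ∃ n : ℕ, (ratMap R)^[n] z = y₁} ∪
    {z | ∃ n : ℕ, (ratMap R)^[n] z = y₂} ∪ {z | ∃ n : ℕ, (ratMap R)^[n] z = y₃} with hGdef
  have hG : G.Finite := (Set.Finite.union h₁ h₂).union h₃
  have hback : ∀ y : OnePoint K, ∀ z, (∃ n : ℕ, (ratMap R)^[n] (ratMap R z) = y) →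
      ∃ n : ℕ, (ratMap R)^[n] z = y := by
    rintro y z ⟨n, hn⟩
    exact ⟨n + 1, by rwa [Function.iterate_succ_apply]⟩
  have hG' : ratMap R ⁻¹' G ⊆ G := by
    rintro z ((hz | hz) | hz)
    · exact Or.inl (Or.inl (hback _ _ hz))
    · exact Or.inl (Or.inr (hback _ _ hz))
    · exact Or.inr (hback _ _ hz)
  have hR1 : 1 ≤ ratDegree R := by omega
  obtain ⟨w₁, hw₁⟩ := exists_unique_preimage_of_mem_finite R hR1 hG hG' (y := y₁)
    (Or.inl (Or.inl ⟨0, rfl⟩))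
  obtain ⟨w₂, hw₂⟩ := exists_unique_preimage_of_mem_finite R hR1 hG hG' (y := y₂)
    (Or.inl (Or.inr ⟨0, rfl⟩))
  obtain ⟨w₃, hw₃⟩ := exists_unique_preimage_of_mem_finite R hR1 hG hG' (y := y₃)
    (Or.inr ⟨0, rfl⟩)
  exact not_three_totally_ramified R hR h12 h13 h23 hw₁ hw₂ hw₃

/-- The union of the forward images is forward invariant. A general m is needed: m = 1 serves E(R),
and m = n serves the iterate fixing S. -/
theorem preimage_compl_iUnion_image_subset {α : Type*} (f : α → α) (X : Set α) (m : ℕ) :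
    f^[m] ⁻¹' (⋃ n : ℕ, f^[n] '' X)ᶜ ⊆ (⋃ n : ℕ, f^[n] '' X)ᶜ := by
  intro z hz hz'
  obtain ⟨n, x, hx, rfl⟩ := Set.mem_iUnion.1 hz'
  refine hz (Set.mem_iUnion.2 ⟨m + n, x, hx, ?_⟩)
  rw [Function.iterate_add_apply]

theorem compl_exceptionalSet_subset_of_finite (R : RatFunc K) (X : Set (OnePoint K))
    (h : (⋃ n : ℕ, (ratMap R)^[n] '' X)ᶜ.Finite) :
    (exceptionalSet R)ᶜ ⊆ ⋃ n : ℕ, (ratMap R)^[n] '' X := by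
  rw [Set.compl_subset_comm]
  intro z hz
  refine h.subset ?_
  rintro y ⟨n, rfl⟩
  exact preimage_compl_iUnion_image_subset (ratMap R) X n hz

end Exceptional

end

end PadicDynamics

namespace PadicDynamics

noncomputable section

open Polynomial Filter Topology

/-! ### Norms and zeros of polynomials near the edge of a disc. -/

section Ultrametric

set_option linter.unusedSectionVars false

variable {K : Type*} [NontriviallyNormedField K] [IsUltrametricDist K]

/-- The value group is dense: roots of an element of norm > 1 have norms arbitrarily close to 1, and
a power of such a root lands in the interval. -/
theorem exists_norm_mem_Ioo [IsAlgClosed K] {s t : ℝ} (hs : 0 ≤ s) (hst : s < t) :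
    ∃ z : K, s < ‖z‖ ∧ ‖z‖ < t := by
  obtain ⟨s', h1, h2, h3⟩ : ∃ s', s ≤ s' ∧ s' < t ∧ 0 < s' :=
    ⟨(s + t) / 2, by linarith, by linarith, by linarith⟩
  obtain ⟨x, hx⟩ := NontriviallyNormedField.non_trivial (α := K)
  have hq : 1 < t / s' := (one_lt_div h3).2 h2
  obtain ⟨n, hn⟩ := pow_unbounded_of_one_lt ‖x‖ hq
  have hn0 : n ≠ 0 := by
    rintro rfl
    rw [pow_zero] at hn
    linarith
  obtain ⟨y, hy⟩ := IsAlgClosed.exists_pow_nat_eq x (Nat.pos_of_ne_zero hn0)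
  have hy' : ‖y‖ ^ n = ‖x‖ := by rw [← norm_pow, hy]
  have hy1 : 1 < ‖y‖ := by
    by_contra! hle
    have := pow_le_one₀ (norm_nonneg y) hle (n := n)
    linarith
  have hy2 : ‖y‖ < t / s' := lt_of_pow_lt_pow_left₀ n (by positivity) (by rw [hy']; exact hn)
  obtain ⟨m, hm1, hm2⟩ := exists_mem_Ico_zpow h3 hy1
  refine ⟨y ^ (m + 1), ?_, ?_⟩
  · rw [norm_zpow]
    exact h1.trans_lt hm2
  · rw [norm_zpow, zpow_add_one₀ (by positivity)]
    calc ‖y‖ ^ m * ‖y‖ ≤ s' * ‖y‖ := by gcongr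
      _ < s' * (t / s') := by gcongr
      _ = t := mul_div_cancel₀ _ h3.ne'

theorem norm_add_eq_left {x y : K} (h : ‖y‖ < ‖x‖) : ‖x + y‖ = ‖x‖ := by
  rw [IsUltrametricDist.norm_add_eq_max_of_norm_ne_norm h.ne', max_eq_left h.le]

theorem norm_sub_eq_left {x y : K} (h : ‖y‖ < ‖x‖) : ‖x - y‖ = ‖x‖ := by
  rw [sub_eq_add_neg, norm_add_eq_left (by rwa [norm_neg])]

theorem norm_sub_eq_left' {a z w : K} (h : ‖w - a‖ < ‖z - a‖) : ‖z - w‖ = ‖z - a‖ := by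
  rw [← norm_sub_eq_left h]
  congr 1
  ring

theorem norm_sub_eq_right' {a z w : K} (h : ‖z - a‖ < ‖w - a‖) : ‖z - w‖ = ‖w - a‖ := by
  rw [norm_sub_rev, norm_sub_eq_left' h]

theorem norm_sub_le_max' (a z w : K) : ‖z - w‖ ≤ max ‖z - a‖ ‖w - a‖ := by
  have := IsUltrametricDist.norm_add_le_max (z - a) (-(w - a))
  rwa [norm_neg, ← sub_eq_add_neg, sub_sub_sub_cancel_right] at this

open Classical in
/-- The number of zeros of `A` in `{|z - a| < ρ}`, counted with multiplicity. -/
def edgeCount (A : K[X]) (a : K) (ρ : ℝ) : ℕ := (A.roots.filter fun w => ‖w - a‖ < ρ).card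

open Classical in
/-- The constant `C` such that `|A z| = C |z - a| ^ n` near the edge of `{|z - a| < ρ}`. -/
def edgeConst (A : K[X]) (a : K) (ρ : ℝ) : ℝ :=
  ‖A.leadingCoeff‖ * ((A.roots.filter fun w => ¬ ‖w - a‖ < ρ).map fun w => ‖w - a‖).prod

theorem edgeConst_pos {A : K[X]} (hA : A ≠ 0) (a : K) {ρ : ℝ} (hρ : 0 < ρ) :
    0 < edgeConst A a ρ := by
  refine mul_pos (norm_pos_iff.2 (leadingCoeff_ne_zero.2 hA)) ?_
  refine Multiset.prod_induction (fun x : ℝ => 0 < x) _ (fun _ _ => mul_pos) one_pos ?_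
  intro x hx
  obtain ⟨w, hw, rfl⟩ := Multiset.mem_map.1 hx
  exact hρ.trans_le (not_lt.1 (Multiset.mem_filter.1 hw).2)

open Classical in
theorem norm_eval_eq_prod [IsAlgClosed K] (A : K[X]) (a : K) (ρ : ℝ) {z : K} (hz : ‖z - a‖ < ρ) :
    ‖A.eval z‖ = edgeConst A a ρ *
      ((A.roots.filter fun w => ‖w - a‖ < ρ).map fun w => ‖z - w‖).prod := by
  have h1 : A.eval z = A.leadingCoeff * (A.roots.map fun w => z - w).prod := by
    conv_lhs => rw [(IsAlgClosed.splits A).eq_prod_roots]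
    rw [eval_mul, eval_C, eval_multiset_prod, Multiset.map_map]
    simp
  have h2 : ∀ s : Multiset K, ‖(s.map fun w => z - w).prod‖ = (s.map fun w => ‖z - w‖).prod := by
    intro s
    induction s using Multiset.induction_on with
    | empty => simp
    | cons a s ih => simp [ih]
  rw [h1, norm_mul, h2, edgeConst, mul_assoc]
  congr 1
  rw [← Multiset.filter_add_not (fun w => ‖w - a‖ < ρ) A.roots, Multiset.map_add,
    Multiset.prod_add, mul_comm]
  simp only [Multiset.filter_add_not]
  congr 2
  refine Multiset.map_congr rfl fun w hw => ?_
  exact norm_sub_eq_right' (hz.trans_le (not_lt.1 (Multiset.mem_filter.1 hw).2))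

theorem norm_eval_eq [IsAlgClosed K] (A : K[X]) {a : K} {ρ : ℝ} {z : K} (hz : ‖z - a‖ < ρ)
    (h : ∀ w ∈ A.roots, ‖w - a‖ < ρ → ‖w - a‖ < ‖z - a‖) :
    ‖A.eval z‖ = edgeConst A a ρ * ‖z - a‖ ^ edgeCount A a ρ := by
  classical
  rw [norm_eval_eq_prod A a ρ hz, edgeCount]
  congr 1
  rw [Multiset.map_congr (g := fun _ => ‖z - a‖) rfl]
  · simp
  · intro w hw
    rw [Multiset.mem_filter] at hw
    exact norm_sub_eq_left' (h w hw.1 hw.2)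

/-- A root w in the disc with |w - a| ≠ |z - a| contributes |z - w| = max(|z - a|, |w - a|) ≥ |z -
a|. Roots are thus allowed on both sides of z. -/
theorem le_norm_eval [IsAlgClosed K] (A : K[X]) {a : K} {ρ : ℝ} {z : K} (hz : ‖z - a‖ < ρ)
    (hρ : 0 < ρ)
    (h : ∀ w ∈ A.roots, ‖w - a‖ < ρ → ‖w - a‖ ≠ ‖z - a‖) :
    edgeConst A a ρ * ‖z - a‖ ^ edgeCount A a ρ ≤ ‖A.eval z‖ := by
  classical
  by_cases hA : A = 0
  · simp [hA, edgeConst]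
  rw [norm_eval_eq_prod A a ρ hz, edgeCount]
  refine mul_le_mul_of_nonneg_left ?_ (edgeConst_pos hA a hρ).le
  have : ∀ s : Multiset K, (∀ w ∈ s, ‖w - a‖ ≠ ‖z - a‖) →
      ‖z - a‖ ^ s.card ≤ (s.map fun w => ‖z - w‖).prod := by
    intro s
    induction s using Multiset.induction_on with
    | empty => simp
    | cons w s ih =>
      intro hs
      rw [Multiset.card_cons, Multiset.map_cons, Multiset.prod_cons, pow_succ']
      have h1 : ‖z - a‖ ≤ ‖z - w‖ := by
        rcases lt_or_gt_of_ne (hs w (Multiset.mem_cons_self w s)) with h | h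
        · exact (norm_sub_eq_left' h).ge
        · exact h.le.trans (norm_sub_eq_right' h).ge
      exact mul_le_mul h1 (ih fun w hw => hs w (Multiset.mem_cons_of_mem hw)) (by positivity)
        (norm_nonneg _)
  refine this _ fun w hw => ?_
  rw [Multiset.mem_filter] at hw
  exact h w hw.1 hw.2

/-- Every point of an ultrametric disc is a centre of it. -/
theorem edge_recenter (A : K[X]) {a a' : K} {ρ : ℝ} (h : ‖a' - a‖ < ρ) :
    edgeCount A a' ρ = edgeCount A a ρ ∧ edgeConst A a' ρ = edgeConst A a ρ := by
  classical
  have h1 : ∀ w, ‖w - a'‖ < ρ ↔ ‖w - a‖ < ρ := by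
    intro w
    constructor
    · intro hw
      have := norm_sub_le_max' a' w a
      rw [norm_sub_rev a a'] at this
      exact this.trans_lt (max_lt hw h)
    · intro hw
      exact (norm_sub_le_max' a w a').trans_lt (max_lt hw h)
  constructor
  · simp [edgeCount, h1]
  · unfold edgeConst
    simp only [h1]
    congr 2
    refine Multiset.map_congr rfl fun w hw => ?_
    rw [Multiset.mem_filter] at hw
    exact norm_sub_eq_left' (h.trans_le (not_lt.1 hw.2))

/-! ### The filter of the edge of a disc -/

/-- The filter generated by the annuli `{s < |z - a| < ρ}`, `s < ρ`. -/
def edge (a : K) (ρ : ℝ) : Filter K := comap (fun z => ‖z - a‖) (𝓝[<] ρ)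

theorem mem_edge_iff {a : K} {ρ : ℝ} {S : Set K} :
    S ∈ edge a ρ ↔ ∃ s, s < ρ ∧ ∀ z, s < ‖z - a‖ → ‖z - a‖ < ρ → z ∈ S := by
  unfold edge
  rw [mem_comap]
  constructor
  · rintro ⟨T, hT, hTS⟩
    obtain ⟨s, hs, hsT⟩ := (mem_nhdsLT_iff_exists_Ioo_subset' (sub_one_lt ρ)).1 hT
    exact ⟨s, hs, fun z h1 h2 => hTS (hsT ⟨h1, h2⟩)⟩
  · rintro ⟨s, hs, h⟩
    exact ⟨Set.Ioo s ρ, Ioo_mem_nhdsLT hs, fun z hz => h z hz.1 hz.2⟩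

theorem eventually_edge_iff {a : K} {ρ : ℝ} {P : K → Prop} :
    (∀ᶠ z in edge a ρ, P z) ↔ ∃ s, s < ρ ∧ ∀ z, s < ‖z - a‖ → ‖z - a‖ < ρ → P z :=
  mem_edge_iff

theorem edge_neBot [IsAlgClosed K] (a : K) {ρ : ℝ} (hρ : 0 < ρ) : (edge a ρ).NeBot := by
  refine ⟨fun h => ?_⟩
  obtain ⟨s, hs, hz⟩ := mem_edge_iff.1 (h ▸ mem_bot : (∅ : Set K) ∈ edge a ρ)
  obtain ⟨z, h1, h2⟩ := exists_norm_mem_Ioo (K := K) (le_max_left 0 s) (max_lt hρ hs)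
  exact hz (a + z) (by simpa using (le_max_right 0 s).trans_lt h1) (by simpa using h2)

theorem tendsto_norm_edge (a : K) (ρ : ℝ) : Tendsto (fun z => ‖z - a‖) (edge a ρ) (𝓝 ρ) :=
  tendsto_comap.mono_right nhdsWithin_le_nhds

theorem eventually_norm_lt_edge (a : K) (ρ : ℝ) : ∀ᶠ z in edge a ρ, ‖z - a‖ < ρ :=
  eventually_edge_iff.2 ⟨ρ - 1, by linarith, fun _ _ h => h⟩

theorem eventually_lt_norm_edge (a : K) {s ρ : ℝ} (h : s < ρ) : ∀ᶠ z in edge a ρ, s < ‖z - a‖ :=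
  eventually_edge_iff.2 ⟨s, h, fun _ h _ => h⟩

theorem eventually_forall_mem_finite_edge (a : K) (ρ : ℝ) {F : Set K} (hF : F.Finite) :
    ∀ᶠ z in edge a ρ, ∀ w ∈ F, ‖w - a‖ < ρ → ‖w - a‖ < ‖z - a‖ := by
  refine (eventually_all_finite hF).2 fun w _ => ?_
  by_cases h : ‖w - a‖ < ρ
  · filter_upwards [eventually_lt_norm_edge a h] with z hz _ using hz
  · exact Eventually.of_forall fun z h' => absurd h' h

theorem eventually_notMem_finite_edge (a : K) (ρ : ℝ) {F : Set K} (hF : F.Finite) :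
    ∀ᶠ z in edge a ρ, z ∉ F := by
  filter_upwards [eventually_forall_mem_finite_edge a ρ hF, eventually_norm_lt_edge a ρ]
    with z h1 h2 h3
  exact lt_irrefl _ (h1 z h3 h2)

theorem eventually_norm_eval_edge [IsAlgClosed K] (A : K[X]) (a : K) (ρ : ℝ) :
    ∀ᶠ z in edge a ρ, ‖A.eval z‖ = edgeConst A a ρ * ‖z - a‖ ^ edgeCount A a ρ := by
  classical
  filter_upwards [eventually_forall_mem_finite_edge a ρ (A.roots.toFinset.finite_toSet),
    eventually_norm_lt_edge a ρ] with z h1 h2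
  exact norm_eval_eq A h2 fun w hw => h1 w (by simpa using hw)

theorem eventually_eval_ne_zero_edge {A : K[X]} (hA : A ≠ 0) (a : K) (ρ : ℝ) :
    ∀ᶠ z in edge a ρ, A.eval z ≠ 0 :=
  eventually_notMem_finite_edge a ρ (finite_setOf_eval_eq_zero hA)

theorem monomial_unique_of_lt {C C' x y : ℝ} {n n' : ℕ} (hC : 0 < C) (hC' : 0 < C') (hx : 0 < x)
    (hxy : x < y) (h1 : C * x ^ n = C' * x ^ n') (h2 : C * y ^ n = C' * y ^ n') : n = n' := by
  wlog hn : n ≤ n' generalizing n n' C C'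
  · exact (this hC' hC h1.symm h2.symm (le_of_not_ge hn)).symm
  obtain ⟨m, rfl⟩ := Nat.exists_eq_add_of_le hn
  have hy : 0 < y := hx.trans hxy
  rw [pow_add] at h1 h2
  have e1 : C = C' * x ^ m := by
    have := pow_pos hx n
    apply mul_right_cancel₀ this.ne'
    rw [h1]; ring
  have e2 : C = C' * y ^ m := by
    have := pow_pos hy n
    apply mul_right_cancel₀ this.ne'
    rw [h2]; ring
  have e3 : x ^ m = y ^ m := mul_left_cancel₀ hC'.ne' (e1.symm.trans e2)
  by_contra hne
  have hm : m ≠ 0 := fun h => hne (by omega)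
  exact (pow_lt_pow_left₀ hxy hx.le hm).ne e3

/-- Two radii in the value group determine exponent and constant. Zeros in a disc are counted in
this way: it suffices to know the norm of the polynomial near the edge. -/
theorem monomial_unique_of_eventually [IsAlgClosed K] {C C' ρ : ℝ} {n n' : ℕ} {a : K} (hC : 0 < C)
    (hC' : 0 < C') (hρ : 0 < ρ)
    (h : ∀ᶠ z in edge a ρ, C * ‖z - a‖ ^ n = C' * ‖z - a‖ ^ n') : n = n' ∧ C = C' := by
  obtain ⟨s, hs, h⟩ := eventually_edge_iff.1 h
  obtain ⟨z, h1, h2⟩ := exists_norm_mem_Ioo (K := K) (le_max_left 0 s) (max_lt hρ hs)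
  obtain ⟨w, h3, h4⟩ := exists_norm_mem_Ioo (K := K) (norm_nonneg z) h2
  have hz : 0 < ‖z‖ := (le_max_left 0 s).trans_lt h1
  have hs' : s < ‖z‖ := (le_max_right 0 s).trans_lt h1
  have e1 := h (a + z) (by simpa using hs') (by simpa using h2)
  have e2 := h (a + w) (by simpa using hs'.trans h3) (by simpa using h4)
  rw [add_sub_cancel_left] at e1 e2
  have hn := monomial_unique_of_lt hC hC' hz h3 e1 e2
  refine ⟨hn, ?_⟩
  subst hn
  exact mul_right_cancel₀ (pow_pos hz n).ne' e1

end Ultrametric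

end

end PadicDynamics

namespace PadicDynamics

noncomputable section

open Polynomial Filter Topology

/-! ### Quotients N/D that map the edge of one disc to the edge of another. -/

section Facts

set_option linter.unusedSectionVars false

variable {K : Type*} [NontriviallyNormedField K] [IsUltrametricDist K] [IsAlgClosed K]

/-- `N / D` maps the edge of the disc of radius `ρ` to the edge of the disc of radius `ρ'`,
with `k = deg` as multiplicity. -/
structure EdgeMap (N D : K[X]) (ρ ρ' : ℝ) (k : ℕ) : Prop where
  one_le : 1 ≤ k
  count_eq : edgeCount N 0 ρ = k + edgeCount D 0 ρ
  const_eq : edgeConst N 0 ρ * ρ ^ k = ρ' * edgeConst D 0 ρ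
  sub_ne_zero : ∀ b, ‖b‖ < ρ' → N - C b * D ≠ 0
  count_sub : ∀ b, ‖b‖ < ρ' → edgeCount (N - C b * D) 0 ρ = k + edgeCount D 0 ρ
  const_sub : ∀ b, ‖b‖ < ρ' → edgeConst (N - C b * D) 0 ρ = edgeConst N 0 ρ

/-- Near the edge |N/D| tends to ρ' from below. So for |b| < ρ' the term bD is dominated by N there,
and N - bD has the growth of N, hence as many zeros in the disc. The exponent k is the excess of
zeros of N over zeros of D; N/D may have poles inside the disc. -/
theorem exists_edgeMap {N D : K[X]} {ρ ρ' : ℝ} (hρ : 0 < ρ) (hρ' : 0 < ρ') (hD : D ≠ 0)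
    (h : Tendsto (fun t => N.eval t / D.eval t) (edge 0 ρ) (edge 0 ρ')) :
    ∃ k, EdgeMap N D ρ ρ' k := by
  have hne := edge_neBot (0 : K) hρ
  have hD0 := eventually_eval_ne_zero_edge hD 0 ρ
  have hlt := h.eventually (eventually_norm_lt_edge 0 ρ')
  have hgt : ∀ b : K, ‖b‖ < ρ' → ∀ᶠ t in edge 0 ρ, ‖b * D.eval t‖ < ‖N.eval t‖ := by
    intro b hb
    filter_upwards [h.eventually (eventually_lt_norm_edge 0 hb), hD0] with t h1 h2
    rw [sub_zero, norm_div, lt_div_iff₀ (norm_pos_iff.2 h2)] at h1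
    rwa [norm_mul]
  have hsub : ∀ b : K, ‖b‖ < ρ' → ∀ᶠ t in edge 0 ρ, ‖(N - C b * D).eval t‖ = ‖N.eval t‖ := by
    intro b hb
    filter_upwards [hgt b hb] with t h1
    rw [eval_sub, eval_mul, eval_C, norm_sub_eq_left h1]
  have hP : ∀ b : K, ‖b‖ < ρ' → N - C b * D ≠ 0 := by
    intro b hb h0
    obtain ⟨t, h1, h2⟩ := ((hsub b hb).and (hgt b hb)).exists
    rw [h0, eval_zero, norm_zero] at h1
    rw [← h1] at h2
    exact absurd h2 (not_lt.2 (norm_nonneg _))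
  have hN : N ≠ 0 := by
    have := hP 0 (by simpa using hρ')
    simpa using this
  have hNe := eventually_norm_eval_edge N 0 ρ
  have hDe := eventually_norm_eval_edge D 0 ρ
  set cN := edgeConst N 0 ρ with hcN
  set cD := edgeConst D 0 ρ with hcD
  set nN := edgeCount N 0 ρ with hnN
  set nD := edgeCount D 0 ρ with hnD
  have cN0 : 0 < cN := edgeConst_pos hN 0 hρ
  have cD0 : 0 < cD := edgeConst_pos hD 0 hρ
  have hlim : cN * ρ ^ nN = ρ' * (cD * ρ ^ nD) := by
    have t1 : Tendsto (fun t : K => cN * ‖t - 0‖ ^ nN) (edge 0 ρ) (𝓝 (cN * ρ ^ nN)) :=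
      ((tendsto_norm_edge 0 ρ).pow nN).const_mul cN
    have t2 : Tendsto (fun t : K => ‖N.eval t / D.eval t - 0‖ * (cD * ‖t - 0‖ ^ nD)) (edge 0 ρ)
        (𝓝 (ρ' * (cD * ρ ^ nD))) :=
      ((tendsto_norm_edge 0 ρ').comp h).mul (((tendsto_norm_edge 0 ρ).pow nD).const_mul cD)
    refine tendsto_nhds_unique_of_eventuallyEq t1 t2 ?_
    filter_upwards [hNe, hDe, hD0] with t h1 h2 h3
    rw [← h1, ← h2, sub_zero, norm_div, div_mul_cancel₀ _ (norm_ne_zero_iff.2 h3)]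
  -- With at least as many zeros in D as in N, the quotient would be a nonincreasing monomial in |t|
  -- with limit ρ', so it could not stay below ρ'.
  have hnlt : nD < nN := by
    by_contra! hle
    obtain ⟨m, hm⟩ := Nat.exists_eq_add_of_le hle
    obtain ⟨t, h1, h2, h3, h4, h5, h6⟩ := (hNe.and (hDe.and (hD0.and (hlt.and
      ((eventually_norm_lt_edge 0 ρ).and (eventually_lt_norm_edge 0 hρ)))))).exists
    rw [sub_zero, norm_div, div_lt_iff₀ (norm_pos_iff.2 h3), h1, h2, hm, pow_add] at h4
    rw [hm, pow_add] at hlim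
    have e1 : cN = ρ' * cD * ρ ^ m := by
      apply mul_right_cancel₀ (pow_pos hρ nN).ne'
      rw [hlim]; ring
    have e2 : cN < ρ' * cD * ‖t - 0‖ ^ m := by
      apply lt_of_mul_lt_mul_right _ (pow_pos h6 nN).le
      calc _ < _ := h4
        _ = _ := by ring
    have e3 : ‖t - 0‖ ^ m ≤ ρ ^ m := pow_le_pow_left₀ h6.le h5.le m
    have e4 : ρ' * cD * ‖t - 0‖ ^ m ≤ ρ' * cD * ρ ^ m :=
      mul_le_mul_of_nonneg_left e3 (by positivity)
    linarith
  obtain ⟨k, hk⟩ := Nat.exists_eq_add_of_lt hnlt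
  have hsub' : ∀ b : K, ‖b‖ < ρ' → edgeCount (N - C b * D) 0 ρ = nN ∧
      edgeConst (N - C b * D) 0 ρ = cN := by
    intro b hb
    refine monomial_unique_of_eventually (a := (0 : K)) (edgeConst_pos (hP b hb) 0 hρ) cN0 hρ ?_
    filter_upwards [hsub b hb, hNe, eventually_norm_eval_edge (N - C b * D) 0 ρ] with t h1 h2 h3
    rw [← h2, ← h3, h1]
  refine ⟨k + 1, by omega, by omega, ?_, hP, ?_, fun b hb => (hsub' b hb).2⟩
  · apply mul_right_cancel₀ (pow_pos hρ nD).ne'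
    rw [hk] at hlim
    rw [mul_assoc, ← pow_add, mul_assoc, ← hlim]
    congr 2
    omega
  · intro b hb
    rw [(hsub' b hb).1]
    omega

theorem EdgeMap.pos {N D : K[X]} {ρ ρ' : ℝ} {k : ℕ} (h : EdgeMap N D ρ ρ' k) (hρ' : 0 < ρ') :
    N ≠ 0 := by
  simpa using h.sub_ne_zero 0 (by simpa using hρ')

theorem exists_root_of_edgeCount_pos {A : K[X]} {a : K} {ρ : ℝ} (h : 0 < edgeCount A a ρ) :
    ∃ w, ‖w - a‖ < ρ ∧ A.eval w = 0 := by
  classical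
  obtain ⟨w, hw⟩ := Multiset.card_pos_iff_exists_mem.1 h
  rw [Multiset.mem_filter] at hw
  exact ⟨w, hw.2, isRoot_of_mem_roots hw.1⟩

theorem EdgeMap.exists_root {N D : K[X]} {ρ ρ' : ℝ} {k : ℕ} (h : EdgeMap N D ρ ρ' k) {b : K}
    (hb : ‖b‖ < ρ') : ∃ t, ‖t‖ < ρ ∧ N.eval t = b * D.eval t := by
  obtain ⟨t, ht, h0⟩ := exists_root_of_edgeCount_pos (A := N - C b * D) (a := 0) (ρ := ρ) (by
    rw [h.count_sub b hb]
    have := h.one_le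
    omega)
  refine ⟨t, by simpa using ht, ?_⟩
  simpa [sub_eq_zero] using h0

theorem EdgeMap.norm_eval_edge {N D : K[X]} {ρ ρ' : ℝ} {k : ℕ} (h : EdgeMap N D ρ ρ' k)
    (hρ : 0 < ρ) (hD : D ≠ 0) : ∀ᶠ t in edge 0 ρ,
      ‖N.eval t‖ = edgeConst N 0 ρ / edgeConst D 0 ρ * ‖t‖ ^ k * ‖D.eval t‖ := by
  filter_upwards [eventually_norm_eval_edge N 0 ρ, eventually_norm_eval_edge D 0 ρ] with t h1 h2
  have := (edgeConst_pos hD 0 hρ).ne'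
  rw [h1, h2, h.count_eq, sub_zero, pow_add]
  field_simp

theorem ncard_setOf_root_le_card {A : K[X]} (hA : A ≠ 0) (P : K → Prop) [DecidablePred P] :
    {t | A.eval t = 0 ∧ P t}.ncard ≤ (A.roots.filter P).card := by
  classical
  have h : {t | A.eval t = 0 ∧ P t} = ((A.roots.filter P).toFinset : Set K) := by
    ext t
    simp [hA]
  rw [h, Set.ncard_coe_finset]
  exact Multiset.toFinset_card_le _

/-- Near the edge, the fibres have at most `k` points. -/
theorem EdgeMap.ncard_fiber_le {N D : K[X]} {ρ ρ' : ℝ} {k : ℕ} (h : EdgeMap N D ρ ρ' k)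
    (hρ : 0 < ρ) (hD : D ≠ 0)
    (hT : Tendsto (fun t => N.eval t / D.eval t) (edge 0 ρ) (edge 0 ρ')) :
    ∃ r, 0 ≤ r ∧ r < ρ ∧ ∀ᶠ t₀ in edge 0 ρ, ∀ b, N.eval t₀ = b * D.eval t₀ →
      {t | N.eval t = b * D.eval t ∧ r < ‖t‖ ∧ ‖t‖ < ρ}.Finite ∧
      {t | N.eval t = b * D.eval t ∧ r < ‖t‖ ∧ ‖t‖ < ρ}.ncard ≤ k := by
  classical
  obtain ⟨r', hr', hr''⟩ := eventually_edge_iff.1 ((h.norm_eval_edge hρ hD).and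
    ((eventually_eval_ne_zero_edge hD 0 ρ).and
      (eventually_forall_mem_finite_edge 0 ρ (D.roots.toFinset.finite_toSet))))
  refine ⟨max 0 r', le_max_left _ _, max_lt hρ hr', ?_⟩
  set r := max 0 r' with hr
  have hr0 : 0 ≤ r := le_max_left _ _
  replace hr'' : ∀ z : K, r < ‖z‖ → ‖z‖ < ρ → _ := fun z h1 h2 =>
    hr'' z (by simpa using (le_max_right 0 r').trans_lt h1) (by simpa using h2)
  set c := edgeConst N 0 ρ / edgeConst D 0 ρ with hc
  have hN : N ≠ 0 := by
    rintro rfl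
    have := h.count_eq
    have := h.one_le
    simp [edgeCount] at *
    omega
  filter_upwards [eventually_norm_lt_edge 0 ρ, eventually_lt_norm_edge 0
    (show r < ρ from max_lt hρ hr'), hT.eventually (eventually_norm_lt_edge 0 ρ'),
    eventually_eval_ne_zero_edge hN 0 ρ] with t₀ h1 h2 h3 hN0 b hb
  rw [sub_zero] at h1 h2 h3
  obtain ⟨g1, g2, -⟩ := hr'' t₀ h2 h1
  have ht₀ : 0 < ‖t₀‖ := hr0.trans_lt h2
  rw [hb, mul_div_cancel_right₀ _ g2] at h3
  -- The modulus of t₀ is the critical radius for b: below it bD dominates N, so N - bD has no new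
  -- zeros there.
  have hbn : ‖b‖ = c * ‖t₀‖ ^ k := by
    rw [hb, norm_mul] at g1
    exact mul_right_cancel₀ (norm_ne_zero_iff.2 g2) g1
  have hb0 : b ≠ 0 := by
    rintro rfl
    rw [zero_mul] at hb
    exact hN0 hb
  have hc0 : 0 < c := by
    have : 0 < ‖b‖ := norm_pos_iff.2 hb0
    rw [hbn] at this
    exact pos_of_mul_pos_left this (by positivity)
  set P := N - C b * D with hP
  have hP0 : P ≠ 0 := h.sub_ne_zero b h3
  have hPev : ∀ t, P.eval t = 0 ↔ N.eval t = b * D.eval t := fun t => by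
    simp [hP, sub_eq_zero]
  have hk0 : k ≠ 0 := by have := h.one_le; omega
  have hinner : ∀ t : K, r < ‖t‖ → ‖t‖ < ‖t₀‖ → ‖P.eval t‖ = ‖b‖ * ‖D.eval t‖ := by
    intro t h4 h5
    obtain ⟨e1, e2, -⟩ := hr'' t h4 (h5.trans h1)
    have : ‖N.eval t‖ < ‖b * D.eval t‖ := by
      rw [e1, norm_mul, hbn]
      have : ‖t‖ ^ k < ‖t₀‖ ^ k := pow_lt_pow_left₀ h5 (norm_nonneg _) hk0
      have := norm_pos_iff.2 e2
      gcongr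
    rw [hP, eval_sub, eval_mul, eval_C, norm_sub_rev, norm_sub_eq_left this, norm_mul]
  have hnoroot : ∀ w, P.eval w = 0 → ‖w‖ < ‖t₀‖ → ‖w‖ ≤ r := by
    intro w hw h4
    by_contra! h5
    have := hinner w h5 h4
    rw [hw, norm_zero] at this
    obtain ⟨-, e2, -⟩ := hr'' w h5 (h4.trans h1)
    exact mul_ne_zero (norm_ne_zero_iff.2 hb0) (norm_ne_zero_iff.2 e2) this.symm
  -- Just inside the radius |t₀| the norms of P and bD agree, so P and D have equally many zeros
  -- there. All zeros of D in the large disc are already counted, and P has k more zeros in that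
  -- disc. These k lie in |t₀| ≤ |t| < ρ.
  have hcount : edgeCount P 0 ‖t₀‖ = edgeCount D 0 ‖t₀‖ := by
    refine (monomial_unique_of_eventually (a := (0 : K)) (ρ := ‖t₀‖) (C := edgeConst P 0 ‖t₀‖)
      (C' := ‖b‖ * edgeConst D 0 ‖t₀‖) (edgeConst_pos hP0 0 ht₀)
      (mul_pos (norm_pos_iff.2 hb0) (edgeConst_pos hD 0 ht₀)) ht₀ ?_).1
    filter_upwards [eventually_norm_eval_edge P 0 ‖t₀‖, eventually_norm_eval_edge D 0 ‖t₀‖,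
      eventually_norm_lt_edge 0 ‖t₀‖, eventually_lt_norm_edge 0 h2] with t e1 e2 e3 e4
    rw [sub_zero] at e3 e4
    rw [← e1, hinner t e4 e3, e2, mul_assoc]
  have hcountD : edgeCount D 0 ‖t₀‖ = edgeCount D 0 ρ := by
    unfold edgeCount
    congr 1
    refine Multiset.filter_congr fun w hw => ?_
    rw [sub_zero]
    refine ⟨fun h4 => h4.trans h1, fun h4 => ?_⟩
    have := (hr'' t₀ h2 h1).2.2 w (by simpa using Multiset.mem_toFinset.2 hw) (by simpa using h4)
    simpa using this
  have hset : {t | N.eval t = b * D.eval t ∧ r < ‖t‖ ∧ ‖t‖ < ρ} =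
      {t | P.eval t = 0 ∧ (‖t - 0‖ < ρ ∧ ¬ ‖t - 0‖ < ‖t₀‖)} := by
    ext t
    simp only [Set.mem_ofPred_eq, hPev, sub_zero]
    refine and_congr_right fun h4 => ⟨fun h5 => ⟨h5.2, fun h6 => ?_⟩, fun h5 => ⟨?_, h5.1⟩⟩
    · exact absurd h5.1 (not_lt.2 (hnoroot t ((hPev t).2 h4) h6))
    · exact h2.trans_le (not_lt.1 h5.2)
  rw [hset]
  refine ⟨(finite_setOf_eval_eq_zero hP0).subset fun t ht => ht.1, ?_⟩
  refine (ncard_setOf_root_le_card hP0 _).trans ?_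
  have h5 := h.count_sub b h3
  have h6 : edgeCount P 0 ρ = edgeCount P 0 ‖t₀‖ +
      (P.roots.filter fun t => ‖t - 0‖ < ρ ∧ ¬ ‖t - 0‖ < ‖t₀‖).card := by
    unfold edgeCount
    rw [← Multiset.card_add]
    congr 1
    conv_lhs => rw [← Multiset.filter_add_not (fun t => ‖t - 0‖ < ‖t₀‖)
      (P.roots.filter fun t => ‖t - 0‖ < ρ)]
    rw [Multiset.filter_filter, Multiset.filter_filter]
    congr 1
    · refine Multiset.filter_congr fun w _ => ?_
      rw [sub_zero]
      exact ⟨fun h7 => h7.1, fun h7 => ⟨h7, h7.trans h1⟩⟩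
    · refine Multiset.filter_congr fun w _ => ?_
      rw [and_comm]
  rw [← hP] at h5
  omega

/-- The contraction of the complement of a backward invariant set. -/
theorem EdgeMap.norm_sub_le {N D : K[X]} {k : ℕ} (h : EdgeMap N D 1 1 k) (hD : D ≠ 0) {a : K}
    (ha : ‖a‖ < 1) {δ : ℝ} (hδ0 : 0 ≤ δ) (hδ : δ < 1) {b b' : K} (hb : ‖b‖ < 1) (hb' : ‖b'‖ < 1)
    (h1 : ∀ t, ‖t‖ < 1 → N.eval t = b * D.eval t → ‖t - a‖ ≤ δ)
    (h2 : ∀ t, ‖t‖ < 1 → N.eval t = b' * D.eval t → ‖t - a‖ ≤ δ) : ‖b - b'‖ ≤ δ ^ k := by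
  classical
  have ha0 : ‖a - 0‖ < 1 := by simpa using ha
  have hconst : edgeConst N 0 1 = edgeConst D 0 1 := by simpa using h.const_eq
  have hlt1 : ∀ w : K, ‖w - a‖ < 1 → ‖w‖ < 1 := fun w hw => by
    have := norm_sub_le_max' a w 0
    simp only [sub_zero, zero_sub, norm_neg] at this
    exact this.trans_lt (max_lt hw ha)
  -- All zeros of N - bD in the disc lie within δ of a. Hence the formula at the edge holds on the
  -- whole annulus δ < |z - a| < 1, after moving the centre to a.
  have hval : ∀ b : K, ‖b‖ < 1 → (∀ t, ‖t‖ < 1 → N.eval t = b * D.eval t → ‖t - a‖ ≤ δ) →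
      ∀ z, δ < ‖z - a‖ → ‖z - a‖ < 1 → ‖(N - C b * D).eval z‖ =
        edgeConst D 0 1 * ‖z - a‖ ^ (k + edgeCount D 0 1) := by
    intro b hb h1 z hz hz'
    rw [norm_eval_eq (N - C b * D) hz', (edge_recenter _ ha0).1, (edge_recenter _ ha0).2,
      h.count_sub b hb, h.const_sub b hb, hconst]
    intro w hw hw'
    refine (h1 w (hlt1 w hw') ?_).trans_lt hz
    simpa [sub_eq_zero] using isRoot_of_mem_roots hw
  by_contra! hlt
  -- A radius slightly larger than δ that avoids the zeros of D. There (b - b')D is a difference of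
  -- two terms of known norm, and D is bounded below.
  have hev : ∀ᶠ x in 𝓝[>] δ, x < 1 ∧ x ^ k < ‖b - b'‖ ∧ ∀ w ∈ D.roots.toFinset, ‖w - a‖ ≠ x := by
    refine Filter.Eventually.and (nhdsWithin_le_nhds (Iio_mem_nhds hδ))
      (Filter.Eventually.and ?_ ?_)
    · exact nhdsWithin_le_nhds ((continuous_pow k).continuousAt.eventually (Iio_mem_nhds hlt))
    · refine (eventually_all_finset _).2 fun w _ => ?_
      rcases le_or_gt ‖w - a‖ δ with h3 | h3
      · filter_upwards [self_mem_nhdsWithin] with x hx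
        exact (h3.trans_lt hx).ne
      · filter_upwards [nhdsWithin_le_nhds (Iio_mem_nhds h3)] with x hx
        exact (ne_of_lt hx).symm
  obtain ⟨u, hu, hu'⟩ := (mem_nhdsGT_iff_exists_Ioo_subset' (lt_add_one δ)).1 hev
  obtain ⟨z, hz1, hz2⟩ := exists_norm_mem_Ioo (K := K) hδ0 hu
  obtain ⟨e1, e2, e3⟩ := hu' ⟨hz1, hz2⟩
  have v1 := hval b hb h1 (a + z) (by simpa using hz1) (by simpa using e1)
  have v2 := hval b' hb' h2 (a + z) (by simpa using hz1) (by simpa using e1)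
  have v3 := le_norm_eval D (a := a) (ρ := 1) (z := a + z) (by simpa using e1) one_pos (by
    intro w hw _
    simpa using e3 w (Multiset.mem_toFinset.2 hw))
  rw [(edge_recenter _ ha0).1, (edge_recenter _ ha0).2] at v3
  rw [add_sub_cancel_left] at v1 v2 v3
  have hz0 : 0 < ‖z‖ := hδ0.trans_lt hz1
  have hcD := edgeConst_pos hD (0 : K) one_pos
  have hDpos : 0 < ‖D.eval (a + z)‖ := lt_of_lt_of_le (by positivity) v3
  have v4 : ‖b - b'‖ * ‖D.eval (a + z)‖ ≤ edgeConst D 0 1 * ‖z‖ ^ (k + edgeCount D 0 1) := by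
    have : (b - b') * D.eval (a + z) =
        (N - C b' * D).eval (a + z) - (N - C b * D).eval (a + z) := by
      simp only [eval_sub, eval_mul, eval_C]
      ring
    rw [← norm_mul, this]
    have := norm_sub_le_max' 0 ((N - C b' * D).eval (a + z)) ((N - C b * D).eval (a + z))
    rwa [sub_zero, sub_zero, v1, v2, max_self] at this
  have v5 : ‖b - b'‖ * ‖D.eval (a + z)‖ ≤ ‖z‖ ^ k * ‖D.eval (a + z)‖ := by
    calc _ ≤ _ := v4
      _ = ‖z‖ ^ k * (edgeConst D 0 1 * ‖z‖ ^ edgeCount D 0 1) := by rw [pow_add]; ring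
      _ ≤ _ := by gcongr
  exact absurd (le_of_mul_le_mul_right v5 hDpos) (not_le.2 e2)

end Facts

end

end PadicDynamics

namespace PadicDynamics

noncomputable section

open Polynomial Filter Topology

/-! ### Vanishing chains and coordinates on balls. -/

section Charts

variable {p : ℕ} [Fact p.Prime]

theorem coe_mem_openDisc_iff {z a : ℂ_[p]} {r : ℝ} :
    (z : PLine p) ∈ openDisc a r ↔ ‖z - a‖ < r := by
  simp [openDisc]

theorem coe_mem_closedDisc_iff {z a : ℂ_[p]} {r : ℝ} :
    (z : PLine p) ∈ closedDisc a r ↔ ‖z - a‖ ≤ r := by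
  simp [closedDisc]

theorem infty_notMem_openDisc {a : ℂ_[p]} {r : ℝ} :
    (OnePoint.infty : PLine p) ∉ openDisc a r := by
  simp [openDisc]

theorem infty_notMem_closedDisc {a : ℂ_[p]} {r : ℝ} :
    (OnePoint.infty : PLine p) ∉ closedDisc a r := by
  simp [closedDisc]

theorem openDisc_eq_closedDisc {a : ℂ_[p]} {r : ℝ} (h : ∀ c : ℂ_[p], ‖c‖ ≠ r) :
    openDisc a r = closedDisc a r := by
  unfold openDisc closedDisc
  congr 1
  ext z
  exact ⟨fun h => (show ‖z - a‖ < r from h).le, fun h' => lt_of_le_of_ne h' (h _)⟩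

namespace VanishingChain

theorem exists_ball_eq_closedDisc (C : VanishingChain p) {i : ℕ}
    (h : OnePoint.infty ∉ C.ball i) : ∃ b t, C.ball i = closedDisc b t ∧ 0 < t := by
  rcases C.ball_closed_or_irrational i with ⟨b, c, hc, h1 | h1⟩ | ⟨b, t, ht, hirr, h1 | h1⟩
  · exact ⟨b, _, h1, norm_pos_iff.2 hc⟩
  · exact absurd (h1 ▸ infty_notMem_openDisc) h
  · exact ⟨b, t, by rw [h1, openDisc_eq_closedDisc hirr], ht⟩
  · exact absurd (h1 ▸ infty_notMem_openDisc) h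

theorem exists_ball_eq_compl_openDisc (C : VanishingChain p) {i : ℕ}
    (h : OnePoint.infty ∈ C.ball i) : ∃ b t, C.ball i = (openDisc b t)ᶜ ∧ 0 < t := by
  rcases C.ball_closed_or_irrational i with ⟨b, c, hc, h1 | h1⟩ | ⟨b, t, ht, hirr, h1 | h1⟩
  · exact absurd (h1 ▸ h) infty_notMem_closedDisc
  · exact ⟨b, _, h1, norm_pos_iff.2 hc⟩
  · exact absurd (h1 ▸ h) infty_notMem_openDisc
  · exact ⟨b, t, h1, ht⟩

theorem ball_subset_total (C : VanishingChain p) (i : ℕ) : C.ball i ⊆ C.total := by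
  rw [← C.iUnion_ball]
  exact Set.subset_iUnion _ i

theorem exists_mem_term (C : VanishingChain p) (i : ℕ) : ∃ x, x ∈ C.total ∧ x ∉ C.ball i := by
  by_contra! h
  exact C.ball_ne i ((C.ball_subset_total i).antisymm h)

theorem term_antitone (C : VanishingChain p) : Antitone C.term := fun _ _ hij =>
  Set.sdiff_subset_sdiff_right (C.mono hij)

theorem exists_mem_ball (C : VanishingChain p) {x : PLine p} (h : x ∈ C.total) :
    ∃ i, ∀ j, i ≤ j → x ∈ C.ball j := by
  rw [← C.iUnion_ball] at h
  obtain ⟨i, hi⟩ := Set.mem_iUnion.1 h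
  exact ⟨i, fun j hj => C.mono hj hi⟩

/-- The filter generated by the terms of a vanishing chain. -/
def filter (C : VanishingChain p) : Filter (PLine p) := ⨅ i, 𝓟 (C.term i)

theorem mem_filter_iff {C : VanishingChain p} {S : Set (PLine p)} :
    S ∈ C.filter ↔ ∃ i, C.term i ⊆ S := by
  unfold filter
  rw [mem_iInf_of_directed]
  · simp
  · exact fun i j => ⟨max i j, by simpa using C.term_antitone (le_max_left i j),
      by simpa using C.term_antitone (le_max_right i j)⟩

/-- B_i is a closed disc, or an irrational one, strictly inside the disc of radius ρ. Its radius and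
the distance of its centre from a are both below ρ. -/
theorem annulus_subset_term (C : VanishingChain p) {a : ℂ_[p]} {ρ : ℝ}
    (h : C.total = openDisc a ρ) (i : ℕ) : ∃ s, s < ρ ∧ ∀ z : ℂ_[p], s < ‖z - a‖ → ‖z - a‖ < ρ →
      (z : PLine p) ∈ C.term i := by
  have hsub := C.ball_subset_total i
  rw [h] at hsub
  obtain ⟨b, t, hb, ht⟩ := C.exists_ball_eq_closedDisc fun h0 => infty_notMem_openDisc (hsub h0)
  have hba : ‖b - a‖ < ρ := coe_mem_openDisc_iff.1 (hsub (by
    rw [hb, coe_mem_closedDisc_iff]; simpa using ht.le))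
  obtain ⟨x, hx, hx'⟩ := C.exists_mem_term i
  rw [h] at hx
  obtain ⟨w, hw, rfl⟩ := hx
  rw [hb] at hx'
  have hw' : t < ‖w - b‖ := not_le.1 fun h0 => hx' (coe_mem_closedDisc_iff.2 h0)
  have htρ : t < ρ := hw'.trans_le ((norm_sub_le_max' a w b).trans (max_le hw.le hba.le))
  refine ⟨max t ‖b - a‖, max_lt htρ hba, fun z hz hz' => ⟨?_, ?_⟩⟩
  · rw [h]
    exact coe_mem_openDisc_iff.2 hz'
  · rw [hb, coe_mem_closedDisc_iff]
    intro hle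
    have := norm_sub_le_max' b z a
    rw [norm_sub_rev a b] at this
    exact absurd (this.trans (max_le_max hle le_rfl)) (not_le.2 hz)

/-- Once B_n contains a and a point at distance more than s from a, it contains the whole disc of
radius s about a. -/
theorem term_subset_annulus (C : VanishingChain p) {a : ℂ_[p]} {ρ : ℝ}
    (h : C.total = openDisc a ρ) (hρ : 0 < ρ) {s : ℝ} (hs : s < ρ) : ∃ i, ∀ x ∈ C.term i,
      ∃ z : ℂ_[p], x = z ∧ s < ‖z - a‖ ∧ ‖z - a‖ < ρ := by
  obtain ⟨y, hy1, hy2⟩ := exists_norm_mem_Ioo (K := ℂ_[p]) (le_max_left 0 s) (max_lt hρ hs)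
  have m1 : ((a + y : ℂ_[p]) : PLine p) ∈ C.total := by
    rw [h, coe_mem_openDisc_iff]; simpa using hy2
  have m2 : (a : PLine p) ∈ C.total := by
    rw [h, coe_mem_openDisc_iff]; simpa using hρ
  obtain ⟨i, hi⟩ := C.exists_mem_ball m1
  obtain ⟨j, hj⟩ := C.exists_mem_ball m2
  set n := max i j
  have k1 := hi n (le_max_left i j)
  have k2 := hj n (le_max_right i j)
  have hsub := C.ball_subset_total n
  rw [h] at hsub
  obtain ⟨b, t, hb, ht⟩ := C.exists_ball_eq_closedDisc fun h0 => infty_notMem_openDisc (hsub h0)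
  rw [hb, coe_mem_closedDisc_iff] at k1 k2
  refine ⟨n, fun x hx => ?_⟩
  obtain ⟨hx1, hx2⟩ := hx
  rw [h] at hx1
  obtain ⟨z, hz, rfl⟩ := hx1
  refine ⟨z, rfl, ?_, hz⟩
  rw [hb] at hx2
  have hz' : t < ‖z - b‖ := not_le.1 fun h0 => hx2 (coe_mem_closedDisc_iff.2 h0)
  rw [norm_sub_eq_left' (k2.trans_lt hz')]
  have := norm_sub_le_max' b (a + y) a
  rw [add_sub_cancel_left] at this
  exact ((le_max_right 0 s).trans_lt hy1).trans_le
    (this.trans (max_le (k1.trans hz'.le) (k2.trans hz'.le)))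

theorem coannulus_subset_term (C : VanishingChain p) {a : ℂ_[p]} {ρ : ℝ} (hρ : 0 ≤ ρ)
    (h : C.total = (closedDisc a ρ)ᶜ) (i : ℕ) : ∃ s, ρ < s ∧ ∀ z : ℂ_[p], ρ < ‖z - a‖ →
      ‖z - a‖ < s → (z : PLine p) ∈ C.term i := by
  have hsub := C.ball_subset_total i
  rw [h] at hsub
  have ha : (a : PLine p) ∉ C.ball i := fun h0 => hsub h0 (coe_mem_closedDisc_iff.2 (by simpa))
  by_cases hinf : OnePoint.infty ∈ C.ball i
  · obtain ⟨b, t, hb, ht⟩ := C.exists_ball_eq_compl_openDisc hinf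
    rw [hb, Set.notMem_compl_iff, coe_mem_openDisc_iff] at ha
    obtain ⟨x, hx, hx'⟩ := C.exists_mem_term i
    rw [hb, Set.notMem_compl_iff] at hx'
    obtain ⟨w, hw, rfl⟩ := hx'
    rw [h] at hx
    have hw' : ρ < ‖w - a‖ := not_le.1 fun h0 => hx (coe_mem_closedDisc_iff.2 h0)
    refine ⟨t, hw'.trans_le ((norm_sub_le_max' b w a).trans (max_le hw.le ha.le)),
      fun z hz hz' => ⟨?_, ?_⟩⟩
    · rw [h]
      exact fun h0 => absurd (coe_mem_closedDisc_iff.1 h0) (not_le.2 hz)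
    · rw [hb, Set.notMem_compl_iff, coe_mem_openDisc_iff]
      rw [norm_sub_rev] at ha
      exact (norm_sub_le_max' a z b).trans_lt (max_lt hz' ha)
  · obtain ⟨b, t, hb, ht⟩ := C.exists_ball_eq_closedDisc hinf
    rw [hb, coe_mem_closedDisc_iff, not_le] at ha
    have hbρ : ρ < ‖b - a‖ := not_le.1 fun h0 => hsub (show (b : PLine p) ∈ C.ball i by
      rw [hb, coe_mem_closedDisc_iff]; simpa using ht.le) (coe_mem_closedDisc_iff.2 h0)
    refine ⟨‖b - a‖, hbρ, fun z hz hz' => ⟨?_, ?_⟩⟩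
    · rw [h]
      exact fun h0 => absurd (coe_mem_closedDisc_iff.1 h0) (not_le.2 hz)
    · rw [hb, coe_mem_closedDisc_iff, norm_sub_eq_right' hz', norm_sub_rev]
      exact not_le.2 ha

theorem term_subset_coannulus (C : VanishingChain p) {a : ℂ_[p]} {ρ : ℝ} (hρ : 0 ≤ ρ)
    (h : C.total = (closedDisc a ρ)ᶜ) {s : ℝ} (hs : ρ < s) : ∃ i, ∀ x ∈ C.term i,
      ∃ z : ℂ_[p], x = z ∧ ρ < ‖z - a‖ ∧ ‖z - a‖ < s := by
  obtain ⟨y, hy1, hy2⟩ := exists_norm_mem_Ioo (K := ℂ_[p]) hρ hs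
  have m1 : ((a + y : ℂ_[p]) : PLine p) ∈ C.total := by
    rw [h, Set.mem_compl_iff, coe_mem_closedDisc_iff]; simpa using hy1
  have m2 : OnePoint.infty ∈ C.total := by
    rw [h]; exact infty_notMem_closedDisc
  obtain ⟨i, hi⟩ := C.exists_mem_ball m1
  obtain ⟨j, hj⟩ := C.exists_mem_ball m2
  set n := max i j
  have k1 := hi n (le_max_left i j)
  have k2 := hj n (le_max_right i j)
  have hsub := C.ball_subset_total n
  rw [h] at hsub
  have ha : (a : PLine p) ∉ C.ball n := fun h0 => hsub h0 (coe_mem_closedDisc_iff.2 (by simpa))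
  obtain ⟨b, t, hb, ht⟩ := C.exists_ball_eq_compl_openDisc k2
  rw [hb, Set.notMem_compl_iff, coe_mem_openDisc_iff] at ha
  rw [hb, Set.mem_compl_iff, coe_mem_openDisc_iff, not_lt] at k1
  refine ⟨n, fun x hx => ?_⟩
  obtain ⟨hx1, hx2⟩ := hx
  rw [hb, Set.notMem_compl_iff] at hx2
  obtain ⟨z, hz, rfl⟩ := hx2
  rw [h] at hx1
  refine ⟨z, rfl, not_le.1 fun h0 => hx1 (coe_mem_closedDisc_iff.2 h0), ?_⟩
  have h1 : ‖z - a‖ < t := (norm_sub_le_max' b z a).trans_lt (max_lt hz ha)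
  rw [norm_sub_rev] at ha
  have h2 : t ≤ ‖y‖ := by
    by_contra! hlt
    have := (norm_sub_le_max' a (a + y) b).trans_lt
      (max_lt (by rwa [add_sub_cancel_left]) ((norm_sub_rev b a) ▸ (norm_sub_rev a b) ▸ ha))
    exact absurd k1 (not_le.2 this)
  linarith

end VanishingChain

/-! ### Charts of balls -/

/-- The coordinate `t ↦ b + c t`. -/
def discChart (b c : ℂ_[p]) (t : ℂ_[p]) : PLine p := homPoint (b + c * t) 1

/-- The coordinate `t ↦ a + c / t`. -/
def codiscChart (a c : ℂ_[p]) (t : ℂ_[p]) : PLine p := homPoint (a * t + c) t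

/-- The coordinates used for the balls of the projective line. -/
def IsChart (χ : ℂ_[p] → PLine p) : Prop :=
  ∃ a c : ℂ_[p], c ≠ 0 ∧ (χ = discChart a c ∨ χ = codiscChart a c)

theorem codiscChart_ne {a c : ℂ_[p]} (hc : c ≠ 0) (t : ℂ_[p]) : a * t + c ≠ 0 ∨ t ≠ 0 := by
  by_cases ht : t = 0
  · left; simpa [ht] using hc
  · exact Or.inr ht

theorem IsChart.injective {χ : ℂ_[p] → PLine p} (h : IsChart χ) : Function.Injective χ := by
  obtain ⟨a, c, hc, rfl | rfl⟩ := h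
  · intro t s hts
    unfold discChart at hts
    rw [homPoint_eq_homPoint_iff (by simp) (by simp), mul_one, mul_one] at hts
    exact mul_left_cancel₀ hc (add_left_cancel hts)
  · intro t s hts
    unfold codiscChart at hts
    rw [homPoint_eq_homPoint_iff (codiscChart_ne hc t) (codiscChart_ne hc s)] at hts
    exact (mul_left_cancel₀ hc (by linear_combination hts)).symm

theorem IsChart.exists_isRep {χ : ℂ_[p] → PLine p} (h : IsChart χ) : ∃ A B, IsRep χ A B := by
  obtain ⟨a, c, hc, rfl | rfl⟩ := h
  · exact ⟨C a + C c * X, 1, isCoprime_one_right, fun t => by simp [discChart]⟩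
  · refine ⟨C a * X + C c, X, isCoprime_of_eval_ne fun t => ?_, fun t => by simp [codiscChart]⟩
    simpa using codiscChart_ne hc t

/-- Proportionality of homogeneous coordinates is linear in s. The equation N(t) = s·D(t) remains
meaningful at poles, so no condition on D is needed. -/
theorem IsChart.exists_polynomials {χ χ' : ℂ_[p] → PLine p} (h : IsChart χ) (h' : IsChart χ')
    (R : RatFunc ℂ_[p]) : ∃ N D : ℂ_[p][X], IsCoprime N D ∧
      ∀ t s, ratMap R (χ t) = χ' s ↔ N.eval t = s * D.eval t := by
  obtain ⟨A₀, B₀, h0⟩ := h.exists_isRep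
  have h1 := h0.ratMap_comp R
  set A := homForm (ratDegree R) R.num A₀ B₀
  set B := homForm (ratDegree R) R.denom A₀ B₀
  have hne := fun t => IsCoprime.eval_ne h1.coprime t
  obtain ⟨a, c, hc, rfl | rfl⟩ := h'
  · refine ⟨A - C a * B, C c * B, isCoprime_of_eval_ne fun t => ?_, fun t s => ?_⟩
    · by_cases hB : B.eval t = 0
      · left; simpa [hB] using hne t
      · right; simp [hB, hc]
    · have := h1.eq t
      rw [this, discChart, homPoint_eq_homPoint_iff (hne t) (by simp)]
      simp only [eval_sub, eval_mul, eval_C]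
      constructor <;> intro h <;> linear_combination h
  · refine ⟨C c * B, A - C a * B, isCoprime_of_eval_ne fun t => ?_, fun t s => ?_⟩
    · by_cases hB : B.eval t = 0
      · right; simpa [hB] using hne t
      · left; simp [hB, hc]
    · have := h1.eq t
      rw [this, codiscChart, homPoint_eq_homPoint_iff (hne t) (codiscChart_ne hc s)]
      simp only [eval_sub, eval_mul, eval_C]
      constructor <;> intro h <;> linear_combination -h

theorem discChart_image (b c : ℂ_[p]) (hc : c ≠ 0) (r : ℝ) :
    discChart b c '' {t | ‖t‖ < r} = openDisc b (‖c‖ * r) := by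
  have hc' := norm_pos_iff.2 hc
  ext x
  constructor
  · rintro ⟨t, ht, rfl⟩
    rw [discChart, homPoint_one, coe_mem_openDisc_iff, add_sub_cancel_left, norm_mul]
    exact mul_lt_mul_of_pos_left ht hc'
  · rintro ⟨z, hz, rfl⟩
    refine ⟨(z - b) / c, ?_, ?_⟩
    · rw [Set.mem_ofPred_eq, norm_div, div_lt_iff₀ hc', mul_comm]
      exact hz
    · rw [discChart, mul_div_cancel₀ _ hc, homPoint_one, add_sub_cancel]

theorem codiscChart_of_ne_zero (a c : ℂ_[p]) {t : ℂ_[p]} (ht : t ≠ 0) :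
    codiscChart a c t = ((a + c / t : ℂ_[p]) : PLine p) := by
  rw [codiscChart, ← homPoint_mul_mul (inv_ne_zero ht), inv_mul_cancel₀ ht, homPoint_one]
  congr 1
  field_simp

theorem codiscChart_zero (a c : ℂ_[p]) : codiscChart a c 0 = OnePoint.infty := by
  rw [codiscChart, homPoint_zero]

theorem codiscChart_div (a : ℂ_[p]) {c z : ℂ_[p]} (hc : c ≠ 0) (hz : z ≠ a) :
    codiscChart a c (c / (z - a)) = (z : PLine p) := by
  have := sub_ne_zero.2 hz
  rw [codiscChart_of_ne_zero _ _ (div_ne_zero hc this), div_div_cancel₀ hc, add_sub_cancel]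

theorem codiscChart_image (a c : ℂ_[p]) (hc : c ≠ 0) {r : ℝ} (hr : 0 < r) :
    codiscChart a c '' {t | ‖t‖ < r} = (closedDisc a (‖c‖ / r))ᶜ := by
  have hc' := norm_pos_iff.2 hc
  ext x
  constructor
  · rintro ⟨t, ht, rfl⟩
    by_cases ht0 : t = 0
    · subst ht0
      rw [codiscChart_zero]
      exact infty_notMem_closedDisc
    · rw [codiscChart_of_ne_zero _ _ ht0, Set.mem_compl_iff, coe_mem_closedDisc_iff,
        add_sub_cancel_left, norm_div, not_le]
      exact div_lt_div_of_pos_left hc' (norm_pos_iff.2 ht0) ht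
  · intro hx
    induction x using OnePoint.rec with
    | infty => exact ⟨0, by simpa using hr, codiscChart_zero a c⟩
    | coe z =>
      rw [Set.mem_compl_iff, coe_mem_closedDisc_iff, not_le] at hx
      have h0 : 0 < ‖z - a‖ := (by positivity : 0 < ‖c‖ / r).trans hx
      refine ⟨c / (z - a), ?_, codiscChart_div a hc fun h => ?_⟩
      · rw [Set.mem_ofPred_eq, norm_div]
        rwa [div_lt_comm₀ hr h0] at hx
      · simp [h] at h0

/-- Terms of the chain and annuli at the edge of the ball are cofinal in each other. So the filter
depends on the ball alone, and assertions about chains become assertions about `edge`. -/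
theorem VanishingChain.filter_eq_map_edge (C : VanishingChain p) {χ : ℂ_[p] → PLine p}
    (hχ : IsChart χ) {r : ℝ} (hr : 0 < r) (h : C.total = χ '' {t | ‖t‖ < r}) :
    C.filter = map χ (edge 0 r) := by
  ext S
  rw [mem_map, mem_edge_iff, mem_filter_iff]
  obtain ⟨a, c, hc, rfl | rfl⟩ := hχ
  · have hc' := norm_pos_iff.2 hc
    rw [discChart_image a c hc] at h
    constructor
    · rintro ⟨i, hi⟩
      obtain ⟨s, hs, hs'⟩ := C.annulus_subset_term h i
      refine ⟨s / ‖c‖, by rwa [div_lt_iff₀' hc'], fun t h1 h2 => hi ?_⟩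
      rw [sub_zero] at h1 h2
      rw [discChart, homPoint_one]
      refine hs' _ ?_ ?_
      · rwa [add_sub_cancel_left, norm_mul, ← div_lt_iff₀' hc']
      · rw [add_sub_cancel_left, norm_mul]
        exact mul_lt_mul_of_pos_left h2 hc'
    · rintro ⟨s, hs, hs'⟩
      obtain ⟨i, hi⟩ := C.term_subset_annulus h (mul_pos hc' hr)
        (show ‖c‖ * s < ‖c‖ * r from mul_lt_mul_of_pos_left hs hc')
      refine ⟨i, fun x hx => ?_⟩
      obtain ⟨z, rfl, h1, h2⟩ := hi x hx
      have := hs' ((z - a) / c) (by rwa [sub_zero, norm_div, lt_div_iff₀' hc'])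
        (by rwa [sub_zero, norm_div, div_lt_iff₀' hc'])
      rwa [Set.mem_preimage, discChart, mul_div_cancel₀ _ hc, homPoint_one, add_sub_cancel] at this
  · have hc' := norm_pos_iff.2 hc
    rw [codiscChart_image a c hc hr] at h
    have hρ : 0 < ‖c‖ / r := by positivity
    constructor
    · rintro ⟨i, hi⟩
      obtain ⟨s, hs, hs'⟩ := C.coannulus_subset_term hρ.le h i
      have hs0 := hρ.trans hs
      refine ⟨‖c‖ / s, (div_lt_comm₀ hr hs0).1 hs, fun t h1 h2 => hi ?_⟩
      rw [sub_zero] at h1 h2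
      have h0 : 0 < ‖t‖ := (by positivity : 0 < ‖c‖ / s).trans h1
      rw [codiscChart_of_ne_zero _ _ (norm_pos_iff.1 h0)]
      refine hs' _ ?_ ?_
      · rw [add_sub_cancel_left, norm_div]
        exact div_lt_div_of_pos_left hc' h0 h2
      · rw [add_sub_cancel_left, norm_div]
        exact (div_lt_comm₀ hs0 h0).1 h1
    · rintro ⟨s, hs, hs'⟩
      have hm : 0 < max s (r / 2) := lt_max_of_lt_right (by linarith)
      obtain ⟨i, hi⟩ := C.term_subset_coannulus hρ.le h
        (show ‖c‖ / r < ‖c‖ / max s (r / 2) from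
          div_lt_div_of_pos_left hc' hm (max_lt hs (by linarith)))
      refine ⟨i, fun x hx => ?_⟩
      obtain ⟨z, rfl, h1, h2⟩ := hi x hx
      have h0 : 0 < ‖z - a‖ := hρ.trans h1
      have := hs' (c / (z - a))
        (by
          rw [sub_zero, norm_div]
          exact (le_max_left _ _).trans_lt ((lt_div_comm₀ h0 hm).1 h2))
        (by rw [sub_zero, norm_div]; exact (div_lt_comm₀ hr h0).1 h1)
      rwa [Set.mem_preimage, codiscChart_div a hc] at this
      rintro rfl
      simp at h0

end Charts

end

end PadicDynamics

namespace PadicDynamics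

noncomputable section

open Polynomial Filter Topology

/-! ### The action of a rational function on ends; irrational and singular points. -/

section EdgeDynamics

variable {p : ℕ} [Fact p.Prime]

theorem exists_edgeMap_of_tendsto {χ χ' : ℂ_[p] → PLine p} (hχ : IsChart χ) (hχ' : IsChart χ')
    {ρ ρ' : ℝ} (hρ : 0 < ρ) (hρ' : 0 < ρ') (Q : RatFunc ℂ_[p])
    (h : Tendsto (fun t => ratMap Q (χ t)) (edge 0 ρ) (map χ' (edge 0 ρ'))) :
    ∃ (N D : ℂ_[p][X]) (k : ℕ), (∀ t s, ratMap Q (χ t) = χ' s ↔ N.eval t = s * D.eval t) ∧ D ≠ 0 ∧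
      Tendsto (fun t => N.eval t / D.eval t) (edge 0 ρ) (edge 0 ρ') ∧ EdgeMap N D ρ ρ' k := by
  obtain ⟨N, D, hcop, hND⟩ := hχ.exists_polynomials hχ' Q
  have hne := edge_neBot (0 : ℂ_[p]) hρ
  have key : ∀ t s, ratMap Q (χ t) = χ' s → D.eval t ≠ 0 ∧ N.eval t / D.eval t = s := by
    intro t s hts
    have h1 := (hND t s).1 hts
    have h2 : D.eval t ≠ 0 := by
      intro h0
      have := IsCoprime.eval_ne hcop t
      simp [h1, h0] at this
    exact ⟨h2, by rw [h1, mul_div_cancel_right₀ _ h2]⟩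
  have hT : Tendsto (fun t => N.eval t / D.eval t) (edge 0 ρ) (edge 0 ρ') := by
    intro U hU
    have : χ' '' U ∈ map χ' (edge 0 ρ') := image_mem_map hU
    refine Filter.mem_map.2 ?_
    filter_upwards [Filter.mem_map.1 (h this)] with t ht
    obtain ⟨s, hs, hs'⟩ := ht
    rw [Set.mem_preimage, (key t s hs'.symm).2]
    exact hs
  have hD : D ≠ 0 := by
    rintro rfl
    have : χ' '' Set.univ ∈ map χ' (edge 0 ρ') := image_mem_map univ_mem
    obtain ⟨t, s, -, hs⟩ := (h.eventually this).exists
    exact (key t s hs.symm).1 eval_zero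
  obtain ⟨k, hk⟩ := exists_edgeMap hρ hρ' hD hT
  exact ⟨N, D, k, hND, hD, hT, hk⟩

/-- The degree along the terms of a vanishing chain is at most the exponent of the edge map. -/
theorem EdgeMap.degree_le {χ χ' : ℂ_[p] → PLine p} (hχ : IsChart χ)
    {ρ ρ' : ℝ} (hρ : 0 < ρ) {Q : RatFunc ℂ_[p]} (hQ : Function.Surjective (ratMap Q))
    {N D : ℂ_[p][X]} {k : ℕ} (hND : ∀ t s, ratMap Q (χ t) = χ' s ↔ N.eval t = s * D.eval t)
    (hD : D ≠ 0) (hT : Tendsto (fun t => N.eval t / D.eval t) (edge 0 ρ) (edge 0 ρ'))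
    (h : EdgeMap N D ρ ρ' k) {C : VanishingChain p} (hC : C.filter = map χ (edge 0 ρ)) {m i₀ : ℕ}
    (hm : ∀ i, i₀ ≤ i → IsOfDegree Q (C.term i) (ratMap Q '' C.term i) m) : m ≤ k := by
  have hne := edge_neBot (0 : ℂ_[p]) hρ
  obtain ⟨r, hr0, hr, hev⟩ := h.ncard_fiber_le hρ hD hT
  have hmem : χ '' {t | r < ‖t‖ ∧ ‖t‖ < ρ} ∈ C.filter := by
    rw [hC]
    refine image_mem_map ?_
    exact mem_edge_iff.2 ⟨r, hr, fun z h1 h2 => by simpa using And.intro h1 h2⟩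
  obtain ⟨i, hi⟩ := VanishingChain.mem_filter_iff.1 hmem
  set j := max i i₀
  have hj : C.term j ⊆ χ '' {t | r < ‖t‖ ∧ ‖t‖ < ρ} :=
    (C.term_antitone (le_max_left i i₀)).trans hi
  have hterm : ∀ᶠ t in edge 0 ρ, χ t ∈ C.term j := by
    have : C.term j ∈ C.filter := VanishingChain.mem_filter_iff.2 ⟨j, subset_rfl⟩
    rwa [hC] at this
  -- Only finitely many parameters have a critical value as image. For a t₀ avoiding them, the
  -- degree m is the number of points of the fibre in the term, all of which lie in the annulus
  -- where k is an upper bound.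
  have hfin : {t | ∃ z, localDegree Q z ≠ 1 ∧ ratMap Q z = ratMap Q (χ t)}.Finite := by
    have h1 := (finite_localDegree_ne_one Q hQ).biUnion fun z _ =>
      finite_ratMap_preimage Q hQ (ratMap Q z)
    refine (h1.preimage (f := χ) hχ.injective.injOn).subset ?_
    rintro t ⟨z, hz, hz'⟩
    exact Set.mem_biUnion (show z ∈ {x | localDegree Q x ≠ 1} from hz) hz'.symm
  obtain ⟨t₀, h1, h2, h3, h4⟩ := (hterm.and ((eventually_notMem_finite_edge 0 ρ hfin).and
    ((eventually_eval_ne_zero_edge hD 0 ρ).and hev))).exists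
  have hb : N.eval t₀ = N.eval t₀ / D.eval t₀ * D.eval t₀ := (div_mul_cancel₀ _ h3).symm
  obtain ⟨f1, f2⟩ := h4 _ hb
  rw [← ncard_fiber_of_isOfDegree (hm j (le_max_right _ _)) (Set.mem_image_of_mem _ h1)
    fun z hz hz' => h2 ⟨z, hz, hz'⟩]
  refine le_trans (Set.ncard_le_ncard ?_ (f1.image χ)) ((Set.ncard_image_le f1).trans f2)
  rintro z ⟨hz, hz'⟩
  obtain ⟨t, ht, rfl⟩ := hj hz
  refine ⟨t, ⟨?_, ht⟩, rfl⟩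
  rw [(hND t₀ _).2 hb] at hz'
  exact (hND t _).1 hz'

/-- The ball of a rational end is determined by the filter of its vanishing chains. -/
theorem image_subset_of_map_edge_eq {χ χ' : ℂ_[p] → PLine p} (hχ : IsChart χ) (hχ' : IsChart χ')
    (h : map χ (edge 0 1) = map χ' (edge 0 1)) :
    χ '' {t | ‖t‖ < 1} = χ' '' {t | ‖t‖ < 1} := by
  have key : ∀ {χ χ' : ℂ_[p] → PLine p}, IsChart χ → IsChart χ' →
      map χ (edge 0 1) = map χ' (edge 0 1) → χ' '' {t | ‖t‖ < 1} ⊆ χ '' {t | ‖t‖ < 1} := by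
    intro χ χ' hχ hχ' h
    -- The identity is an edge map from one ball to the other, and edge maps attain every point of
    -- the target ball.
    obtain ⟨N, D, k, hND, -, -, hk⟩ := exists_edgeMap_of_tendsto hχ hχ' one_pos one_pos RatFunc.X
      (by rw [ratMap_X]; exact h.le)
    rintro _ ⟨s, hs, rfl⟩
    obtain ⟨t, ht, hts⟩ := hk.exists_root hs
    exact ⟨t, ht, by simpa [ratMap_X] using (hND t s).2 hts⟩
  exact (key hχ' hχ h.symm).antisymm (key hχ hχ' h)

theorem VanishingChain.filter_eq_map_of_term_eq {C C' : VanishingChain p}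
    {f : PLine p → PLine p} {M : ℕ} (h : ∀ i, C'.term i = f '' C.term (M + i)) :
    C'.filter = map f C.filter := by
  ext S
  rw [mem_map, mem_filter_iff, mem_filter_iff]
  constructor
  · rintro ⟨i, hi⟩
    refine ⟨M + i, ?_⟩
    rw [h] at hi
    exact Set.image_subset_iff.1 hi
  · rintro ⟨i, hi⟩
    refine ⟨i, ?_⟩
    rw [h, Set.image_subset_iff]
    exact (C.term_antitone (Nat.le_add_left i M)).trans hi

theorem VanishingChain.ball_toEnd (C : VanishingChain p) : C.toEnd.ball = C.total := rfl

theorem End.exists_chain (P : End p) : ∃ C : VanishingChain p, C.toEnd = P :=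
  Quotient.exists_rep P

theorem PointIterMapsTo.exists_chain {R : RatFunc ℂ_[p]} {n : ℕ} {S S' : HypSpace p}
    (h : PointIterMapsTo R n S S') {C : VanishingChain p} (hC : C.toEnd ∈ S.1) :
    ∃ (C' : VanishingChain p) (M : ℕ), C'.toEnd ∈ S'.1 ∧
      ∀ i, C'.term i = (ratMap R)^[n] '' C.term (M + i) := by
  induction n generalizing S' with
  | zero =>
    have h : S = S' := h
    subst h
    exact ⟨C, 0, hC, fun i => by simp⟩
  | succ n ih =>
    obtain ⟨S'', h1, h2⟩ := h
    obtain ⟨C', M, hC', hM⟩ := ih h1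
    obtain ⟨P', hP', d, -, h3⟩ := h2 _ hC'
    obtain ⟨N, ⟨C'', hC'', hN⟩, -⟩ := h3 C' rfl
    refine ⟨C'', M + N, hC'' ▸ hP', fun i => ?_⟩
    rw [hN, hM, ← Set.image_comp, ← Function.iterate_succ', add_assoc]

/-! ### Irrational points are not repelling -/

theorem pow_ne_norm_of_irrational {ρ : ℝ} (hρ : 0 < ρ) (hirr : ∀ c : ℂ_[p], ‖c‖ ≠ ρ) {m : ℕ}
    (hm : m ≠ 0) (q : ℂ_[p]) : ‖q‖ ≠ ρ ^ m := by
  intro h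
  obtain ⟨x, hx⟩ := IsAlgClosed.exists_pow_nat_eq q (Nat.pos_of_ne_zero hm)
  refine hirr x ?_
  rw [← hx, norm_pow] at h
  exact (pow_left_inj₀ (norm_nonneg x) hρ.le hm).1 h

/-- The constant in |N/D| = c|t|^k is itself in the value group, as one value of t near the edge
shows. -/
theorem EdgeMap.exists_norm_mul_pow_eq {N D : ℂ_[p][X]} {ρ ρ' : ℝ} {k : ℕ}
    (h : EdgeMap N D ρ ρ' k) (hρ : 0 < ρ) (hρ' : 0 < ρ') (hD : D ≠ 0) :
    ∃ q : ℂ_[p], q ≠ 0 ∧ ‖q‖ * ρ ^ k = ρ' := by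
  have hne := edge_neBot (0 : ℂ_[p]) hρ
  have hN : N ≠ 0 := h.pos hρ'
  obtain ⟨t, h1, h2, h3⟩ := ((h.norm_eval_edge hρ hD).and ((eventually_eval_ne_zero_edge hD 0 ρ).and
    (eventually_lt_norm_edge 0 hρ))).exists
  rw [sub_zero] at h3
  have hq : ‖N.eval t / (t ^ k * D.eval t)‖ = edgeConst N 0 ρ / edgeConst D 0 ρ := by
    have := norm_pos_iff.2 h2
    rw [norm_div, norm_mul, norm_pow, h1]
    field_simp
  have hcD := edgeConst_pos hD 0 hρ
  refine ⟨N.eval t / (t ^ k * D.eval t), norm_pos_iff.1 ?_, ?_⟩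
  · rw [hq]
    exact div_pos (edgeConst_pos hN 0 hρ) hcD
  · rw [hq, div_mul_eq_mul_div, h.const_eq, mul_div_cancel_right₀ _ hcD.ne']

/-- The end of the disc of radius ρ goes to itself or to the opposite end. With k ≥ d ≥ 2 in the
first case, a positive power of ρ, namely ρ^(k-1) or ρ^(k+1), is in the value group. Since that
group is divisible, ρ would be rational. -/
theorem not_repelling_of_irrational {S : Set (End p)} (hS : IsIrrationalPoint S)
    {Q : RatFunc ℂ_[p]} (hQ : Function.Surjective (ratMap Q)) {d : ℕ} (hd : 1 < d)
    (hmaps : ∀ C : VanishingChain p, C.toEnd ∈ S → ∃ C' : VanishingChain p, C'.toEnd ∈ S ∧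
      C'.filter = map (ratMap Q) C.filter)
    (hdeg : ∀ P ∈ S, ∃ P', EndMapsTo Q P P' d) : False := by
  obtain ⟨P, P', hP, -, hPP', rfl⟩ := hS
  obtain ⟨a, ρ, hρ, hirr, hball⟩ := hP
  have hall : ∀ P₀ ∈ ({P, P'} : Set (End p)),
      P₀.ball = openDisc a ρ ∨ P₀.ball = (openDisc a ρ)ᶜ := by
    rintro P₀ (rfl | rfl)
    · exact hball
    · rw [hPP']
      rcases hball with h | h <;> simp [h]
  obtain ⟨P₀, hP₀, hb⟩ : ∃ P₀ ∈ ({P, P'} : Set (End p)), P₀.ball = openDisc a ρ := by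
    rcases hball with h | h
    · exact ⟨P, by simp, h⟩
    · exact ⟨P', by simp, by rw [hPP', h, compl_compl]⟩
  obtain ⟨C, rfl⟩ := P₀.exists_chain
  rw [C.ball_toEnd] at hb
  have hχ : IsChart (discChart a 1) := ⟨a, 1, one_ne_zero, Or.inl rfl⟩
  have hCf : C.filter = map (discChart a 1) (edge 0 ρ) :=
    C.filter_eq_map_edge hχ hρ (by rw [discChart_image a 1 one_ne_zero, norm_one, one_mul, hb])
  obtain ⟨C', hC', hCC'⟩ := hmaps C hP₀
  obtain ⟨P₁, -, hdeg⟩ := hdeg _ hP₀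
  obtain ⟨i₀, -, hi₀⟩ := hdeg C rfl
  have hirr' : openDisc a ρ = closedDisc a ρ := openDisc_eq_closedDisc hirr
  rcases hall _ hC' with hb' | hb' <;> rw [C'.ball_toEnd] at hb'
  · have hCf' : C'.filter = map (discChart a 1) (edge 0 ρ) :=
      C'.filter_eq_map_edge hχ hρ (by rw [discChart_image a 1 one_ne_zero, norm_one, one_mul, hb'])
    obtain ⟨N, D, k, hND, hD, hT, hk⟩ := exists_edgeMap_of_tendsto hχ hχ hρ hρ Q
      (by rw [← hCf', hCC', hCf, Filter.map_map]; exact tendsto_map)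
    have hdk := hk.degree_le hχ hρ hQ hND hD hT hCf hi₀
    obtain ⟨q, hq0, hq⟩ := hk.exists_norm_mul_pow_eq hρ hρ hD
    obtain ⟨e, rfl⟩ : ∃ e, k = e + 1 := ⟨k - 1, by omega⟩
    refine pow_ne_norm_of_irrational hρ hirr (m := e) (by omega) q⁻¹ ?_
    have hq' := norm_pos_iff.2 hq0
    rw [pow_succ, ← mul_assoc] at hq
    have : ‖q‖ * ρ ^ e = 1 := mul_right_cancel₀ hρ.ne' (by rw [hq, one_mul])
    rw [norm_inv, eq_comm]
    exact eq_inv_of_mul_eq_one_right this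
  · have hχ' : IsChart (codiscChart a 1) := ⟨a, 1, one_ne_zero, Or.inr rfl⟩
    have hρ' : 0 < ρ⁻¹ := inv_pos.2 hρ
    have hCf' : C'.filter = map (codiscChart a 1) (edge 0 ρ⁻¹) :=
      C'.filter_eq_map_edge hχ' hρ' (by
        rw [codiscChart_image a 1 one_ne_zero hρ', norm_one, one_div, inv_inv, hb', hirr'])
    obtain ⟨N, D, k, hND, hD, hT, hk⟩ := exists_edgeMap_of_tendsto hχ hχ' hρ hρ' Q
      (by rw [← hCf', hCC', hCf, Filter.map_map]; exact tendsto_map)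
    obtain ⟨q, hq0, hq⟩ := hk.exists_norm_mul_pow_eq hρ hρ' hD
    refine pow_ne_norm_of_irrational hρ hirr (m := k + 1) (by omega) q⁻¹ ?_
    have hq' := norm_pos_iff.2 hq0
    rw [norm_inv, eq_comm, pow_succ]
    refine eq_inv_of_mul_eq_one_right ?_
    rw [← mul_assoc, hq, inv_mul_cancel₀ hρ.ne']

/-! ### Singular points are not repelling -/

theorem norm_eval_eq_edgeConst {A : ℂ_[p][X]} {a : ℂ_[p]} {ρ : ℝ}
    (h : ∀ w, ‖w - a‖ < ρ → A.eval w ≠ 0) {z : ℂ_[p]} (hz : ‖z - a‖ < ρ) :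
    ‖A.eval z‖ = edgeConst A a ρ := by
  have h' : ∀ w ∈ A.roots, ¬ ‖w - a‖ < ρ := fun w hw hw' => h w hw' (isRoot_of_mem_roots hw)
  have h0 : edgeCount A a ρ = 0 := by
    classical
    unfold edgeCount
    rw [Multiset.filter_eq_nil.2 h', Multiset.card_zero]
  rw [norm_eval_eq A hz fun w hw hw' => absurd hw' (h' w hw), h0, pow_zero, mul_one]

/-- The terms of the chain are eventually discs shrinking to the empty set, so some term contains no
pole and no isolated fixed point. There either Q is the identity, or |Q(z) - z| is a constant
smaller than the radius. Q then preserves large distances in the disc, which leaves one zero per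
fibre. -/
theorem not_repelling_of_singular {S : Set (End p)} (hS : IsSingularPoint S)
    {Q : RatFunc ℂ_[p]} (hQ : Function.Surjective (ratMap Q)) {d : ℕ} (hd : 1 < d)
    (hmaps : ∀ C : VanishingChain p, C.toEnd ∈ S → ∃ (C' : VanishingChain p) (M : ℕ),
      C'.toEnd ∈ S ∧ ∀ i, C'.term i = ratMap Q '' C.term (M + i))
    (hdeg : ∀ P ∈ S, ∃ P', EndMapsTo Q P P' d) : False := by
  obtain ⟨P, hP, rfl⟩ := hS
  obtain ⟨C, rfl⟩ := P.exists_chain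
  have htot : C.total = Set.univ := hP
  obtain ⟨C', M, hC', hM⟩ := hmaps C rfl
  have hequiv : C'.Equiv C := Quotient.exact hC'
  have htot' : C'.total = Set.univ := by
    rw [← htot]
    exact hequiv.total_subset.antisymm hequiv.symm.total_subset
  obtain ⟨P₁, -, hdeg⟩ := hdeg _ rfl
  obtain ⟨i₀, -, hi₀⟩ := hdeg C rfl
  have hterm : ∀ i x, x ∈ C.term i ↔ x ∉ C.ball i := fun i x => by
    simp [VanishingChain.term, htot]
  obtain ⟨i₁, hi₁⟩ := C.exists_mem_ball (x := OnePoint.infty) (by rw [htot]; trivial)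
  have hdisc : ∀ i, i₁ ≤ i → ∃ b t, C.term i = openDisc b t ∧ 0 < t := by
    intro i hi
    obtain ⟨b, t, hb, ht⟩ := C.exists_ball_eq_compl_openDisc (hi₁ i hi)
    refine ⟨b, t, ?_, ht⟩
    ext x
    rw [hterm, hb, Set.notMem_compl_iff]
  have hgen : ∀ (b : ℂ_[p]) (t : ℝ), 0 < t → ∃ z : ℂ_[p], ‖z - b‖ < t ∧
      ∀ x, localDegree Q x ≠ 1 → ratMap Q x ≠ ratMap Q (z : PLine p) := by
    intro b t ht
    have hne := edge_neBot b ht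
    have h1 := (finite_localDegree_ne_one Q hQ).biUnion fun z _ =>
      finite_ratMap_preimage Q hQ (ratMap Q z)
    obtain ⟨z, h2, h3⟩ := ((eventually_norm_lt_edge b t).and (eventually_notMem_finite_edge b t
      (h1.preimage (f := fun z : ℂ_[p] => (z : PLine p)) OnePoint.coe_injective.injOn))).exists
    refine ⟨z, h2, fun x hx hxz => h3 ?_⟩
    exact Set.mem_biUnion (show x ∈ {x | localDegree Q x ≠ 1} from hx) hxz.symm
  have havoid : ∀ F : Set ℂ_[p], F.Finite → ∃ i, ∀ j, i ≤ j → ∀ z ∈ F, (z : PLine p) ∉ C.term j := by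
    intro F hF
    induction F, hF using Set.Finite.induction_on with
    | empty => exact ⟨0, by simp⟩
    | @insert z F _ _ ih =>
      obtain ⟨i, hi⟩ := ih
      obtain ⟨j, hj⟩ := C.exists_mem_ball (x := (z : PLine p)) (by rw [htot]; trivial)
      refine ⟨max i j, fun l hl w hw => ?_⟩
      rcases hw with rfl | hw
      · rw [hterm, not_not]
        exact hj l ((le_max_right i j).trans hl)
      · exact hi l ((le_max_left i j).trans hl) w hw
  have hD := Q.denom_ne_zero
  obtain ⟨n, hn0, hn1, b, t, hnt, ht, hnD, hnG⟩ : ∃ n, i₀ ≤ n ∧ i₁ ≤ n ∧ ∃ b t, C.term n =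
      openDisc b t ∧ 0 < t ∧ (∀ w : ℂ_[p], ‖w - b‖ < t → Q.denom.eval w ≠ 0) ∧
      (Q.num - X * Q.denom ≠ 0 → ∀ w : ℂ_[p], ‖w - b‖ < t → (Q.num - X * Q.denom).eval w ≠ 0) := by
    obtain ⟨j₁, hj₁⟩ := havoid _ (finite_setOf_eval_eq_zero hD)
    obtain ⟨j₂, hj₂⟩ : ∃ i, Q.num - X * Q.denom ≠ 0 → ∀ j, i ≤ j → ∀ z : ℂ_[p],
        (Q.num - X * Q.denom).eval z = 0 → (z : PLine p) ∉ C.term j := by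
      by_cases hG : Q.num - X * Q.denom = 0
      · exact ⟨0, fun h => absurd hG h⟩
      · obtain ⟨i, hi⟩ := havoid _ (finite_setOf_eval_eq_zero hG)
        exact ⟨i, fun _ => hi⟩
    set n := max (max i₀ i₁) (max j₁ j₂)
    obtain ⟨b, t, hnt, ht⟩ := hdisc n (by omega)
    refine ⟨n, by omega, by omega, b, t, hnt, ht, fun w hw hw' => ?_, fun hG w hw hw' => ?_⟩
    · exact hj₁ n (by omega) w hw' (hnt ▸ coe_mem_openDisc_iff.2 hw)
    · exact hj₂ hG n (by omega) w hw' (hnt ▸ coe_mem_openDisc_iff.2 hw)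
  obtain ⟨z₀, hz₀, hcrit⟩ := hgen b t ht
  have hz₀' : (z₀ : PLine p) ∈ C.term n := hnt ▸ coe_mem_openDisc_iff.2 hz₀
  have hcard := ncard_fiber_of_isOfDegree (hi₀ n hn0) (Set.mem_image_of_mem _ hz₀') hcrit
  set f : ℂ_[p] → ℂ_[p] := fun z => Q.num.eval z / Q.denom.eval z with hf
  have hfz : ∀ z, ‖z - b‖ < t → ratMap Q (z : PLine p) = (f z : PLine p) := fun z hz => by
    rw [ratMap_coe, if_neg (hnD z hz)]
  set G := Q.num - X * Q.denom with hG
  have hGf : ∀ z, ‖z - b‖ < t → G.eval z = (f z - z) * Q.denom.eval z := fun z hz => by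
    rw [hG, hf, eval_sub, eval_mul, eval_X, sub_mul, div_mul_cancel₀ _ (hnD z hz)]
  by_cases hG0 : G = 0
  · have hid : ∀ z, ‖z - b‖ < t → f z = z := fun z hz => by
      have := hGf z hz
      rw [hG0, eval_zero, eq_comm, mul_eq_zero, or_iff_left (hnD z hz), sub_eq_zero] at this
      exact this
    have : {z | z ∈ C.term n ∧ ratMap Q z = ratMap Q (z₀ : PLine p)} ⊆ {(z₀ : PLine p)} := by
      rintro z ⟨h1, h2⟩
      rw [hnt] at h1
      obtain ⟨z, hz, rfl⟩ := h1
      have hz : ‖z - b‖ < t := hz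
      change ratMap Q (z : PLine p) = _ at h2
      rw [hfz z hz, hfz z₀ hz₀, hid z hz, hid z₀ hz₀] at h2
      exact h2
    have := Set.ncard_le_ncard this
    rw [hcard, Set.ncard_singleton] at this
    omega
  · set c := edgeConst G b t / edgeConst Q.denom b t with hc
    have hcD : 0 < edgeConst Q.denom b t := edgeConst_pos hD b ht
    have hfc : ∀ z, ‖z - b‖ < t → ‖f z - z‖ = c := fun z hz => by
      have := hGf z hz
      rw [hc, eq_div_iff hcD.ne', ← norm_eval_eq_edgeConst hnD hz, ← norm_mul, ← this,
        norm_eval_eq_edgeConst (hnG hG0) hz]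
    -- Invariance of the end: a point z far along the chain is sent back into the n-th term, so z
    -- and f(z) lie in one disc of radius t.
    have hct : c < t := by
      obtain ⟨m, hm, h1, h2⟩ := hequiv.symm n
      set l := max (M + m) n
      obtain ⟨x, -, hx⟩ := C.exists_mem_term l
      rw [← hterm] at hx
      have hx1 := C.term_antitone (le_max_right (M + m) n) hx
      have hx2 := C.term_antitone (le_max_left (M + m) n) hx
      rw [hnt] at hx1
      obtain ⟨z, hz, rfl⟩ := hx1
      have hz : ‖z - b‖ < t := hz
      have hx3 : ratMap Q (z : PLine p) ∈ C.term n := by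
        have : ratMap Q (z : PLine p) ∈ C'.term m := by
          rw [hM]
          exact Set.mem_image_of_mem _ hx2
        rw [hterm]
        exact fun h => this.2 (h1 h)
      rw [hfz z hz, hnt, coe_mem_openDisc_iff] at hx3
      rw [← hfc z hz]
      exact (norm_sub_le_max' b _ _).trans_lt (max_lt hx3 hz)
    set A := Q.num - Polynomial.C (f z₀) * Q.denom with hA
    have hA0 : A ≠ 0 := num_sub_C_mul_denom_ne_zero Q hQ _
    have hz₀b : ∀ z, ‖z - z₀‖ < t → ‖z - b‖ < t := fun z hz => by
      have := norm_sub_le_max' z₀ z b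
      rw [norm_sub_rev b] at this
      exact this.trans_lt (max_lt hz hz₀)
    -- For |z - z₀| > c the displacements of z and z₀ are negligible, so |f(z) - f(z₀)| = |z - z₀|:
    -- the growth exponent near the edge is 1.
    have hcount : edgeCount A z₀ t = 1 := by
      refine (monomial_unique_of_eventually (a := z₀) (ρ := t) (C := edgeConst A z₀ t)
        (C' := edgeConst Q.denom b t) (edgeConst_pos hA0 _ ht) hcD ht ?_).1
      filter_upwards [eventually_norm_eval_edge A z₀ t, eventually_norm_lt_edge z₀ t,
        eventually_lt_norm_edge z₀ hct] with z h1 h2 h3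
      have hzb := hz₀b z h2
      have h4 : A.eval z = (f z - f z₀) * Q.denom.eval z := by
        rw [hA, eval_sub, eval_mul, eval_C, sub_mul, hf]
        simp only
        rw [div_mul_cancel₀ _ (hnD z hzb)]
      have h5 : ‖f z - f z₀‖ = ‖z - z₀‖ := by
        have h6 : f z - f z₀ = (z - z₀) + ((f z - z) - (f z₀ - z₀)) := by ring
        have h7 : ‖(f z - z) - (f z₀ - z₀)‖ ≤ c := by
          have := norm_sub_le_max' 0 (f z - z) (f z₀ - z₀)
          rwa [sub_zero, sub_zero, hfc z hzb, hfc z₀ hz₀, max_self] at this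
        rw [h6, norm_add_eq_left (h7.trans_lt h3)]
      rw [← h1, h4, norm_mul, h5, norm_eval_eq_edgeConst hnD hzb, pow_one, mul_comm]
    have hle : {z | z ∈ C.term n ∧ ratMap Q z = ratMap Q (z₀ : PLine p)}.ncard ≤ 1 := by
      classical
      have h1 : {z | z ∈ C.term n ∧ ratMap Q z = ratMap Q (z₀ : PLine p)} ⊆
          (fun z : ℂ_[p] => (z : PLine p)) '' {w | A.eval w = 0 ∧ ‖w - z₀‖ < t} := by
        rintro z ⟨h1, h2⟩
        rw [hnt] at h1
        obtain ⟨z, hz, rfl⟩ := h1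
        have hz : ‖z - b‖ < t := hz
        refine ⟨z, ⟨?_, (norm_sub_le_max' b z z₀).trans_lt (max_lt hz hz₀)⟩, rfl⟩
        change ratMap Q (z : PLine p) = _ at h2
        rw [hfz z₀ hz₀, ratMap_coe_eq_coe_iff] at h2
        rw [hA, eval_sub, eval_mul, eval_C, h2, sub_self]
      have hfin : {w | A.eval w = 0 ∧ ‖w - z₀‖ < t}.Finite :=
        (finite_setOf_eval_eq_zero hA0).subset fun w hw => hw.1
      refine (Set.ncard_le_ncard h1 (hfin.image _)).trans ((Set.ncard_image_le hfin).trans ?_)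
      refine (ncard_setOf_root_le_card hA0 _).trans (le_of_eq ?_)
      rw [← hcount]
      unfold edgeCount
      congr
    exact absurd (hcard.symm.trans_le hle) (not_le.2 hd)

end EdgeDynamics

end

end PadicDynamics

namespace PadicDynamics

noncomputable section

open Polynomial Filter Topology

/-! ### Residue classes and their images under automorphisms. -/

section Gauss

variable {p : ℕ} [Fact p.Prime]

theorem mem_padicComplexInt_iff {z : ℂ_[p]} : z ∈ 𝓞_ℂ_[p] ↔ ‖z‖ ≤ 1 := by
  change Valued.v z ≤ 1 ↔ _
  rw [PadicComplex.norm_eq_norm, ← map_one (PadicComplex.valued p).v, ← Valuation.restrict_le_iff,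
    ← (Valuation.RankOne.strictMono (Valued.v : Valuation ℂ_[p] _)).le_iff_le, map_one, map_one]
  rfl

theorem mem_maximalIdeal_padicComplexInt_iff {z : 𝓞_ℂ_[p]} :
    z ∈ IsLocalRing.maximalIdeal 𝓞_ℂ_[p] ↔ ‖(z : ℂ_[p])‖ < 1 := by
  rw [← ValuationSubring.coe_mem_nonunits_iff, ValuationSubring.mem_nonunits_iff_or,
    mem_padicComplexInt_iff, norm_inv, not_le]
  constructor
  · rintro (h | h)
    · simp [h]
    · exact (one_lt_inv_iff₀.1 h).2
  · intro h
    by_cases h0 : (z : ℂ_[p]) = 0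
    · exact Or.inl h0
    · exact Or.inr (one_lt_inv_iff₀.2 ⟨norm_pos_iff.2 h0, h⟩)

theorem residue_eq_residue_iff {z w : 𝓞_ℂ_[p]} :
    IsLocalRing.residue _ z = IsLocalRing.residue _ w ↔ ‖(z : ℂ_[p]) - w‖ < 1 := by
  rw [← sub_eq_zero, ← map_sub, IsLocalRing.residue_eq_zero_iff,
    mem_maximalIdeal_padicComplexInt_iff]
  rfl

/-- A monic lift has a root in ℂ_p. The root is integral, hence in the integrally closed ring of
integers, and it reduces to a root. -/
instance isAlgClosed_residueField : IsAlgClosed (ResidueField p) := by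
  refine IsAlgClosed.of_exists_root _ fun f hf hirr => ?_
  obtain ⟨q, hq, hdeg, hmon⟩ := lifts_and_natDegree_eq_and_monic
    (f := IsLocalRing.residue 𝓞_ℂ_[p])
    ((mem_lifts _).2 (map_surjective _ IsLocalRing.residue_surjective f)) hf
  have h0 : (q.map (algebraMap 𝓞_ℂ_[p] ℂ_[p])).degree ≠ 0 := by
    rw [hmon.degree_map, degree_eq_natDegree hmon.ne_zero, hdeg]
    exact_mod_cast hirr.natDegree_pos.ne'
  obtain ⟨z, hz⟩ := IsAlgClosed.exists_root _ h0
  have hint : IsIntegral 𝓞_ℂ_[p] z := ⟨q, hmon, by rwa [IsRoot.def, eval_map] at hz⟩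
  obtain ⟨y, rfl⟩ := IsIntegrallyClosed.isIntegral_iff.1 hint
  refine ⟨IsLocalRing.residue _ y, ?_⟩
  rw [IsRoot.def, eval_map, eval₂_at_apply] at hz
  rw [← hq, eval_map, eval₂_at_apply,
    (FaithfulSMul.algebraMap_injective 𝓞_ℂ_[p] ℂ_[p]) (hz.trans (map_zero _).symm), map_zero]

theorem coe_mem_canonicalBall_residue_iff {ξ : 𝓞_ℂ_[p]} {z : ℂ_[p]} :
    (z : PLine p) ∈ canonicalBall (IsLocalRing.residue _ ξ : OnePoint (ResidueField p)) ↔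
      ‖z - ξ‖ < 1 := by
  constructor
  · rintro ⟨w, hw, hwz⟩
    rw [← OnePoint.coe_injective hwz]
    exact residue_eq_residue_iff.1 hw
  · intro h
    have hz : ‖z‖ ≤ 1 := by
      have h1 := norm_sub_le_max' (ξ : ℂ_[p]) z 0
      rw [sub_zero, zero_sub, norm_neg] at h1
      exact h1.trans (max_le h.le (mem_padicComplexInt_iff.1 ξ.2))
    exact ⟨⟨z, mem_padicComplexInt_iff.2 hz⟩, residue_eq_residue_iff.2 h, rfl⟩

theorem canonicalBall_residue (ξ : 𝓞_ℂ_[p]) :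
    canonicalBall (IsLocalRing.residue _ ξ : OnePoint (ResidueField p)) =
      openDisc (ξ : ℂ_[p]) 1 := by
  ext x
  induction x using OnePoint.rec with
  | infty =>
    refine iff_of_false ?_ infty_notMem_openDisc
    rintro ⟨w, -, hw⟩
    exact OnePoint.coe_ne_infty _ hw
  | coe z => rw [coe_mem_canonicalBall_residue_iff, coe_mem_openDisc_iff]

theorem canonicalBall_infty :
    canonicalBall (OnePoint.infty : OnePoint (ResidueField p)) = (closedDisc 0 1)ᶜ := rfl

theorem exists_mem_canonicalBall (x : PLine p) : ∃ ζ, x ∈ canonicalBall ζ := by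
  induction x using OnePoint.rec with
  | infty => exact ⟨OnePoint.infty, infty_notMem_closedDisc⟩
  | coe z =>
    by_cases hz : ‖z‖ ≤ 1
    · refine ⟨(IsLocalRing.residue _ ⟨z, mem_padicComplexInt_iff.2 hz⟩ : ResidueField p), ?_⟩
      rw [coe_mem_canonicalBall_residue_iff]
      simp
    · refine ⟨OnePoint.infty, ?_⟩
      rw [canonicalBall_infty, Set.mem_compl_iff, coe_mem_closedDisc_iff, sub_zero]
      exact hz

theorem eq_of_mem_canonicalBall {x : PLine p} {ζ ζ' : OnePoint (ResidueField p)}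
    (h : x ∈ canonicalBall ζ) (h' : x ∈ canonicalBall ζ') : ζ = ζ' := by
  have key : ∀ (ξ : 𝓞_ℂ_[p]), x ∈ openDisc (ξ : ℂ_[p]) 1 → x ∉ (closedDisc 0 1)ᶜ := by
    rintro ξ ⟨z, hz, rfl⟩ hx
    refine hx (coe_mem_closedDisc_iff.2 ?_)
    have h1 := norm_sub_le_max' (ξ : ℂ_[p]) z 0
    rw [zero_sub, norm_neg] at h1
    exact h1.trans (max_le (le_of_lt hz) (mem_padicComplexInt_iff.1 ξ.2))
  cases ζ with
  | infty =>
    cases ζ' with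
    | infty => rfl
    | coe ζ' =>
      obtain ⟨ξ', rfl⟩ := IsLocalRing.residue_surjective ζ'
      rw [canonicalBall_residue] at h'
      exact absurd h (key ξ' h')
  | coe ζ =>
    obtain ⟨ξ, rfl⟩ := IsLocalRing.residue_surjective ζ
    cases ζ' with
    | infty =>
      rw [canonicalBall_residue] at h
      exact absurd h' (key ξ h)
    | coe ζ' =>
      obtain ⟨ξ', rfl⟩ := IsLocalRing.residue_surjective ζ'
      rw [canonicalBall_residue] at h h'
      obtain ⟨z, hz, rfl⟩ := h
      have h1 : ‖z - ξ'‖ < 1 := coe_mem_openDisc_iff.1 h'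
      have h2 : ‖z - ξ‖ < 1 := hz
      congr 1
      rw [residue_eq_residue_iff]
      have h3 := norm_sub_le_max' z (ξ : ℂ_[p]) ξ'
      rw [norm_sub_rev _ z, norm_sub_rev _ z] at h3
      exact h3.trans_lt (max_lt h2 h1)

theorem canonicalBall_nonempty (ζ : OnePoint (ResidueField p)) : (canonicalBall ζ).Nonempty := by
  cases ζ with
  | infty => exact ⟨OnePoint.infty, infty_notMem_closedDisc⟩
  | coe ζ =>
    obtain ⟨ξ, rfl⟩ := IsLocalRing.residue_surjective ζ
    exact ⟨((ξ : ℂ_[p]) : PLine p), by rw [coe_mem_canonicalBall_residue_iff]; simp⟩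

/-! ### Action of automorphisms on the canonical partition -/

/-- The condition that `[x, y]` and `[x', y']` are in the same ball of the canonical partition. -/
def SameBall (x y x' y' : ℂ_[p]) : Prop :=
  ‖x * y' - x' * y‖ < max ‖x‖ ‖y‖ * max ‖x'‖ ‖y'‖

/-- The larger coordinate decides the ball: ∞ if |y'| < |x'|, and the residue class of x'/y'
otherwise. `SameBall` is stated through the sup norm and the determinant, so it is invariant under
linear maps that preserve both. -/
theorem exists_sameBall_iff {x' y' : ℂ_[p]} (h : x' ≠ 0 ∨ y' ≠ 0) :
    ∃ ζ, ∀ x y : ℂ_[p], (x ≠ 0 ∨ y ≠ 0) →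
      (homPoint x y ∈ canonicalBall ζ ↔ SameBall x y x' y') := by
  unfold SameBall
  rcases lt_or_ge ‖y'‖ ‖x'‖ with hlt | hle
  · refine ⟨OnePoint.infty, fun x y hxy => ?_⟩
    have hx' : 0 < ‖x'‖ := (norm_nonneg _).trans_lt hlt
    have hH : 0 < max ‖x‖ ‖y‖ := by
      rcases hxy with h | h
      · exact lt_max_of_lt_left (norm_pos_iff.2 h)
      · exact lt_max_of_lt_right (norm_pos_iff.2 h)
    rw [canonicalBall_infty, max_eq_left hlt.le]
    have h1 : ‖x * y' - x' * y‖ < max ‖x‖ ‖y‖ * ‖x'‖ ↔ ‖x' * y‖ < max ‖x‖ ‖y‖ * ‖x'‖ := by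
      have hxy' : ‖x * y'‖ < max ‖x‖ ‖y‖ * ‖x'‖ := by
        rw [norm_mul]
        calc _ ≤ max ‖x‖ ‖y‖ * ‖y'‖ := by gcongr; exact le_max_left _ _
          _ < _ := by gcongr
      constructor
      · intro h2
        have := norm_sub_le_max' (x * y') (x' * y) 0
        rw [sub_zero, zero_sub, norm_neg, norm_sub_rev] at this
        exact this.trans_lt (max_lt h2 hxy')
      · intro h2
        have := norm_sub_le_max' 0 (x * y') (x' * y)
        rw [sub_zero, sub_zero] at this
        exact this.trans_lt (max_lt hxy' h2)
    rw [h1, norm_mul, mul_comm, mul_lt_mul_iff_left₀ hx']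
    by_cases hy : y = 0
    · subst hy
      rw [homPoint_zero, norm_zero]
      rw [norm_zero] at hH
      exact iff_of_true infty_notMem_closedDisc hH
    · have hy0 := norm_pos_iff.2 hy
      rw [homPoint, if_neg hy, Set.mem_compl_iff, coe_mem_closedDisc_iff, sub_zero, norm_div,
        div_le_one hy0, not_le, lt_max_iff, or_iff_left (lt_irrefl _)]
  · have hy' : y' ≠ 0 := by
      rcases h with h | h
      · exact norm_pos_iff.1 ((norm_pos_iff.2 h).trans_le hle)
      · exact h
    have hy0' := norm_pos_iff.2 hy'
    have hξ : ‖x' / y'‖ ≤ 1 := by rwa [norm_div, div_le_one hy0']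
    refine ⟨(IsLocalRing.residue _ ⟨x' / y', mem_padicComplexInt_iff.2 hξ⟩ : ResidueField p),
      fun x y hxy => ?_⟩
    rw [max_eq_right hle]
    have h1 : x * y' - x' * y = (x - x' / y' * y) * y' := by field_simp
    rw [h1, norm_mul, mul_lt_mul_iff_left₀ hy0']
    have h2 : ‖x' / y' * y‖ ≤ ‖y‖ := by
      rw [norm_mul]
      exact mul_le_of_le_one_left (norm_nonneg _) hξ
    have h3 : ‖x - x' / y' * y‖ < max ‖x‖ ‖y‖ ↔ ‖x - x' / y' * y‖ < ‖y‖ := by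
      refine ⟨fun h => ?_, fun h => lt_max_of_lt_right h⟩
      rcases lt_or_ge ‖y‖ ‖x‖ with hlt | hge
      · rw [max_eq_left hlt.le, norm_sub_eq_left (h2.trans_lt hlt)] at h
        exact absurd h (lt_irrefl _)
      · rwa [max_eq_right hge] at h
    rw [h3]
    by_cases hy : y = 0
    · subst hy
      rw [homPoint_zero, norm_zero]
      refine iff_of_false ?_ (not_lt.2 (norm_nonneg _))
      rw [canonicalBall_residue]
      exact infty_notMem_openDisc
    · have hy0 := norm_pos_iff.2 hy
      have h4 : x - x' / y' * y = (x / y - x' / y') * y := by field_simp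
      rw [homPoint, if_neg hy, coe_mem_canonicalBall_residue_iff, h4, norm_mul,
        mul_lt_iff_lt_one_left hy0]

theorem mem_canonicalBall_iff_sameBall {x' y' : ℂ_[p]} (h : x' ≠ 0 ∨ y' ≠ 0)
    {ζ : OnePoint (ResidueField p)} (hζ : homPoint x' y' ∈ canonicalBall ζ) {x y : ℂ_[p]}
    (hxy : x ≠ 0 ∨ y ≠ 0) : homPoint x y ∈ canonicalBall ζ ↔ SameBall x y x' y' := by
  obtain ⟨ζ', h'⟩ := exists_sameBall_iff h
  have h1 : homPoint x' y' ∈ canonicalBall ζ' := by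
    rw [h' x' y' h, SameBall, sub_self, norm_zero]
    have : 0 < max ‖x'‖ ‖y'‖ := h.elim (fun h => lt_max_of_lt_left (norm_pos_iff.2 h))
      fun h => lt_max_of_lt_right (norm_pos_iff.2 h)
    positivity
  rw [eq_of_mem_canonicalBall hζ h1]
  exact h' x y hxy

theorem smul_homPoint [DecidableEq ℂ_[p]] (φ : GL (Fin 2) ℂ_[p]) {x y : ℂ_[p]}
    (h : x ≠ 0 ∨ y ≠ 0) :
    φ • homPoint x y = homPoint (φ 0 0 * x + φ 0 1 * y) (φ 1 0 * x + φ 1 1 * y) := by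
  by_cases hy : y = 0
  · subst hy
    have hx : x ≠ 0 := by simpa using h
    rw [homPoint_zero, OnePoint.smul_infty_eq_ite, mul_zero, mul_zero, add_zero, add_zero,
      mul_comm, mul_comm _ x, homPoint_mul_mul hx]
    unfold homPoint
    split_ifs <;> rfl
  · rw [← homPoint_mul_mul (inv_ne_zero hy) x y, inv_mul_cancel₀ hy, homPoint_one,
      OnePoint.smul_some_eq_ite, ← homPoint_mul_mul (inv_ne_zero hy) (_ + _)]
    have e1 : ∀ a b : ℂ_[p], y⁻¹ * (a * x + b * y) = a * (y⁻¹ * x) + b := fun a b => by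
      field_simp
    rw [e1, e1]
    unfold homPoint
    split_ifs <;> rfl

/-- A linear map which preserves the canonical norm permutes the canonical balls. -/
theorem exists_canonicalBall_image_eq {f g : ℂ_[p] → ℂ_[p] → ℂ_[p]}
    {f' g' : ℂ_[p] → ℂ_[p] → ℂ_[p]}
    (hnorm : ∀ x y, max ‖f x y‖ ‖g x y‖ = max ‖x‖ ‖y‖)
    (hdet : ∀ x y x' y', ‖f x y * g x' y' - f x' y' * g x y‖ = ‖x * y' - x' * y‖)
    (hinv : ∀ x y, f (f' x y) (g' x y) = x ∧ g (f' x y) (g' x y) = y)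
    (ζ : OnePoint (ResidueField p)) : ∃ ζ' : OnePoint (ResidueField p),
      {z | ∃ x y, (x ≠ 0 ∨ y ≠ 0) ∧ homPoint x y ∈ canonicalBall ζ ∧ homPoint (f x y) (g x y) = z} =
        canonicalBall ζ' := by
  have hne : ∀ {x y : ℂ_[p]}, (x ≠ 0 ∨ y ≠ 0) ↔ 0 < max ‖x‖ ‖y‖ := by
    intro x y
    rw [lt_max_iff, norm_pos_iff, norm_pos_iff]
  have hfg : ∀ {x y : ℂ_[p]}, (f x y ≠ 0 ∨ g x y ≠ 0) ↔ (x ≠ 0 ∨ y ≠ 0) := by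
    intro x y
    rw [hne, hnorm, ← hne]
  have hsame : ∀ x y x' y', SameBall (f x y) (g x y) (f x' y') (g x' y') ↔ SameBall x y x' y' := by
    intro x y x' y'
    rw [SameBall, hnorm, hnorm, hdet, SameBall]
  obtain ⟨z₀, hz₀⟩ := canonicalBall_nonempty ζ
  obtain ⟨x₀, y₀, h₀, rfl⟩ := exists_homPoint_eq z₀
  obtain ⟨ζ', hζ'⟩ := exists_mem_canonicalBall (homPoint (f x₀ y₀) (g x₀ y₀))
  refine ⟨ζ', ?_⟩
  ext z
  constructor
  · rintro ⟨x, y, hxy, h1, rfl⟩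
    rw [mem_canonicalBall_iff_sameBall (hfg.2 h₀) hζ' (hfg.2 hxy), hsame]
    exact (mem_canonicalBall_iff_sameBall h₀ hz₀ hxy).1 h1
  · intro h1
    obtain ⟨x, y, hxy, rfl⟩ := exists_homPoint_eq z
    obtain ⟨e1, e2⟩ := hinv x y
    have hxy' : f' x y ≠ 0 ∨ g' x y ≠ 0 := by
      rw [← hfg, e1, e2]
      exact hxy
    refine ⟨f' x y, g' x y, hxy', ?_, by rw [e1, e2]⟩
    rw [mem_canonicalBall_iff_sameBall h₀ hz₀ hxy', ← hsame, e1, e2]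
    exact (mem_canonicalBall_iff_sameBall (hfg.2 h₀) hζ' hxy).1 h1

/-- The coordinates of the balls defined by the closed disc with centre `a` and radius `‖c‖`. -/
def IsGaussChart (a c : ℂ_[p]) (χ : ℂ_[p] → PLine p) : Prop :=
  (∃ ξ : ℂ_[p], ‖ξ‖ ≤ 1 ∧ χ = discChart (a + c * ξ) c) ∨ χ = codiscChart a c

theorem IsGaussChart.isChart {a c : ℂ_[p]} (hc : c ≠ 0) {χ : ℂ_[p] → PLine p}
    (h : IsGaussChart a c χ) : IsChart χ := by
  rcases h with ⟨ξ, -, rfl⟩ | rfl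
  · exact ⟨_, c, hc, Or.inl rfl⟩
  · exact ⟨_, c, hc, Or.inr rfl⟩

theorem exists_isGaussChart_image (a c : ℂ_[p]) (ζ : OnePoint (ResidueField p)) :
    ∃ χ, IsGaussChart a c χ ∧
      {z | ∃ x y, (x ≠ 0 ∨ y ≠ 0) ∧ homPoint x y ∈ canonicalBall ζ ∧
        homPoint (a * y + c * x) y = z} = χ '' {t | ‖t‖ < 1} := by
  cases ζ with
  | infty =>
    refine ⟨codiscChart a c, Or.inr rfl, ?_⟩
    have h0 := codiscChart_image (p := p) 0 1 one_ne_zero one_pos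
    rw [norm_one, div_one] at h0
    ext z
    constructor
    · rintro ⟨x, y, hxy, h1, rfl⟩
      rw [canonicalBall_infty, ← h0] at h1
      obtain ⟨t, ht, h2⟩ := h1
      refine ⟨t, ht, ?_⟩
      rw [codiscChart, zero_mul, zero_add,
        homPoint_eq_homPoint_iff (by simp) hxy, one_mul] at h2
      have hx : x ≠ 0 := by
        rintro rfl
        simp [h2] at hxy
      rw [codiscChart, h2, ← homPoint_mul_mul hx]
      congr 1
      ring
    · rintro ⟨t, ht, rfl⟩
      refine ⟨1, t, by simp, ?_, by rw [codiscChart, mul_one]⟩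
      rw [canonicalBall_infty, ← h0]
      exact ⟨t, ht, by simp [codiscChart]⟩
  | coe ζ =>
    obtain ⟨ξ, rfl⟩ := IsLocalRing.residue_surjective ζ
    refine ⟨discChart (a + c * ξ) c, Or.inl ⟨ξ, mem_padicComplexInt_iff.1 ξ.2, rfl⟩, ?_⟩
    ext z
    constructor
    · rintro ⟨x, y, hxy, h1, rfl⟩
      have hy : y ≠ 0 := by
        rintro rfl
        rw [homPoint_zero, canonicalBall_residue] at h1
        exact infty_notMem_openDisc h1
      rw [homPoint, if_neg hy, coe_mem_canonicalBall_residue_iff] at h1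
      refine ⟨x / y - ξ, h1, ?_⟩
      rw [discChart, ← homPoint_mul_mul hy]
      congr 1
      · field_simp
        ring
      · ring
    · rintro ⟨t, ht, rfl⟩
      refine ⟨ξ + t, 1, by simp, ?_, ?_⟩
      · rw [homPoint_one, coe_mem_canonicalBall_residue_iff, add_sub_cancel_left]
        exact ht
      · rw [discChart]
        congr 1
        ring

/-- The automorphism is a scalar e times the affine map z ↦ a + cz times a norm-preserving map (f,
g). The last factor permutes the canonical balls, so only the affine one moves the partition. -/
theorem exists_isGaussChart_of_eq {α β γ δ a c : ℂ_[p]} {f g f' g' : ℂ_[p] → ℂ_[p] → ℂ_[p]}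
    (hnorm : ∀ x y, max ‖f x y‖ ‖g x y‖ = max ‖x‖ ‖y‖)
    (hdet : ∀ x y x' y', ‖f x y * g x' y' - f x' y' * g x y‖ = ‖x * y' - x' * y‖)
    (hinv : ∀ x y, f (f' x y) (g' x y) = x ∧ g (f' x y) (g' x y) = y)
    {e : ℂ_[p]} (he : e ≠ 0) (h1 : ∀ x y, α * x + β * y = e * (a * g x y + c * f x y))
    (h2 : ∀ x y, γ * x + δ * y = e * g x y) (hc : c ≠ 0) (ζ : OnePoint (ResidueField p)) :
    ∃ χ, IsGaussChart a c χ ∧ {z | ∃ x y, (x ≠ 0 ∨ y ≠ 0) ∧ homPoint x y ∈ canonicalBall ζ ∧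
      homPoint (α * x + β * y) (γ * x + δ * y) = z} = χ '' {t | ‖t‖ < 1} := by
  obtain ⟨ζ', hζ'⟩ := exists_canonicalBall_image_eq hnorm hdet hinv ζ
  obtain ⟨χ, hχ, hχ'⟩ := exists_isGaussChart_image a c ζ'
  refine ⟨χ, hχ, ?_⟩
  rw [← hχ', ← hζ']
  have hfg : ∀ {x y : ℂ_[p]}, (x ≠ 0 ∨ y ≠ 0) → (f x y ≠ 0 ∨ g x y ≠ 0) := by
    intro x y hxy
    rw [← norm_pos_iff, ← norm_pos_iff (a := g x y), ← lt_max_iff, hnorm, lt_max_iff, norm_pos_iff,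
      norm_pos_iff]
    exact hxy
  ext z
  constructor
  · rintro ⟨x, y, hxy, h, rfl⟩
    exact ⟨f x y, g x y, hfg hxy, ⟨x, y, hxy, h, rfl⟩, by rw [h1, h2, homPoint_mul_mul he]⟩
  · rintro ⟨x', y', hxy', ⟨x, y, hxy, h, h3⟩, rfl⟩
    refine ⟨x, y, hxy, h, ?_⟩
    rw [h1, h2, homPoint_mul_mul he]
    rw [homPoint_eq_homPoint_iff (hfg hxy) hxy'] at h3
    have hne : ∀ {x y : ℂ_[p]}, (x ≠ 0 ∨ y ≠ 0) → (a * y + c * x ≠ 0 ∨ y ≠ 0) := by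
      intro x y hxy
      by_cases hy : y = 0
      · left
        simpa [hy, hc] using hxy
      · exact Or.inr hy
    rw [homPoint_eq_homPoint_iff (hne (hfg hxy)) (hne hxy')]
    linear_combination c * h3

theorem max_norm_add_mul {t : ℂ_[p]} (ht : ‖t‖ ≤ 1) (x y : ℂ_[p]) :
    max ‖x‖ ‖t * x + y‖ = max ‖x‖ ‖y‖ := by
  have htx : ‖t * x‖ ≤ ‖x‖ := by
    rw [norm_mul]
    exact mul_le_of_le_one_left (norm_nonneg _) ht
  rcases lt_or_ge ‖x‖ ‖y‖ with h | h
  · rw [add_comm, norm_add_eq_left (htx.trans_lt h)]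
  · rw [max_eq_left h, max_eq_left]
    exact (IsUltrametricDist.norm_add_le_max _ _).trans (max_le htx h)

open Classical in
/-- The image of the canonical partition by an automorphism is the partition defined by a closed
disc. -/
theorem exists_isGaussChart_smul (φ : GL (Fin 2) ℂ_[p]) : ∃ a c : ℂ_[p], c ≠ 0 ∧ ∀ ζ, ∃ χ,
    IsGaussChart a c χ ∧ (fun z : PLine p => φ • z) '' canonicalBall ζ = χ '' {t | ‖t‖ < 1} := by
  have himage : ∀ ζ : OnePoint (ResidueField p), (fun z : PLine p => φ • z) '' canonicalBall ζ =
      {z | ∃ x y, (x ≠ 0 ∨ y ≠ 0) ∧ homPoint x y ∈ canonicalBall ζ ∧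
        homPoint (φ 0 0 * x + φ 0 1 * y) (φ 1 0 * x + φ 1 1 * y) = z} := by
    intro ζ
    ext z
    constructor
    · rintro ⟨w, hw, rfl⟩
      obtain ⟨x, y, hxy, rfl⟩ := exists_homPoint_eq w
      exact ⟨x, y, hxy, hw, (smul_homPoint φ hxy).symm⟩
    · rintro ⟨x, y, hxy, h, rfl⟩
      exact ⟨homPoint x y, h, smul_homPoint φ hxy⟩
  simp only [himage]
  have hdet : φ 0 0 * φ 1 1 - φ 0 1 * φ 1 0 ≠ 0 := by
    rw [← Matrix.det_fin_two]
    exact φ.det_ne_zero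
  generalize φ 0 0 = α at *
  generalize φ 0 1 = β at *
  generalize φ 1 0 = γ at *
  generalize φ 1 1 = δ at *
  -- An Iwasawa decomposition: dividing the bottom row by its larger entry makes it part of a matrix
  -- that preserves the sup norm, and what remains is upper triangular. The second case includes a
  -- swap of coordinates.
  rcases le_or_gt ‖γ‖ ‖δ‖ with hle | hlt
  · have hδ : δ ≠ 0 := by
      rintro rfl
      rw [norm_zero, norm_le_zero_iff] at hle
      simp [hle] at hdet
    have ht : ‖γ / δ‖ ≤ 1 := by
      rw [norm_div]
      exact div_le_one_of_le₀ hle (norm_nonneg _)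
    have hc : (α * δ - β * γ) / δ ^ 2 ≠ 0 := div_ne_zero hdet (pow_ne_zero _ hδ)
    refine ⟨β / δ, (α * δ - β * γ) / δ ^ 2, hc, fun ζ => ?_⟩
    refine exists_isGaussChart_of_eq (f := fun x _ => x) (g := fun x y => γ / δ * x + y)
      (f' := fun x _ => x) (g' := fun x y => y - γ / δ * x) (e := δ)
      (fun x y => max_norm_add_mul ht x y) ?_ ?_ hδ ?_ ?_ hc ζ
    · intro x y x' y'
      congr 1
      ring
    · intro x y
      exact ⟨rfl, by ring⟩
    · intro x y
      field_simp
      ring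
    · intro x y
      field_simp
  · have hγ : γ ≠ 0 := norm_pos_iff.1 ((norm_nonneg _).trans_lt hlt)
    have ht : ‖δ / γ‖ ≤ 1 := by
      rw [norm_div]
      exact div_le_one_of_le₀ hlt.le (norm_nonneg _)
    have hc : (β * γ - α * δ) / γ ^ 2 ≠ 0 := by
      refine div_ne_zero (fun h => hdet ?_) (pow_ne_zero _ hγ)
      linear_combination -h
    refine ⟨α / γ, (β * γ - α * δ) / γ ^ 2, hc, fun ζ => ?_⟩
    refine exists_isGaussChart_of_eq (f := fun _ y => y) (g := fun x y => δ / γ * y + x)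
      (f' := fun x y => y - δ / γ * x) (g' := fun x _ => x) (e := γ) ?_ ?_ ?_ hγ ?_ ?_ hc ζ
    · intro x y
      rw [max_norm_add_mul ht y x, max_comm]
    · intro x y x' y'
      rw [norm_sub_rev]
      congr 1
      ring
    · intro x y
      exact ⟨rfl, by ring⟩
    · intro x y
      field_simp
      ring
    · intro x y
      field_simp
      ring

end Gauss

end

end PadicDynamics

namespace PadicDynamics

noncomputable section

open Polynomial Filter Topology

/-! ### Open affinoids against the partition defined by a closed disc. -/

section Partition

variable {p : ℕ} [Fact p.Prime]

theorem openDisc_eq_of_norm_sub_lt {a b : ℂ_[p]} {r : ℝ} (h : ‖b - a‖ < r) :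
    openDisc b r = openDisc a r := by
  have key : ∀ {a b : ℂ_[p]}, ‖b - a‖ < r → openDisc b r ⊆ openDisc a r := by
    rintro a b h _ ⟨z, hz, rfl⟩
    refine coe_mem_openDisc_iff.2 ((norm_sub_le_max' b z a).trans_lt (max_lt hz ?_))
    rwa [norm_sub_rev]
  exact (key h).antisymm (key (by rwa [norm_sub_rev]))

theorem IsGaussChart.eq_or_eq {a c : ℂ_[p]} {χ : ℂ_[p] → PLine p} (h : IsGaussChart a c χ) :
    (∃ m : ℂ_[p], ‖m - a‖ ≤ ‖c‖ ∧ χ = discChart m c) ∨ χ = codiscChart a c := by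
  refine h.imp_left ?_
  rintro ⟨ξ, hξ, rfl⟩
  refine ⟨_, ?_, rfl⟩
  rw [add_sub_cancel_left, norm_mul]
  exact mul_le_of_le_one_right (norm_nonneg _) hξ

theorem discChart_image_unit (m : ℂ_[p]) {c : ℂ_[p]} (hc : c ≠ 0) :
    discChart m c '' {t | ‖t‖ < 1} = openDisc m ‖c‖ := by
  rw [discChart_image m c hc, mul_one]

theorem codiscChart_image_unit (a : ℂ_[p]) {c : ℂ_[p]} (hc : c ≠ 0) :
    codiscChart a c '' {t | ‖t‖ < 1} = (closedDisc a ‖c‖)ᶜ := by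
  rw [codiscChart_image a c hc one_pos, div_one]

/-- Among two points in distinct balls of the partition, one is finite and lies in the closed disc,
and the other one is not close to it. -/
theorem exists_far_points {a c : ℂ_[p]} (hc : c ≠ 0) {χ₁ χ₂ : ℂ_[p] → PLine p}
    (h₁ : IsGaussChart a c χ₁) (h₂ : IsGaussChart a c χ₂)
    (hne : χ₁ '' {t | ‖t‖ < 1} ≠ χ₂ '' {t | ‖t‖ < 1}) {O : Set (PLine p)}
    (hO₁ : (χ₁ '' {t | ‖t‖ < 1} ∩ O).Nonempty) (hO₂ : (χ₂ '' {t | ‖t‖ < 1} ∩ O).Nonempty) :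
    ∃ v : ℂ_[p], (v : PLine p) ∈ O ∧ ‖v - a‖ ≤ ‖c‖ ∧ ∃ u ∈ O, u ∉ openDisc v ‖c‖ := by
  have key : ∀ m : ℂ_[p], ‖m - a‖ ≤ ‖c‖ → ∀ {χ : ℂ_[p] → PLine p}, IsGaussChart a c χ →
      openDisc m ‖c‖ ≠ χ '' {t | ‖t‖ < 1} → (openDisc m ‖c‖ ∩ O).Nonempty →
      (χ '' {t | ‖t‖ < 1} ∩ O).Nonempty →
      ∃ v : ℂ_[p], (v : PLine p) ∈ O ∧ ‖v - a‖ ≤ ‖c‖ ∧ ∃ u ∈ O, u ∉ openDisc v ‖c‖ := by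
    rintro m hm χ hχ hne ⟨_, ⟨v, hv, rfl⟩, hvO⟩ ⟨u, hu, huO⟩
    have hva : ‖v - a‖ ≤ ‖c‖ := by
      refine (norm_sub_le_max' m v a).trans (max_le (le_of_lt hv) ?_)
      rwa [norm_sub_rev]
    refine ⟨v, hvO, hva, u, huO, fun hu' => ?_⟩
    rcases hχ.eq_or_eq with ⟨m', -, rfl⟩ | rfl
    · rw [discChart_image_unit m' hc] at hu hne
      obtain ⟨z, hz, rfl⟩ := hu
      rw [← openDisc_eq_of_norm_sub_lt hv,
        ← openDisc_eq_of_norm_sub_lt (coe_mem_openDisc_iff.1 hu'),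
        ← openDisc_eq_of_norm_sub_lt (a := m') hz] at hne
      exact hne rfl
    · rw [codiscChart_image_unit a hc] at hu
      obtain ⟨z, hz, rfl⟩ := hu'
      refine hu (coe_mem_closedDisc_iff.2 ((norm_sub_le_max' v z a).trans (max_le (le_of_lt hz) ?_)))
      rwa [norm_sub_rev]
  -- Two distinct balls cannot both be the outer one; the one that is a disc supplies v.
  rcases h₁.eq_or_eq with ⟨m, hm, rfl⟩ | rfl
  · rw [discChart_image_unit m hc] at hO₁ hne
    exact key m hm h₂ hne hO₁ hO₂
  · rcases h₂.eq_or_eq with ⟨m, hm, rfl⟩ | rfl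
    · rw [discChart_image_unit m hc] at hO₂ hne
      exact key m hm h₁ hne.symm hO₂ hO₁
    · exact absurd rfl hne

/-- An open ball which meets two balls of the partition contains all but one of its balls, and an
annulus of the exceptional one. -/
theorem IsOpenBall.exists_forall_isGaussChart {O : Set (PLine p)} (hO : IsOpenBall O) {a c : ℂ_[p]}
    (hc : c ≠ 0) (hpts : ∃ v : ℂ_[p], (v : PLine p) ∈ O ∧ ‖v - a‖ ≤ ‖c‖ ∧
      ∃ u ∈ O, u ∉ openDisc v ‖c‖) :
    ∃ B₀ : Set (PLine p), ∀ χ, IsGaussChart a c χ → ∃ s < 1, ∀ t, ‖t‖ < 1 → χ t ∉ O →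
      χ '' {t | ‖t‖ < 1} = B₀ ∧ ‖t‖ ≤ s := by
  obtain ⟨v, hvO, hva, u, huO, huv⟩ := hpts
  have hc' := norm_pos_iff.2 hc
  have hmul : ∀ t : ℂ_[p], ‖t‖ < 1 → ‖c * t‖ < ‖c‖ := fun t ht => by
    rw [norm_mul]
    exact mul_lt_of_lt_one_right hc' ht
  have hdisc : ∀ m b t : ℂ_[p], ‖m + c * t - b‖ ≤ max ‖c * t‖ ‖m - b‖ := fun m b t => by
    rw [add_comm, add_sub_assoc]
    exact IsUltrametricDist.norm_add_le_max _ _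
  have hdiv : ∀ t : ℂ_[p], t ≠ 0 → ‖t‖ < 1 → ‖c‖ < ‖c / t‖ := fun t h0 ht => by
    rw [norm_div, lt_div_iff₀ (norm_pos_iff.2 h0)]
    exact mul_lt_of_lt_one_right hc' ht
  obtain ⟨b, c', hc'', rfl | rfl⟩ := hO
  -- A disc with points at distance ≥ |c| has radius r > |c|, so it contains the closed disc and
  -- only the outer ball is exceptional. In the coordinate a + c/t, the omitted points have |t| ≤
  -- |c|/r.
  · generalize ‖c'‖ = r at *
    rw [← openDisc_eq_of_norm_sub_lt (coe_mem_openDisc_iff.1 hvO)] at *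
    obtain ⟨u, hu, rfl⟩ := huO
    rw [coe_mem_openDisc_iff, not_lt] at huv
    have hr : ‖c‖ < r := huv.trans_lt hu
    rw [openDisc_eq_of_norm_sub_lt (hva.trans_lt hr)]
    refine ⟨(closedDisc a ‖c‖)ᶜ, fun χ hχ => ?_⟩
    rcases hχ.eq_or_eq with ⟨m, hm, rfl⟩ | rfl
    · refine ⟨0, one_pos, fun t ht h => absurd ?_ h⟩
      rw [discChart, homPoint_one, coe_mem_openDisc_iff]
      exact (hdisc m a t).trans_lt ((max_le (hmul t ht).le hm).trans_lt hr)
    · refine ⟨‖c‖ / r, (div_lt_one (hc'.trans hr)).2 hr,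
        fun t ht h => ⟨codiscChart_image_unit a hc, ?_⟩⟩
      by_cases ht0 : t = 0
      · rw [ht0, norm_zero]
        exact div_nonneg hc'.le (hc'.trans hr).le
      · rw [codiscChart_of_ne_zero a c ht0, coe_mem_openDisc_iff, add_sub_cancel_left, not_lt,
          norm_div, le_div_iff₀ (norm_pos_iff.2 ht0)] at h
        rwa [le_div_iff₀ (hc'.trans hr), mul_comm]
  · have hc''' := norm_pos_iff.2 hc''
    generalize ‖c'‖ = r at *
    rw [Set.mem_compl_iff, coe_mem_closedDisc_iff, not_le] at hvO
    -- The removed disc lies inside one ball of the partition: the residue disc of b if b is in the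
    -- closed disc, and the outer ball otherwise.
    rcases le_or_gt ‖b - a‖ ‖c‖ with hba | hba
    · have hr : r < ‖c‖ := hvO.trans_le ((norm_sub_le_max' a v b).trans (max_le hva hba))
      refine ⟨openDisc b ‖c‖, fun χ hχ => ?_⟩
      rcases hχ.eq_or_eq with ⟨m, hm, rfl⟩ | rfl
      · rcases lt_or_ge ‖m - b‖ ‖c‖ with hmb | hmb
        · refine ⟨max r ‖m - b‖ / ‖c‖, (div_lt_one hc').2 (max_lt hr hmb), fun t ht h => ⟨?_, ?_⟩⟩
          · rw [discChart_image_unit m hc, openDisc_eq_of_norm_sub_lt hmb]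
          · rw [discChart, homPoint_one, Set.notMem_compl_iff, coe_mem_closedDisc_iff] at h
            rw [le_div_iff₀ hc', mul_comm, ← norm_mul]
            have h1 : c * t = (m + c * t - b) - (m - b) := by ring
            rw [h1]
            have h2 := norm_sub_le_max' 0 (m + c * t - b) (m - b)
            rw [sub_zero, sub_zero] at h2
            exact h2.trans (max_le_max_right _ h)
        · refine ⟨0, one_pos, fun t ht h => absurd ?_ h⟩
          rw [discChart, homPoint_one, Set.mem_compl_iff, coe_mem_closedDisc_iff, not_le,
            add_sub_right_comm, norm_add_eq_left ((hmul t ht).trans_le hmb)]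
          exact hr.trans_le hmb
      · refine ⟨0, one_pos, fun t ht h => absurd ?_ h⟩
        by_cases ht0 : t = 0
        · rw [ht0, codiscChart_zero]
          exact infty_notMem_closedDisc
        · have h1 := hdiv t ht0 ht
          have h2 : a + c / t - b = c / t - (b - a) := by ring
          rw [codiscChart_of_ne_zero a c ht0, Set.mem_compl_iff, coe_mem_closedDisc_iff, not_le, h2,
            norm_sub_eq_left (hba.trans_lt h1)]
          exact hr.trans h1
    · have hr : r < ‖b - a‖ := by
        rwa [norm_sub_eq_right' (hva.trans_lt hba)] at hvO
      refine ⟨(closedDisc a ‖c‖)ᶜ, fun χ hχ => ?_⟩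
      rcases hχ.eq_or_eq with ⟨m, hm, rfl⟩ | rfl
      · refine ⟨0, one_pos, fun t ht h => absurd ?_ h⟩
        rw [discChart, homPoint_one, Set.mem_compl_iff, coe_mem_closedDisc_iff, not_le,
          norm_sub_eq_right' (((hdisc m a t).trans (max_le (hmul t ht).le hm)).trans_lt hba)]
        exact hr
      · refine ⟨‖c‖ / ‖b - a‖, (div_lt_one (hc'.trans hba)).2 hba,
          fun t ht h => ⟨codiscChart_image_unit a hc, ?_⟩⟩
        by_cases ht0 : t = 0
        · rw [ht0, norm_zero]
          positivity
        · rw [codiscChart_of_ne_zero a c ht0, Set.notMem_compl_iff, coe_mem_closedDisc_iff] at h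
          rw [le_div_iff₀ (hc'.trans hba), ← le_div_iff₀' (norm_pos_iff.2 ht0), ← norm_div]
          by_contra! h1
          rw [norm_sub_eq_right' (by rwa [add_sub_cancel_left])] at h
          exact absurd hr (not_lt.2 h)

/-- Each of the finitely many open balls spoils at most one ball of the partition; the largest of
their bounds s is still below 1. -/
theorem IsOpenAffinoid.exists_forall_isGaussChart {Z : Set (PLine p)} (hZ : IsOpenAffinoid Z)
    {a c : ℂ_[p]} (hc : c ≠ 0) {χ₁ χ₂ : ℂ_[p] → PLine p}
    (h₁ : IsGaussChart a c χ₁) (h₂ : IsGaussChart a c χ₂)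
    (hne : χ₁ '' {t | ‖t‖ < 1} ≠ χ₂ '' {t | ‖t‖ < 1})
    (hZ₁ : (χ₁ '' {t | ‖t‖ < 1} ∩ Z).Nonempty) (hZ₂ : (χ₂ '' {t | ‖t‖ < 1} ∩ Z).Nonempty) :
    ∃ 𝓑 : Set (Set (PLine p)), 𝓑.Finite ∧ ∀ χ, IsGaussChart a c χ → ∃ s < 1, ∀ t, ‖t‖ < 1 →
      χ t ∉ Z → χ '' {t | ‖t‖ < 1} ∈ 𝓑 ∧ ‖t‖ ≤ s := by
  obtain ⟨-, F, hF, hFO, rfl⟩ := hZ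
  have key : ∀ O ∈ F, ∃ B₀ : Set (PLine p), ∀ χ, IsGaussChart a c χ → ∃ s < 1, ∀ t, ‖t‖ < 1 →
      χ t ∉ O → χ '' {t | ‖t‖ < 1} = B₀ ∧ ‖t‖ ≤ s := fun O hO => by
    have hsub := Set.sInter_subset_of_mem hO
    exact (hFO O hO).exists_forall_isGaussChart hc (exists_far_points hc h₁ h₂ hne
      (hZ₁.mono (Set.inter_subset_inter_right _ hsub))
      (hZ₂.mono (Set.inter_subset_inter_right _ hsub)))
  choose! B hB using key
  refine ⟨B '' F, hF.image _, fun χ hχ => ?_⟩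
  choose! s hs1 hs using fun O hO => hB O hO χ hχ
  rcases F.eq_empty_or_nonempty with rfl | hFne
  · exact ⟨0, one_pos, fun t _ h => absurd (by simp) h⟩
  obtain ⟨O', hO', hmax⟩ := Set.exists_max_image F s hF hFne
  refine ⟨s O', hs1 O' hO', fun t ht h => ?_⟩
  obtain ⟨O, hO, htO⟩ : ∃ O ∈ F, χ t ∉ O := by simpa using h
  obtain ⟨h3, h4⟩ := hs O hO t ht htO
  exact ⟨⟨O, hO, h3.symm⟩, h4.trans (hmax O hO)⟩

end Partition

end

end PadicDynamics

namespace PadicDynamics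

noncomputable section

open Polynomial Filter Topology

/-! ### Rational repelling points and the conclusion. -/

section Rational

variable {p : ℕ} [Fact p.Prime]

/-- A backward invariant set which meets only finitely many balls of an invariant partition is
finite, if it does not come near the boundary of any ball and the map is ramified on the balls which
are totally invariant. -/
theorem finite_of_preimage_subset {ι : Type*} {χ : ι → ℂ_[p] → PLine p}
    (hcover : ∀ x, ∃ ζ t, ‖t‖ < 1 ∧ χ ζ t = x) {f : PLine p → PLine p} {M : Set (PLine p)}
    (hM : f ⁻¹' M ⊆ M) {σ : ι → ι} (hσ : Function.Surjective σ)
    (hmap : ∀ ζ, ∃ (N D : ℂ_[p][X]) (k : ℕ), (∀ t s, f (χ ζ t) = χ (σ ζ) s ↔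
      N.eval t = s * D.eval t) ∧ D ≠ 0 ∧ EdgeMap N D 1 1 k ∧
      ((∀ ζ', σ ζ' = σ ζ → ζ' = ζ) → 2 ≤ k))
    (hfin : {ζ | ∃ t, ‖t‖ < 1 ∧ χ ζ t ∈ M}.Finite)
    (hs : ∀ ζ, ∃ s < 1, ∀ t, ‖t‖ < 1 → χ ζ t ∈ M → ‖t‖ ≤ s) : M.Finite := by
  choose N D k hND hD hk hk2 using hmap
  choose s hs1 hs using hs
  set T := {ζ | ∃ t, ‖t‖ < 1 ∧ χ ζ t ∈ M} with hTdef
  have hback : ∀ ζ b t, χ (σ ζ) b ∈ M → (N ζ).eval t = b * (D ζ).eval t → χ ζ t ∈ M :=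
    fun ζ b t hb ht => hM (by rwa [Set.mem_preimage, (hND ζ t b).2 ht])
  -- Every point of the ball σ ζ has a preimage in the ball ζ, and backward invariance puts that
  -- preimage in M.
  have hσT : σ ⁻¹' T ⊆ T := by
    rintro ζ ⟨b, hb, hbM⟩
    obtain ⟨t, ht, ht'⟩ := (hk ζ).exists_root hb
    exact ⟨t, ht, hback ζ b t hbM ht'⟩
  obtain ⟨hTeq, hinj⟩ := preimage_eq_and_injOn_of_preimage_subset hσ hfin hσT
  set A : ι → Set ℂ_[p] := fun ζ => {t | ‖t‖ < 1 ∧ χ ζ t ∈ M} with hA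
  have hdist : ∀ ζ, ∀ t ∈ A ζ, ∀ t' ∈ A ζ, dist t t' ≤ max 0 (s ζ) := by
    rintro ζ t ⟨ht, htM⟩ t' ⟨ht', htM'⟩
    have h := norm_sub_le_max' 0 t t'
    rw [sub_zero, sub_zero] at h
    rw [dist_eq_norm]
    exact h.trans ((max_le (hs ζ t ht htM) (hs ζ t' ht' htM')).trans (le_max_right _ _))
  have hbdd : ∀ ζ, Bornology.IsBounded (A ζ) := fun ζ =>
    Metric.isBounded_iff.2 ⟨_, fun _ ht _ ht' => hdist ζ _ ht _ ht'⟩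
  have hdiam : ∀ ζ, Metric.diam (A ζ) < 1 := fun ζ =>
    (Metric.diam_le_of_forall_dist_le (le_max_left _ _) (hdist ζ)).trans_lt
      (max_lt one_pos (hs1 ζ))
  -- σ is injective on T and σ⁻¹(T) = T, so ζ is alone in its σ-fibre and k ≥ 2. The preimages of M
  -- in the ball lie within diam(A ζ) of any point of A ζ, which is the δ of the contraction.
  have hle : ∀ ζ ∈ T, Metric.diam (A (σ ζ)) ≤ Metric.diam (A ζ) ^ 2 := by
    rintro ζ hζ
    have hunique : ∀ ζ', σ ζ' = σ ζ → ζ' = ζ := fun ζ' h => by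
      have hζ'' : ζ ∈ σ ⁻¹' T := hTeq.symm ▸ hζ
      have hζ' : σ ζ' ∈ T := by
        rw [h]
        exact hζ''
      exact hinj (hσT hζ') hζ h
    have h2 := hk2 ζ hunique
    obtain ⟨a, ha, haM⟩ := hζ
    have hroot : ∀ b, χ (σ ζ) b ∈ M → ∀ t, ‖t‖ < 1 → (N ζ).eval t = b * (D ζ).eval t →
        ‖t - a‖ ≤ Metric.diam (A ζ) := fun b hb t ht h => by
      rw [← dist_eq_norm]
      exact Metric.dist_le_diam_of_mem (hbdd ζ) ⟨ht, hback ζ b t hb h⟩ ⟨ha, haM⟩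
    refine Metric.diam_le_of_forall_dist_le (by positivity) ?_
    rintro b ⟨hb, hbM⟩ b' ⟨hb', hbM'⟩
    rw [dist_eq_norm]
    exact ((hk ζ).norm_sub_le (hD ζ) ha Metric.diam_nonneg (hdiam ζ) hb hb' (hroot b hbM)
      (hroot b' hbM')).trans (pow_le_pow_of_le_one Metric.diam_nonneg (hdiam ζ).le h2)
  -- The largest diameter is attained at some σ ζ₁ with ζ₁ in T. So x = diam(A ζ₁) satisfies x ≤ x²
  -- and x < 1, whence x = 0.
  have hzero : ∀ ζ ∈ T, Metric.diam (A ζ) = 0 := by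
    intro ζ hζ
    obtain ⟨ζ₀, hζ₀, hmax⟩ := Set.exists_max_image T (fun ζ => Metric.diam (A ζ)) hfin ⟨ζ, hζ⟩
    obtain ⟨ζ₁, rfl⟩ := hσ ζ₀
    have h1 := hle ζ₁ (hσT hζ₀)
    have h2 := hmax ζ₁ (hσT hζ₀)
    have h3 := hdiam ζ₁
    have h4 : 0 ≤ Metric.diam (A ζ₁) := Metric.diam_nonneg
    have h5 := hmax ζ hζ
    have h6 : 0 ≤ Metric.diam (A ζ) := Metric.diam_nonneg
    have h7 : Metric.diam (A ζ₁) = 0 := by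
      nlinarith
    rw [h7] at h1
    linarith
  refine (hfin.biUnion (t := fun ζ => χ ζ '' A ζ) fun ζ hζ => Set.Finite.image _ ?_).subset ?_
  · refine Set.Subsingleton.finite fun t ht t' ht' => dist_le_zero.1 ?_
    rw [← hzero ζ hζ]
    exact Metric.dist_le_diam_of_mem (hbdd ζ) ht ht'
  · intro x hx
    obtain ⟨ζ, t, ht, rfl⟩ := hcover x
    exact Set.mem_biUnion (show ζ ∈ T from ⟨t, ht, hx⟩) ⟨t, ⟨ht, hx⟩, rfl⟩

open Classical in
/-- The balls of a rational point, with coordinates. -/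
theorem IsParametrization.exists_chart {S : Set (End p)} {e : OnePoint (ResidueField p) → End p}
    (h : IsParametrization S e) : ∃ (a c : ℂ_[p]) (χ : OnePoint (ResidueField p) → ℂ_[p] → PLine p),
      c ≠ 0 ∧ (∀ ζ, IsGaussChart a c (χ ζ)) ∧ (∀ ζ, (e ζ).ball = χ ζ '' {t | ‖t‖ < 1}) ∧
      (∀ x, ∃ ζ, x ∈ χ ζ '' {t | ‖t‖ < 1}) ∧
      ∀ ζ ζ' x, x ∈ χ ζ '' {t | ‖t‖ < 1} → x ∈ χ ζ' '' {t | ‖t‖ < 1} → ζ = ζ' := by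
  obtain ⟨-, φ, hφ⟩ := h
  obtain ⟨a, c, hc, hχ⟩ := exists_isGaussChart_smul φ
  choose χ hχ hball using hχ
  refine ⟨a, c, χ, hc, hχ, fun ζ => (hφ ζ).trans (hball ζ), fun x => ?_, fun ζ ζ' x h h' => ?_⟩
  · obtain ⟨ζ, hζ⟩ := exists_mem_canonicalBall (φ⁻¹ • x)
    refine ⟨ζ, ?_⟩
    rw [← hball]
    exact ⟨_, hζ, smul_inv_smul φ x⟩
  · rw [← hball] at h h'
    obtain ⟨y, hy, rfl⟩ := h
    obtain ⟨y', hy', h⟩ := h'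
    rw [(MulAction.injective φ h : y' = y)] at hy'
    exact eq_of_mem_canonicalBall hy hy'

/-- The target S' of r is not assumed to be S. Its balls are identified with those of S through the
filters of their chains, which turns r into a self-map σ of the index set of S. -/
theorem finite_of_rational {S S' : Set (End p)} {e e' : OnePoint (ResidueField p) → End p}
    (hS : IsParametrization S e) (hS' : IsParametrization S' e') {Q : RatFunc ℂ_[p]}
    (hQ : Function.Surjective (ratMap Q)) {r : RatFunc (ResidueField p)}
    (hr : 2 ≤ ratDegree r) (he : ∀ ζ, EndMapsTo Q (e ζ) (e' (ratMap r ζ)) (localDegree r ζ))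
    (hmaps : ∀ C : VanishingChain p, C.toEnd ∈ S → ∃ C' : VanishingChain p, C'.toEnd ∈ S ∧
      C'.filter = map (ratMap Q) C.filter)
    {Z : Set (PLine p)} (hZ : IsOpenAffinoid Z) {ζ₁ ζ₂ : OnePoint (ResidueField p)}
    (hne : ζ₁ ≠ ζ₂) (h₁ : ((e ζ₁).ball ∩ Z).Nonempty) (h₂ : ((e ζ₂).ball ∩ Z).Nonempty)
    {M : Set (PLine p)} (hM : ratMap Q ⁻¹' M ⊆ M) (hMZ : Disjoint M Z) : M.Finite := by
  obtain ⟨a, c, χ, hc, hχ, hball, hcover, hdisj⟩ := hS.exists_chart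
  obtain ⟨a', c', χ', hc', hχ', hball', hcover', hdisj'⟩ := hS'.exists_chart
  have hchart := fun ζ => (hχ ζ).isChart hc
  have hchart' := fun ζ => (hχ' ζ).isChart hc'
  have hmem : ∀ ζ, χ ζ 0 ∈ χ ζ '' {t | ‖t‖ < 1} := fun ζ => ⟨0, by simp, rfl⟩
  have hinj : ∀ ζ ζ', χ ζ '' {t | ‖t‖ < 1} = χ ζ' '' {t | ‖t‖ < 1} → ζ = ζ' := fun ζ ζ' h =>
    hdisj ζ ζ' _ (hmem ζ) (h ▸ hmem ζ)
  have hmap : ∀ ζ, ∃ ζ', χ' (ratMap r ζ) '' {t | ‖t‖ < 1} = χ ζ' '' {t | ‖t‖ < 1} ∧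
      ∃ (N D : ℂ_[p][X]) (k : ℕ), (∀ t s, ratMap Q (χ ζ t) = χ ζ' s ↔
        N.eval t = s * D.eval t) ∧ D ≠ 0 ∧ EdgeMap N D 1 1 k ∧ localDegree r ζ ≤ k := by
    intro ζ
    obtain ⟨C, hC⟩ := (e ζ).exists_chain
    have hCf : C.filter = map (χ ζ) (edge 0 1) :=
      C.filter_eq_map_edge (hchart ζ) one_pos (by rw [← C.ball_toEnd, hC, hball])
    obtain ⟨C', hC'S, hC'⟩ := hmaps C (by rw [hC, hS.1]; exact Set.mem_range_self ζ)
    rw [hS.1] at hC'S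
    obtain ⟨ζ', hζ'⟩ := hC'S
    have hCf' : C'.filter = map (χ ζ') (edge 0 1) :=
      C'.filter_eq_map_edge (hchart ζ') one_pos (by rw [← C'.ball_toEnd, ← hζ', hball])
    obtain ⟨-, hE⟩ := he ζ
    obtain ⟨i₀, ⟨C'', hC'', hterm⟩, hdeg⟩ := hE C hC
    have hCf'' : C''.filter = map (χ' (ratMap r ζ)) (edge 0 1) :=
      C''.filter_eq_map_edge (hchart' _) one_pos (by rw [← C''.ball_toEnd, hC'', hball'])
    refine ⟨ζ', image_subset_of_map_edge_eq (hchart' _) (hchart ζ') ?_, ?_⟩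
    · rw [← hCf', ← hCf'', hC', VanishingChain.filter_eq_map_of_term_eq hterm]
    · obtain ⟨N, D, k, hND, hD, hT, hk⟩ := exists_edgeMap_of_tendsto (hchart ζ) (hchart ζ') one_pos
        one_pos Q (by
          rw [← hCf', hC', hCf, Filter.map_map]
          exact tendsto_map)
      exact ⟨N, D, k, hND, hD, hk, hk.degree_le (hchart ζ) one_pos hQ hND hD hT hCf hdeg⟩
  choose σ hσ N D k hND hD hk hdeg using hmap
  have hfib : ∀ ζ ζ', ratMap r ζ' = ratMap r ζ → σ ζ' = σ ζ := fun ζ ζ' h =>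
    hinj _ _ (by rw [← hσ, ← hσ, h])
  have hrsurj := ratMap_surjective r (one_le_two.trans hr)
  -- r is surjective and the balls of S' cover the line, so the centre of any ball of S lies in some
  -- ball of S' that coincides with a ball indexed by σ.
  have hσsurj : Function.Surjective σ := by
    intro ζ
    obtain ⟨ξ', hξ'⟩ := hcover' (χ ζ 0)
    obtain ⟨ξ, rfl⟩ := hrsurj ξ'
    rw [hσ] at hξ'
    exact ⟨ξ, hdisj _ _ _ hξ' (hmem ζ)⟩
  rw [hball] at h₁ h₂
  obtain ⟨𝓑, h𝓑, hs⟩ := hZ.exists_forall_isGaussChart hc (hχ ζ₁) (hχ ζ₂)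
    (fun h => hne (hinj _ _ h)) h₁ h₂
  have hMZ' : ∀ x ∈ M, x ∉ Z := fun x hx hx' => Set.disjoint_left.1 hMZ hx hx'
  refine finite_of_preimage_subset (χ := χ) (fun x => ?_) hM hσsurj
    (fun ζ => ⟨N ζ, D ζ, k ζ, hND ζ, hD ζ, hk ζ, fun h => ?_⟩) ?_ fun ζ => ?_
  · obtain ⟨ζ, t, ht, rfl⟩ := hcover x
    exact ⟨ζ, t, ht, rfl⟩
  -- A one-point σ-fibre contains the r-fibre, so r is totally ramified at ζ and deg r ≤ k.
  · refine hr.trans (le_trans (le_of_eq ?_) (hdeg ζ))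
    exact (localDegree_eq_ratDegree_of_unique r (one_le_two.trans hr)
      fun ζ' h' => h ζ' (hfib ζ ζ' h')).symm
  · refine Set.Finite.of_finite_image (f := fun ζ => χ ζ '' {t | ‖t‖ < 1}) (h𝓑.subset ?_)
      fun ζ _ ζ' _ h => hinj ζ ζ' h
    rintro _ ⟨ζ, ⟨t, ht, htM⟩, rfl⟩
    obtain ⟨s, -, hs⟩ := hs _ (hχ ζ)
    exact (hs t ht (hMZ' _ htM)).1
  · obtain ⟨s, hs1, hs⟩ := hs _ (hχ ζ)
    exact ⟨s, hs1, fun t ht htM => (hs t ht (hMZ' _ htM)).2⟩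

/-- If an open analytic space meets two members of a covering, then it contains an open affinoid
which meets two members of the covering. -/
theorem IsOpenAnalyticSpace.exists_affinoid {X : Set (PLine p)} (hX : IsOpenAnalyticSpace X)
    {ι : Type*} {β : ι → Set (PLine p)} (hβ : ∀ x, ∃ ζ, x ∈ β ζ) {ζ₁ ζ₂ : ι} (hne : ζ₁ ≠ ζ₂)
    (h₁ : (β ζ₁ ∩ X).Nonempty) (h₂ : (β ζ₂ ∩ X).Nonempty) :
    ∃ Z ⊆ X, IsOpenAffinoid Z ∧ ∃ ζ ζ', ζ ≠ ζ' ∧ (β ζ ∩ Z).Nonempty ∧ (β ζ' ∩ Z).Nonempty := by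
  obtain ⟨x, F, -, hF, rfl⟩ := hX
  obtain ⟨ζ, hζ⟩ := hβ x
  have key : ∀ ζ', ζ ≠ ζ' → (β ζ' ∩ ⋃₀ F).Nonempty →
      ∃ Z ⊆ ⋃₀ F, IsOpenAffinoid Z ∧ ∃ ζ ζ', ζ ≠ ζ' ∧ (β ζ ∩ Z).Nonempty ∧
        (β ζ' ∩ Z).Nonempty := by
    rintro ζ' hne ⟨y, hy, Z, hZ, hyZ⟩
    exact ⟨Z, Set.subset_sUnion_of_mem hZ, (hF Z hZ).1, ζ, ζ', hne, ⟨x, hζ, (hF Z hZ).2⟩,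
      ⟨y, hy, hyZ⟩⟩
  -- The common point x lies in a ball that differs from at least one of the two given ones. An
  -- affinoid through a point of that other ball also contains x.
  by_cases h : ζ = ζ₁
  · exact key ζ₂ (h ▸ hne) h₂
  · exact key ζ₁ h h₁

theorem IsRepellingPeriodic.finite_compl {R : RatFunc ℂ_[p]} (hR : 2 ≤ ratDegree R)
    {X : Set (PLine p)} (hX : IsOpenAnalyticSpace X) {S : HypSpace p}
    (hS : IsRepellingPeriodic R S) (hSX : S.Separates X) :
    (⋃ n : ℕ, (ratMap R)^[n] '' X)ᶜ.Finite := by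
  obtain ⟨n, -, hiter, d, hd, hdeg⟩ := hS
  have hRsurj := ratMap_surjective R (one_le_two.trans hR)
  have hQeq := ratMap_ratIter R hRsurj n
  have hQ : Function.Surjective (ratMap (ratIter R n)) := by
    rw [hQeq]
    exact hRsurj.iterate n
  have hmaps : ∀ C : VanishingChain p, C.toEnd ∈ S.1 → ∃ (C' : VanishingChain p) (M : ℕ),
      C'.toEnd ∈ S.1 ∧ ∀ i, C'.term i = ratMap (ratIter R n) '' C.term (M + i) := fun C hC => by
    rw [hQeq]
    exact hiter.exists_chain hC
  have hmaps' : ∀ C : VanishingChain p, C.toEnd ∈ S.1 → ∃ C' : VanishingChain p,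
      C'.toEnd ∈ S.1 ∧ C'.filter = map (ratMap (ratIter R n)) C.filter := fun C hC => by
    obtain ⟨C', M, hC', hM⟩ := hmaps C hC
    exact ⟨C', hC', VanishingChain.filter_eq_map_of_term_eq hM⟩
  rcases hdeg with ⟨hsing | hirr, hdeg⟩ | ⟨S', e, e', r, he, he', hr, rfl⟩
  · exact (not_repelling_of_singular hsing hQ hd hmaps hdeg).elim
  · exact (not_repelling_of_irrational hirr hQ hd hmaps' hdeg).elim
  have hinf : ∃ ζ ζ', ζ ≠ ζ' ∧ ((e ζ).ball ∩ X).Nonempty ∧ ((e ζ').ball ∩ X).Nonempty := by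
    -- A parametrized point has disjoint nonempty balls, so it cannot be singular: a singular point
    -- has the whole line as its only ball.
    rcases hSX with ⟨-, P, hP, P', hP', hne, h, h'⟩ | ⟨⟨P, hP, hS⟩, -⟩
    · rw [he.1] at hP hP'
      obtain ⟨ζ, rfl⟩ := hP
      obtain ⟨ζ', rfl⟩ := hP'
      exact ⟨ζ, ζ', fun h => hne (by rw [h]), h, h'⟩
    · obtain ⟨a, c, χ, -, -, hball, hcover, hdisj⟩ := he.exists_chart
      have huniv : ∀ ζ, (e ζ).ball = Set.univ := fun ζ => by
        have h1 : e ζ ∈ S.1 := by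
          rw [he.1]
          exact Set.mem_range_self ζ
        rw [hS] at h1
        rw [Set.mem_singleton_iff.1 h1]
        exact hP
      have := hdisj OnePoint.infty ((0 : ResidueField p) : OnePoint (ResidueField p))
        OnePoint.infty (by rw [← hball, huniv]; trivial) (by rw [← hball, huniv]; trivial)
      exact absurd this (OnePoint.infty_ne_coe _)
  obtain ⟨ζ₁, ζ₂, hne, h₁, h₂⟩ := hinf
  obtain ⟨Z, hZX, hZ, ζ, ζ', hne, h₁, h₂⟩ := hX.exists_affinoid (β := fun ζ => (e ζ).ball)
    (fun x => by
      obtain ⟨a, c, χ, -, -, hball, hcover, -⟩ := he.exists_chart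
      obtain ⟨ζ, hζ⟩ := hcover x
      exact ⟨ζ, by rwa [hball]⟩) hne h₁ h₂
  refine finite_of_rational he he' hQ hd hr hmaps' hZ hne h₁ h₂ ?_ ?_
  · rw [hQeq]
    exact preimage_compl_iUnion_image_subset _ _ _
  · rw [Set.disjoint_left]
    intro x hx hxZ
    exact hx (Set.mem_iUnion.2 ⟨0, x, hZX hxZ, rfl⟩)

end Rational

end

end PadicDynamics
theorem mainTheorem6 (p : ℕ) [Fact p.Prime] (R : RatFunc ℂ_[p])
    (hR : 2 ≤ PadicDynamics.ratDegree R)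
    (X : Set (PadicDynamics.PLine p)) (hX : PadicDynamics.IsOpenAnalyticSpace X)
    (S : PadicDynamics.HypSpace p) (hS : PadicDynamics.IsRepellingPeriodic R S)
    (hSX : S.Separates X) :
    (PadicDynamics.exceptionalSet R).encard ≤ 2 ∧
      (PadicDynamics.exceptionalSet R)ᶜ ⊆ ⋃ n : ℕ, (PadicDynamics.ratMap R)^[n] '' X := by
  exact ⟨PadicDynamics.encard_exceptionalSet_le R hR,
    PadicDynamics.compl_exceptionalSet_subset_of_finite R X (hS.finite_compl hR hX hSX)⟩
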